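/- Setting. For points $X=(x_1,\dots,x_n)$ in $\mathbb{R}^d$ with the Euclidean distance and a family $C$ of $k$ centers in $\mathbb{R}^d$ let $d(x,C)=\min_{c\in C}d(x,c)$, and let $f_z^X(C)$ be the sum of $d^2(x,C)$ over the points $x$ of $X$ that remain after the $z$ points with the largest distance to $C$ are discarded. Let $\mathrm{Opt}(X,k,z)=\inf_C f_z^X(C)$. A (possibly randomized) algorithm $\mathcal{A}$ for $k$-means is $\alpha$-approximate if, for all $m,k,d$, all points $y_1,\dots,y_m\in\mathbb{R}^d$ and all multiplicities $w_1,\dots,w_m\in\mathbb{N}$, each of its possible outputs $C$ satisfies $\sum_i w_i d^2(y_i,C)\le\alpha\,\inf_{C'}\sum_i w_i d^2(y_i,C')$, where $C'$ ranges over families of $k$ centers. Algorithms run on a randomized real RAM (unit-cost arithmetic on natural and on real numbers, comparisons, indirect addressing, coins with a computed bias) and may use $\mathcal{A}$ as a black box, where a call of $\mathcal{A}$ on $m$ points (with multiplicities) of $\mathbb{R}^d$ and $k$ centers costs $T(m,k,d)$ steps, with $T$ nondecreasing in $m$. Theorem. There are a single randomized algorithm with black-box access to a $k$-means algorithm, a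 constant $\delta>0$ and a constant $c\in\mathbb{N}$ such that the following holds for every $\alpha\ge 1$, every $\alpha$-approximate $k$-means algorithm $\mathcal{A}$ with running time $T$, all integers $n\ge2$, $d\ge1$, $k\ge1$, $z\ge0$ and all $X=(x_1,\dots,x_n)$ in $\mathbb{R}^d$ (not necessarily distinct). On input $(X,k,z)$ the algorithm outputs $k$ centers $C$ such that, with probability at least $\delta$, $$f^X_{ckz}(C)\le c\,\alpha\cdot\mathrm{Opt}(X,k,z),$$ and its expected running time is at most $c\,k\,d\,n\log^2 n+T(\lceil c\,k\log n\rceil,k,d)$. In particular, if $\alpha=O(1)$, it outputs with constant probability an $O(1)$-approximate solution to $k$-means with outliers that discards $O(kz)$ outliers, in expected time $O(kdn\log^2 n)+T(O(k\log n))$. -/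

import Mathlib

open scoped ENNReal

namespace KMeansOutliers

noncomputable section

/-! ## The clustering problems -/

/-- Points of `ℝ^d` with the Euclidean distance. -/
abbrev Pt (d : ℕ) : Type := EuclideanSpace ℝ (Fin d)

/-- `d(x, C) = min_{c ∈ C} d(x, c)`, for a family `C` of `k` centers. -/
def distTo {d k : ℕ} (x : Pt d) (C : Fin k → Pt d) : ℝ := ⨅ j : Fin k, dist x (C j)

/-- `f_z^X(C)`: the sum of `d²(x, C)` over the points of `X` that remain after the `z` points with
the highest assignment cost are discarded (everything is discarded if `z ≥ n`), written as the
least cost that can be reached by discarding at most `z` points; see `outlierCost_eq`.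
The points `X i` need not be distinct. -/
def outlierCost {n d k : ℕ} (z : ℕ) (X : Fin n → Pt d) (C : Fin k → Pt d) : ℝ :=
  ⨅ R : {R : Finset (Fin n) // R.card ≤ z}, ∑ i ∈ R.1ᶜ, distTo (X i) C ^ 2

/-- If `R` consists of `z` points of `X` that are farthest from `C`, then `f_z^X(C)` is the cost of
the points outside `R`. -/
theorem outlierCost_eq {n d k : ℕ} (z : ℕ) (X : Fin n → Pt d) (C : Fin k → Pt d)
    (R : Finset (Fin n)) (hR : R.card = z)
    (hfar : ∀ i ∈ R, ∀ j ∉ R, distTo (X j) C ≤ distTo (X i) C) :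
    outlierCost z X C = ∑ i ∈ Rᶜ, distTo (X i) C ^ 2 := by
  have h0 : ∀ i, 0 ≤ distTo (X i) C := fun i => Real.iInf_nonneg fun _ => dist_nonneg
  have hbdd : BddBelow (Set.range fun Q : {Q : Finset (Fin n) // Q.card ≤ z} =>
      ∑ i ∈ Q.1ᶜ, distTo (X i) C ^ 2) :=
    ⟨0, by rintro _ ⟨Q, rfl⟩; exact Finset.sum_nonneg fun i _ => sq_nonneg _⟩
  have : Nonempty {Q : Finset (Fin n) // Q.card ≤ z} := ⟨⟨R, hR.le⟩⟩
  refine le_antisymm (ciInf_le hbdd ⟨R, hR.le⟩) (le_ciInf ?_)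
  rintro ⟨Q, hQ⟩
  set f : Fin n → ℝ := fun i => distTo (X i) C ^ 2 with hf
  have hfar' : ∀ i ∈ R, ∀ j ∉ R, f j ≤ f i := fun i hi j hj =>
    pow_le_pow_left₀ (h0 j) (hfar i hi j hj) 2
  have e1 := Finset.sum_compl_add_sum R f
  have e2 := Finset.sum_compl_add_sum Q f
  have s1 := Finset.sum_inter_add_sum_sdiff R Q f
  have s2 := Finset.sum_inter_add_sum_sdiff Q R f
  rw [Finset.inter_comm Q R] at s2
  have hcard : (Q \ R).card ≤ (R \ Q).card := by
    have a := Finset.card_sdiff_add_card_inter R Q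
    have b := Finset.card_sdiff_add_card_inter Q R
    rw [Finset.inter_comm Q R] at b
    omega
  have key : ∑ i ∈ Q \ R, f i ≤ ∑ i ∈ R \ Q, f i := by
    rcases (R \ Q).eq_empty_or_nonempty with h | h
    · have hz : Q \ R = ∅ := by
        rw [h, Finset.card_empty] at hcard
        exact Finset.card_eq_zero.mp (Nat.le_zero.mp hcard)
      rw [h, hz]
    · obtain ⟨a, ha, hmin⟩ := Finset.exists_min_image (R \ Q) f h
      have ha' := (Finset.mem_sdiff.mp ha).1
      calc ∑ i ∈ Q \ R, f i ≤ (Q \ R).card • f a :=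
            Finset.sum_le_card_nsmul _ _ _ fun i hi =>
              hfar' a ha' i (Finset.mem_sdiff.mp hi).2
        _ ≤ (R \ Q).card • f a := nsmul_le_nsmul_left (sq_nonneg _) hcard
        _ ≤ ∑ i ∈ R \ Q, f i := Finset.card_nsmul_le_sum _ _ _ hmin
  change ∑ i ∈ Rᶜ, f i ≤ ∑ i ∈ Qᶜ, f i
  linarith

/-- `Opt(X, k, z)`, the optimal value of `k`-means with `z` outliers. -/
def outlierOpt {n d : ℕ} (X : Fin n → Pt d) (k z : ℕ) : ℝ :=
  ⨅ C : Fin k → Pt d, outlierCost z X C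

/-- The (weighted) `k`-means cost, without outliers; the point `Y i` has multiplicity `w i`. -/
def weightedCost {m d k : ℕ} (Y : Fin m → Pt d) (w : Fin m → ℕ) (C : Fin k → Pt d) : ℝ :=
  ∑ i, (w i : ℝ) * distTo (Y i) C ^ 2

/-- The optimal value of (weighted) `k`-means, without outliers. -/
def weightedOpt {m d : ℕ} (Y : Fin m → Pt d) (w : Fin m → ℕ) (k : ℕ) : ℝ :=
  ⨅ C : Fin k → Pt d, weightedCost Y w C

/-- A (possibly randomized) algorithm for weighted `k`-means, seen from outside: on every instance
it has a distribution of outputs. -/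
abbrev KMeansAlg : Type :=
  ∀ (m k d : ℕ), (Fin m → Pt d) → (Fin m → ℕ) → PMF (Fin k → Pt d)

/-- Every possible output of `A` is an `α`-approximate solution to `k`-means. -/
def KMeansAlg.IsApprox (A : KMeansAlg) (α : ℝ) : Prop :=
  ∀ (m k d : ℕ) (Y : Fin m → Pt d) (w : Fin m → ℕ), ∀ C ∈ (A m k d Y w).support,
    weightedCost Y w C ≤ α * weightedOpt Y w k

/-! ## The machine model

A randomized real RAM: an array of natural numbers (indices, counters, flags) and an array of real
numbers, with unit-cost arithmetic and comparisons and indirect addressing; there is no rounding and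
no conversion from reals to integers. Programs are finite and structured. Repetition is by counted
loops only, so every program halts; this restricts the programs, and makes the existence of a
program a stronger claim. -/

/-- The memory. -/
structure Mem where
  nat : ℕ → ℕ
  real : ℕ → ℝ

/-- Integer expressions; `load e` reads the cell of the integer array with address `e`. -/
inductive NExp : Type
  | lit (c : ℕ)
  | load (addr : NExp)
  | add (a b : NExp)
  | sub (a b : NExp)
  | mul (a b : NExp)

/-- Real expressions; `load e` reads the cell of the real array with address `e`. -/
inductive RExp : Type
  | ofNat (e : NExp)
  | load (addr : NExp)
  | add (a b : RExp)
  | sub (a b : RExp)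
  | mul (a b : RExp)
  | div (a b : RExp)

/-- Tests: comparison of two integers or of two reals. -/
inductive Test : Type
  | natLe (a b : NExp)
  | realLe (a b : RExp)

/-- Programs.
* `setNat a e` and `setReal a e` store the value of `e` in the cell with address `a`;
* `flip a e` stores in the integer cell with address `a` the outcome of a fresh independent coin
  that shows `1` with probability `e` (cut off to `[0, 1]`) and `0` otherwise;
* `loop e p` runs `p` as often as the value of `e` at the start of the loop;
* `call m k d pts wts out` runs the black-box `k`-means algorithm on the `m` points of `ℝ^d` stored
  row by row in the real array from address `pts` on, with the weights stored in the integer array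
  from address `wts` on, and stores the `k` centers row by row in the real array from `out` on. -/
inductive Prog : Type
  | setNat (addr e : NExp)
  | setReal (addr : NExp) (e : RExp)
  | flip (addr : NExp) (bias : RExp)
  | seq (p q : Prog)
  | ite (t : Test) (p q : Prog)
  | loop (e : NExp) (p : Prog)
  | call (m k d pts wts out : NExp)

/-- Value of an integer expression; `sub` is truncated subtraction. -/
def NExp.eval (s : Mem) : NExp → ℕ
  | lit c => c
  | load a => s.nat (a.eval s)
  | add a b => a.eval s + b.eval s
  | sub a b => a.eval s - b.eval s
  | mul a b => a.eval s * b.eval s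

/-- Value of a real expression; division by zero gives zero. -/
def RExp.eval (s : Mem) : RExp → ℝ
  | ofNat e => (e.eval s : ℝ)
  | load a => s.real (a.eval s)
  | add a b => a.eval s + b.eval s
  | sub a b => a.eval s - b.eval s
  | mul a b => a.eval s * b.eval s
  | div a b => a.eval s / b.eval s

/-- Truth of a test. -/
def Test.holds (s : Mem) : Test → Prop
  | natLe a b => a.eval s ≤ b.eval s
  | realLe a b => a.eval s ≤ b.eval s

/-- A coin that shows `true` with probability `r`, cut off to `[0, 1]`. -/
def coin (r : ℝ) : PMF Bool :=
  PMF.ofFintype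
    (fun b => ENNReal.ofReal (if b then max 0 (min 1 r) else 1 - max 0 (min 1 r))) (by
      have h0 : (0 : ℝ) ≤ max 0 (min 1 r) := le_max_left _ _
      have h1 : max 0 (min 1 r) ≤ (1 : ℝ) := max_le zero_le_one (min_le_left _ _)
      simp only [Fintype.sum_bool, if_true, Bool.false_eq_true, if_false]
      rw [← ENNReal.ofReal_add h0 (by linarith)]
      simp)

/-- Store `v` in the integer cell `a`. -/
def Mem.setNat (s : Mem) (a v : ℕ) : Mem := { s with nat := Function.update s.nat a v }

/-- Store `v` in the real cell `a`. -/
def Mem.setReal (s : Mem) (a : ℕ) (v : ℝ) : Mem := { s with real := Function.update s.real a v }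

/-- The `m` points of `ℝ^d` that are stored row by row in the real array from address `a` on. -/
def Mem.readPts (s : Mem) (a m d : ℕ) : Fin m → Pt d :=
  fun i => WithLp.toLp 2 fun j => s.real (a + (d * (i : ℕ) + (j : ℕ)))

/-- Store `m` points of `ℝ^d` row by row in the real array from address `a` on. -/
def Mem.writePts (s : Mem) (a : ℕ) {m d : ℕ} (C : Fin m → Pt d) : Mem :=
  { s with real := fun b =>
      if h : a ≤ b ∧ b - a < m * d then
        let q : Fin m × Fin d := finProdFinEquiv.symm ⟨b - a, h.2⟩
        (C q.1) q.2
      else s.real b }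

/-- Reading back what has been written. -/
theorem Mem.readPts_writePts (s : Mem) (a : ℕ) {m d : ℕ} (C : Fin m → Pt d) :
    (s.writePts a C).readPts a m d = C := by
  funext i
  ext j
  have hlt : d * (i : ℕ) + (j : ℕ) < m * d := by
    have := (finProdFinEquiv (i, j)).2
    rwa [finProdFinEquiv_apply_val, add_comm] at this
  have he : (⟨d * (i : ℕ) + (j : ℕ), hlt⟩ : Fin (m * d)) = finProdFinEquiv (i, j) := by
    apply Fin.ext
    simp [finProdFinEquiv_apply_val, add_comm]
  have hs := finProdFinEquiv.symm_apply_apply (i, j)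
  simp only [Mem.readPts, Mem.writePts, Nat.le_add_right, Nat.add_sub_cancel_left, hlt, he, hs,
    and_self, dite_true]

/-- `t` more steps in front of a computation that yields a memory and a number of steps. -/
def addSteps (t : ℕ) (μ : PMF (Mem × ℕ)) : PMF (Mem × ℕ) := μ.map fun r => (r.1, t + r.2)

/-- `r` repetitions of `f`; one step is charged for each repetition and one for leaving the loop. -/
def repeatSteps (f : Mem → PMF (Mem × ℕ)) : ℕ → Mem → PMF (Mem × ℕ)
  | 0, s => PMF.pure (s, 1)
  | r + 1, s => (f s).bind fun o => addSteps (1 + o.2) (repeatSteps f r o.1)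

open Classical in
/-- The joint distribution of the final memory and of the number of steps, when a program is run
with the black-box algorithm `A`, where a call of `A` on `m` points of `ℝ^d` for `k` centers takes
`T m k d` steps. Each elementary command takes one step: the expressions in it have a size that is
fixed by the program. -/
def Prog.run (A : KMeansAlg) (T : ℕ → ℕ → ℕ → ℕ) : Prog → Mem → PMF (Mem × ℕ)
  | setNat a e, s => PMF.pure (s.setNat (a.eval s) (e.eval s), 1)
  | setReal a e, s => PMF.pure (s.setReal (a.eval s) (e.eval s), 1)
  | flip a e, s => (coin (e.eval s)).map fun b => (s.setNat (a.eval s) (if b then 1 else 0), 1)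
  | seq p q, s => (p.run A T s).bind fun o => addSteps o.2 (q.run A T o.1)
  | ite t p q, s => addSteps 1 (if t.holds s then p.run A T s else q.run A T s)
  | loop e p, s => repeatSteps (p.run A T) (e.eval s) s
  | call m k d pts wts out, s =>
      (A (m.eval s) (k.eval s) (d.eval s) (s.readPts (pts.eval s) (m.eval s) (d.eval s))
          (fun i => s.nat (wts.eval s + (i : ℕ)))).map fun C =>
        (s.writePts (out.eval s) C, 1 + T (m.eval s) (k.eval s) (d.eval s))

/-- The initial memory for the instance `(X, k, z)`: the integer array starts with `n, d, k, z`, the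
real array with the coordinates of `X 0, …, X (n - 1)`; all other cells are zero. -/
def initMem {n d : ℕ} (X : Fin n → Pt d) (k z : ℕ) : Mem :=
  Mem.writePts
    { nat := fun a => if a = 0 then n else if a = 1 then d else if a = 2 then k
        else if a = 3 then z else 0
      real := fun _ => 0 } 0 X

/-- The centers that a run has put out: the first `k * d` cells of the real array. -/
def output (s : Mem) (k d : ℕ) : Fin k → Pt d := s.readPts 0 k d

/-- The expected number of steps. -/
def expectedSteps (μ : PMF (Mem × ℕ)) : ℝ≥0∞ := ∑' o, μ o * (o.2 : ℝ≥0∞)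

end

end KMeansOutliers

namespace KMeansOutliers

noncomputable section

/-! ## Notation for programs -/

/-! The algorithm replaces the instance by O(k log n) weighted points, by successive sampling, and
leaves these to the black box. For the analysis fix centers C of cost at most 4 Opt
(`exists_near_optimal`), let `a i` be the squared distance of point i to C, and let O be the at most
z points that C discards. The algorithm never sees C.

A round works on the N points not yet removed. If N ≤ 128kz it does nothing, since these points can
be discarded as outliers. Otherwise it makes independent trials. A trial draws 8k uniform samples
and one further sample, the pivot; the threshold t is the squared distance of the pivot to the
samples. Points within t of the samples are assigned to the nearest one, and samples with fewer than
N/(64k) assigned points are dropped. Among the trials that still cover N/8 points the one with the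
least threshold is kept, and the points it covers are removed.

A trial is good if it covers N/8 points and t ≤ 4 `a i` for at least N/8 of the points. This has
probability at least 1/8 (`expect_goodSample`). Let μ be a 7/8-quantile of `a`. A point with `a i` ≤
μ is within 4μ of the samples as soon as some sample with value at most μ lies in its C-cluster, and
on average at most N/8 such points stay uncovered. By Markov's inequality, 5N/8 points are within 4μ
with probability at least 1/2. Then at least N/4 choices of the pivot give t ≤ 4μ and at the same
time N/4 points within t; dropping light samples costs at most N/8 of them. A good trial stays good
when t decreases, so choosing the least threshold needs no knowledge of C. With 32 lg trials in each
of 6 lg rounds, where lg is the binary length of n, all rounds are good with probability at least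
1/2 (`success_trials`, `success_rounds`, `half_le_success`).

If all rounds are good, the number of remaining points falls by a factor 7/8 per active round, so at
most 128kz remain at the end (`card_remaining_le`). Moving the removed points to their samples costs
at most ∑ N t over the rounds. In each active round at least N/16 points outside O have t ≤ 4 `a i`,
and half of these at least are gone 27 rounds later; so the thresholds can be charged to `a` with
each point paying boundedly often (`sum_card_mul_le`, `sum_thresholds_le`).

In an active round N/(64k) > 2z, so O makes up at most half of the points assigned to any kept
sample, and the cost of C on the weighted samples is O(Opt) although no outliers are discarded there
(`weightedCost_le_of_heavy`). Every output of the black box is thus good on the samples, and by the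
triangle inequality on the removed points (`cost_of_roundsGood`).

The running time bounds hold for every outcome of the coins, hence in expectation. -/

instance : Add NExp := ⟨NExp.add⟩
instance : Sub NExp := ⟨NExp.sub⟩
instance : Mul NExp := ⟨NExp.mul⟩
instance (c : ℕ) : OfNat NExp c := ⟨NExp.lit c⟩
instance : Add RExp := ⟨RExp.add⟩
instance : Sub RExp := ⟨RExp.sub⟩
instance : Mul RExp := ⟨RExp.mul⟩
instance : Div RExp := ⟨RExp.div⟩

infixr:60 " ;; " => Prog.seq

/-- The contents of a fixed integer cell. -/
def cell (a : ℕ) : NExp := NExp.load (NExp.lit a)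

@[simp] theorem NExp.eval_lit (s : Mem) (c : ℕ) :
    (no_index (OfNat.ofNat c) : NExp).eval s = (OfNat.ofNat c : ℕ) := rfl
@[simp] theorem NExp.eval_hadd (s : Mem) (a b : NExp) : (a + b).eval s = a.eval s + b.eval s := rfl
@[simp] theorem NExp.eval_hsub (s : Mem) (a b : NExp) : (a - b).eval s = a.eval s - b.eval s := rfl
@[simp] theorem NExp.eval_hmul (s : Mem) (a b : NExp) : (a * b).eval s = a.eval s * b.eval s := rfl
@[simp] theorem NExp.eval_load (s : Mem) (a : NExp) : (NExp.load a).eval s = s.nat (a.eval s) := rfl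
@[simp] theorem eval_cell (s : Mem) (a : ℕ) : (cell a).eval s = s.nat a := rfl
@[simp] theorem RExp.eval_ofNat (s : Mem) (e : NExp) : (RExp.ofNat e).eval s = (e.eval s : ℝ) := rfl
@[simp] theorem RExp.eval_load (s : Mem) (a : NExp) :
    (RExp.load a).eval s = s.real (a.eval s) := rfl
@[simp] theorem RExp.eval_hadd (s : Mem) (a b : RExp) : (a + b).eval s = a.eval s + b.eval s := rfl
@[simp] theorem RExp.eval_hsub (s : Mem) (a b : RExp) : (a - b).eval s = a.eval s - b.eval s := rfl
@[simp] theorem RExp.eval_hmul (s : Mem) (a b : RExp) : (a * b).eval s = a.eval s * b.eval s := rfl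
@[simp] theorem RExp.eval_hdiv (s : Mem) (a b : RExp) : (a / b).eval s = a.eval s / b.eval s := rfl
@[simp] theorem Test.holds_natLe (s : Mem) (a b : NExp) :
    (Test.natLe a b).holds s ↔ a.eval s ≤ b.eval s := Iff.rfl
@[simp] theorem Test.holds_realLe (s : Mem) (a b : RExp) :
    (Test.realLe a b).holds s ↔ a.eval s ≤ b.eval s := Iff.rfl

@[simp] theorem Mem.setNat_nat (s : Mem) (a v b : ℕ) :
    (s.setNat a v).nat b = if b = a then v else s.nat b := by
  simp [Mem.setNat, Function.update_apply]
@[simp] theorem Mem.setNat_real (s : Mem) (a v : ℕ) : (s.setNat a v).real = s.real := rfl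
@[simp] theorem Mem.setReal_real (s : Mem) (a b : ℕ) (v : ℝ) :
    (s.setReal a v).real b = if b = a then v else s.real b := by
  simp [Mem.setReal, Function.update_apply]
@[simp] theorem Mem.setReal_nat (s : Mem) (a : ℕ) (v : ℝ) : (s.setReal a v).nat = s.nat := rfl

/-! ## Expectations -/

/-- The expectation of a nonnegative function. -/
def expect {β : Type*} (μ : PMF β) (f : β → ℝ≥0∞) : ℝ≥0∞ := ∑' b, μ b * f b

section expect
variable {β γ : Type*}

theorem expect_pure (b : β) (f : β → ℝ≥0∞) : expect (PMF.pure b) f = f b := by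
  rw [expect, tsum_eq_single b]
  · simp
  · intro c hc; simp [PMF.pure_apply, hc]

theorem expect_bind (μ : PMF β) (κ : β → PMF γ) (f : γ → ℝ≥0∞) :
    expect (μ.bind κ) f = expect μ fun b => expect (κ b) f := by
  simp only [expect, PMF.bind_apply, ← ENNReal.tsum_mul_right, ← ENNReal.tsum_mul_left]
  rw [ENNReal.tsum_comm]
  simp only [mul_assoc]

theorem expect_map (μ : PMF β) (h : β → γ) (f : γ → ℝ≥0∞) :
    expect (μ.map h) f = expect μ fun b => f (h b) := by
  rw [PMF.map, expect_bind]
  simp [Function.comp_apply, expect_pure]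

theorem expect_mono {μ : PMF β} {f g : β → ℝ≥0∞} (h : ∀ b ∈ μ.support, f b ≤ g b) :
    expect μ f ≤ expect μ g := by
  refine ENNReal.tsum_le_tsum fun b => ?_
  by_cases hb : b ∈ μ.support
  · exact mul_le_mul_right (h b hb) _
  · rw [PMF.mem_support_iff, not_not] at hb
    simp [hb]

theorem expect_const (μ : PMF β) (c : ℝ≥0∞) : expect μ (fun _ => c) = c := by
  rw [expect, ENNReal.tsum_mul_right, μ.tsum_coe, one_mul]

theorem expect_const_mul (μ : PMF β) (c : ℝ≥0∞) (f : β → ℝ≥0∞) :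
    expect μ (fun b => c * f b) = c * expect μ f := by
  simp only [expect, ← ENNReal.tsum_mul_left]
  exact tsum_congr fun b => by ring

theorem expect_add (μ : PMF β) (f g : β → ℝ≥0∞) :
    expect μ (fun b => f b + g b) = expect μ f + expect μ g := by
  simp only [expect, mul_add, ENNReal.tsum_add]

theorem expect_finset_sum {ι : Type*} (μ : PMF β) (I : Finset ι) (f : ι → β → ℝ≥0∞) :
    expect μ (fun b => ∑ i ∈ I, f i b) = ∑ i ∈ I, expect μ (f i) := by
  classical
  induction I using Finset.induction_on with
  | empty => simpa using expect_const μ 0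
  | insert a I ha ih => simp only [Finset.sum_insert ha, expect_add, ih]

open Classical in
/-- The indicator function of a predicate. -/
def ind (Q : β → Prop) (b : β) : ℝ≥0∞ := if Q b then 1 else 0

theorem ind_of {Q : β → Prop} {b : β} (h : Q b) : ind Q b = 1 := if_pos h
theorem ind_of_not {Q : β → Prop} {b : β} (h : ¬ Q b) : ind Q b = 0 := if_neg h
theorem ind_le_one (Q : β → Prop) (b : β) : ind Q b ≤ 1 := by
  unfold ind; split_ifs <;> simp

theorem ind_mono {Q : β → Prop} {Q' : γ → Prop} {b : β} {c : γ} (h : Q b → Q' c) :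
    ind Q b ≤ ind Q' c := by
  by_cases hb : Q b
  · rw [ind_of (h hb)]; exact ind_le_one _ _
  · rw [ind_of_not hb]; exact zero_le

theorem expect_ind (μ : PMF β) (Q : β → Prop) : expect μ (ind Q) = μ.toOuterMeasure {b | Q b} := by
  rw [PMF.toOuterMeasure_apply, expect]
  refine tsum_congr fun b => ?_
  by_cases h : Q b
  · simp [ind_of h, h]
  · simp [ind_of_not h, h]

theorem expect_le_one {μ : PMF β} {f : β → ℝ≥0∞} (h : ∀ b, f b ≤ 1) : expect μ f ≤ 1 :=
  (expect_mono fun b _ => h b).trans (expect_const μ 1).le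

theorem expect_ind_not (μ : PMF β) (Q : β → Prop) :
    expect μ (ind Q) + expect μ (ind fun b => ¬ Q b) = 1 := by
  rw [← expect_add, ← expect_const μ 1]
  congr 1
  funext b
  by_cases h : Q b
  · simp [ind, h]
  · simp [ind, h]

end expect

/-! ## Program logic -/

/-- All possible outcomes satisfy `Q` and come within `t` steps. -/
def Ensures (μ : PMF (Mem × ℕ)) (Q : Mem → Prop) (t : ℕ) : Prop :=
  ∀ o ∈ μ.support, Q o.1 ∧ o.2 ≤ t

theorem Ensures.mono {μ : PMF (Mem × ℕ)} {Q Q' : Mem → Prop} {t t' : ℕ} (h : Ensures μ Q t)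
    (hQ : ∀ s, Q s → Q' s) (ht : t ≤ t') : Ensures μ Q' t' :=
  fun o ho => ⟨hQ _ (h o ho).1, (h o ho).2.trans ht⟩

theorem expectedSteps_le {μ : PMF (Mem × ℕ)} {Q : Mem → Prop} {t : ℕ} (h : Ensures μ Q t) :
    expectedSteps μ ≤ t := by
  have : expectedSteps μ = expect μ fun o => (o.2 : ℝ≥0∞) := rfl
  rw [this, ← expect_const μ (t : ℝ≥0∞)]
  exact expect_mono fun o ho => by exact_mod_cast (h o ho).2

theorem Ensures.bind {μ : PMF (Mem × ℕ)} {κ : Mem → PMF (Mem × ℕ)} {Q : Mem → Prop} {t t' : ℕ}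
    {c : ℕ} (h : Ensures μ (fun s => Ensures (κ s) Q t') t) :
    Ensures (μ.bind fun o => addSteps (c + o.2) (κ o.1)) Q (c + t + t') := by
  intro o ho
  rw [PMF.mem_support_bind_iff] at ho
  obtain ⟨o1, h1, h2⟩ := ho
  rw [addSteps, PMF.mem_support_map_iff] at h2
  obtain ⟨o2, h3, rfl⟩ := h2
  have a := h o1 h1
  have b := a.1 o2 h3
  exact ⟨b.1, by have := a.2; have := b.2; dsimp only; omega⟩

theorem expect_addSteps (t : ℕ) (μ : PMF (Mem × ℕ)) (f : Mem → ℝ≥0∞) :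
    expect (addSteps t μ) (fun o => f o.1) = expect μ fun o => f o.1 := by
  rw [addSteps, expect_map]

theorem ensures_pure {s : Mem} {t : ℕ} {Q : Mem → Prop} (h : Q s) :
    Ensures (PMF.pure (s, t)) Q t := by
  intro o ho
  rw [PMF.support_pure, Set.mem_singleton_iff] at ho
  subst ho
  exact ⟨h, le_rfl⟩

section rules
variable {A : KMeansAlg} {T : ℕ → ℕ → ℕ → ℕ} {p q : Prog} {s : Mem} {Q : Mem → Prop}

/-- Nesting `Ensures` in the postcondition makes the rule work like a weakest precondition: a
program is executed symbolically from the front. -/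
theorem ensures_seq {t1 t2 : ℕ}
    (h : Ensures (p.run A T s) (fun s1 => Ensures (q.run A T s1) Q t2) t1) :
    Ensures ((p ;; q).run A T s) Q (t1 + t2) := by
  have := Ensures.bind (c := 0) h
  simp only [zero_add] at this
  exact this

theorem ensures_setNat {a e : NExp} (h : Q (s.setNat (a.eval s) (e.eval s))) :
    Ensures ((Prog.setNat a e).run A T s) Q 1 := ensures_pure h

theorem ensures_setReal {a : NExp} {e : RExp} (h : Q (s.setReal (a.eval s) (e.eval s))) :
    Ensures ((Prog.setReal a e).run A T s) Q 1 := ensures_pure h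

theorem ensures_setNat_seq {a e : NExp} {t : ℕ}
    (h : Ensures (q.run A T (s.setNat (a.eval s) (e.eval s))) Q t) :
    Ensures ((Prog.setNat a e ;; q).run A T s) Q (t + 1) :=
  add_comm 1 t ▸ ensures_seq (ensures_setNat h)

theorem ensures_setReal_seq {a : NExp} {e : RExp} {t : ℕ}
    (h : Ensures (q.run A T (s.setReal (a.eval s) (e.eval s))) Q t) :
    Ensures ((Prog.setReal a e ;; q).run A T s) Q (t + 1) :=
  add_comm 1 t ▸ ensures_seq (ensures_setReal h)

theorem ensures_ite {c : Test} {t : ℕ} (hp : c.holds s → Ensures (p.run A T s) Q t)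
    (hq : ¬ c.holds s → Ensures (q.run A T s) Q t) :
    Ensures ((Prog.ite c p q).run A T s) Q (t + 1) := by
  intro o ho
  rw [Prog.run, addSteps, PMF.mem_support_map_iff] at ho
  obtain ⟨o', h', rfl⟩ := ho
  split_ifs at h' with hc
  · have := hp hc o' h'
    exact ⟨this.1, by dsimp only; omega⟩
  · have := hq hc o' h'
    exact ⟨this.1, by dsimp only; omega⟩

theorem ensures_repeatSteps {f : Mem → PMF (Mem × ℕ)} {τ : ℕ} (I : ℕ → Mem → Prop) (r : ℕ)
    (hstep : ∀ i < r, ∀ s, I i s → Ensures (f s) (I (i + 1)) τ) (j i : ℕ) (hij : i + j = r)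
    (s : Mem) (hs : I i s) : Ensures (repeatSteps f j s) (I r) (j * (τ + 1) + 1) := by
  induction j generalizing i s with
  | zero => obtain rfl : i = r := by omega
            simpa [repeatSteps] using ensures_pure hs
  | succ j ih =>
    have h1 : Ensures (f s) (fun s1 => Ensures (repeatSteps f j s1) (I r) (j * (τ + 1) + 1)) τ :=
      (hstep i (by omega) s hs).mono (fun s1 h => ih (i + 1) (by omega) s1 h) le_rfl
    exact (Ensures.bind (c := 1) h1).mono (fun _ h => h) (by ring_nf; omega)

theorem ensures_loop {e : NExp} {τ : ℕ} (I : ℕ → Mem → Prop) (r : ℕ) (hr : e.eval s = r)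
    (h0 : I 0 s) (hstep : ∀ i < r, ∀ s, I i s → Ensures (p.run A T s) (I (i + 1)) τ) :
    Ensures ((Prog.loop e p).run A T s) (I r) (r * (τ + 1) + 1) := by
  rw [Prog.run, hr]
  exact ensures_repeatSteps I r hstep r 0 (by omega) s h0

end rules

/-! ### Success probabilities -/

/-- The probability that the final memory satisfies `G`. -/
def success (μ : PMF (Mem × ℕ)) (G : Mem → Prop) : ℝ≥0∞ := expect μ fun o => ind G o.1

theorem success_eq (μ : PMF (Mem × ℕ)) (G : Mem → Prop) :
    success μ G = μ.toOuterMeasure {o | G o.1} := expect_ind μ fun o => G o.1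

theorem Ensures.success {μ : PMF (Mem × ℕ)} {Q G : Mem → Prop} {t : ℕ} (h : Ensures μ Q t)
    (hG : ∀ s, Q s → G s) : success μ G = 1 := by
  refine le_antisymm (expect_le_one fun _ => ind_le_one _ _) ?_
  rw [← expect_const μ 1]
  exact expect_mono fun o ho => by rw [ind_of (hG _ (h o ho).1)]

theorem success_mono {μ : PMF (Mem × ℕ)} {Q G G' : Mem → Prop} {t : ℕ} (h : Ensures μ Q t)
    (hG : ∀ s, Q s → G s → G' s) : success μ G ≤ success μ G' :=
  expect_mono fun o ho => ind_mono (hG _ (h o ho).1)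

theorem success_bind {μ : PMF (Mem × ℕ)} {κ : Mem → PMF (Mem × ℕ)} {c : ℕ} (G : Mem → Prop) :
    success (μ.bind fun o => addSteps (c + o.2) (κ o.1)) G
      = expect μ fun o => success (κ o.1) G := by
  rw [success, expect_bind]
  simp only [expect_addSteps]
  rfl

/-- Success probabilities multiply along a sequence. -/
theorem success_bind_ge {μ : PMF (Mem × ℕ)} {κ : Mem → PMF (Mem × ℕ)} {c : ℕ} {Q G G' : Mem → Prop}
    {t : ℕ} {a b : ℝ≥0∞} (hμ : Ensures μ Q t) (ha : a ≤ success μ G)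
    (hb : ∀ s, Q s → G s → b ≤ success (κ s) G') :
    b * a ≤ success (μ.bind fun o => addSteps (c + o.2) (κ o.1)) G' := by
  rw [success_bind]
  refine (mul_le_mul_right ha b).trans ?_
  rw [success, ← expect_const_mul]
  refine expect_mono fun o ho => ?_
  by_cases h : G o.1
  · rw [ind_of h, mul_one]; exact hb _ (hμ o ho).1 h
  · rw [ind_of_not h, mul_zero]; exact zero_le

theorem success_seq_ge {A : KMeansAlg} {T : ℕ → ℕ → ℕ → ℕ} {p q : Prog} {s : Mem}
    {Q G G' : Mem → Prop} {t : ℕ} {a b : ℝ≥0∞} (hμ : Ensures (p.run A T s) Q t)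
    (ha : a ≤ success (p.run A T s) G) (hb : ∀ s, Q s → G s → b ≤ success (q.run A T s) G') :
    b * a ≤ success ((p ;; q).run A T s) G' := by
  have := success_bind_ge (c := 0) hμ ha hb
  simp only [zero_add] at this
  exact this

theorem success_ite {A : KMeansAlg} {T : ℕ → ℕ → ℕ → ℕ} {p q : Prog} {s : Mem} {c : Test}
    {G : Mem → Prop} {a : ℝ≥0∞} (hp : c.holds s → a ≤ success (p.run A T s) G)
    (hq : ¬ c.holds s → a ≤ success (q.run A T s) G) :
    a ≤ success ((Prog.ite c p q).run A T s) G := by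
  rw [Prog.run, success, expect_addSteps]
  split_ifs with h
  · exact hp h
  · exact hq h

/-- Every repetition succeeds with probability at least `a`. -/
theorem success_loop_all {f : Mem → PMF (Mem × ℕ)} {τ : ℕ} (I G : ℕ → Mem → Prop) (r : ℕ)
    (hstep : ∀ i < r, ∀ s, I i s → Ensures (f s) (I (i + 1)) τ) {a : ℝ≥0∞}
    (hG : ∀ i < r, ∀ s, I i s → G i s → a ≤ success (f s) (G (i + 1))) (j i : ℕ) (hij : i + j = r)
    (s : Mem) (hs : I i s) (hg : G i s) : a ^ j ≤ success (repeatSteps f j s) (G r) := by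
  induction j generalizing i s with
  | zero => obtain rfl : i = r := by omega
            simp [repeatSteps, success, expect_pure, ind_of hg]
  | succ j ih =>
    rw [pow_succ]
    exact success_bind_ge (c := 1) (κ := repeatSteps f j) (hstep i (by omega) s hs)
      (hG i (by omega) s hs hg) fun s1 h1 h2 => ih (i + 1) (by omega) s1 h1 h2

/-- Failing `r` times in a row. -/
theorem success_loop_some {f : Mem → PMF (Mem × ℕ)} {τ : ℕ} (I G : Mem → Prop)
    (hI : ∀ s, I s → Ensures (f s) I τ) (hG : ∀ s, I s → G s → Ensures (f s) G τ) {a : ℝ≥0∞}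
    (ha : ∀ s, I s → a ≤ success (f s) G) (r : ℕ) (s : Mem) (hs : I s) :
    expect (repeatSteps f r s) (fun o => ind (fun s => ¬ G s) o.1) ≤ (1 - a) ^ r := by
  have hfail : ∀ s, I s → expect (f s) (fun o => ind (fun s => ¬ G s) o.1) ≤ 1 - a := by
    intro s hs
    have h := expect_ind_not (f s) fun o => G o.1
    have h' : expect (f s) (fun o => ind (fun s => ¬ G s) o.1)
        = expect (f s) (ind fun o => ¬ G o.1) := rfl
    have h2 : a ≤ expect (f s) (ind fun o => G o.1) := ha s hs
    rw [h']
    refine ENNReal.le_sub_of_add_le_right ?_ ?_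
    · exact ne_top_of_le_ne_top ENNReal.one_ne_top (h2.trans (expect_le_one fun _ => ind_le_one _ _))
    · rw [← h, add_comm]; gcongr
  -- Success is never undone by later repetitions, so after a success the failure probability is
  -- exactly zero.
  have hgood : ∀ r s, I s → G s →
      expect (repeatSteps f r s) (fun o => ind (fun s => ¬ G s) o.1) = 0 := by
    intro r
    induction r with
    | zero => intro s _ hg; simp [repeatSteps, expect_pure, ind, hg]
    | succ r ih =>
      intro s hs hg
      rw [repeatSteps, expect_bind]
      simp only [expect_addSteps]
      refine le_antisymm ?_ zero_le
      rw [← expect_const (f s) 0]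
      exact expect_mono fun o ho => (ih o.1 (hI s hs o ho).1 (hG s hs hg o ho).1).le
  induction r generalizing s with
  | zero => simp [repeatSteps, expect_pure, ind_le_one]
  | succ r ih =>
    rw [repeatSteps, expect_bind, pow_succ]
    simp only [expect_addSteps]
    refine le_trans ?_ (mul_le_mul_right (hfail s hs) _)
    rw [← expect_const_mul]
    refine expect_mono fun o ho => ?_
    by_cases h : G o.1
    · rw [hgood r o.1 (hI s hs o ho).1 h]; exact zero_le
    · rw [ind_of (Q := fun s => ¬ G s) h, mul_one]; exact ih _ (hI s hs o ho).1

/-! ### Abstraction to a distribution on another type -/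

/-- `μ` ends within `t` steps in memories that represent, via `R`, a value distributed like `ν`. -/
structure Refines {β : Type*} (μ : PMF (Mem × ℕ)) (ν : PMF β) (R : β → Mem → Prop) (t : ℕ) :
    Prop where
  ensures : Ensures μ (fun s => ∃ b, R b s) t
  le_expect : ∀ (g : β → ℝ≥0∞) (f : Mem → ℝ≥0∞), (∀ b s, R b s → g b ≤ f s) →
    expect ν g ≤ expect μ fun o => f o.1

section refines
variable {β γ : Type*} {A : KMeansAlg} {T : ℕ → ℕ → ℕ → ℕ} {p q : Prog} {s : Mem}

theorem Ensures.refines {μ : PMF (Mem × ℕ)} {b : β} {R : β → Mem → Prop} {t : ℕ}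
    (h : Ensures μ (R b) t) : Refines μ (PMF.pure b) R t :=
  ⟨h.mono (fun _ h => ⟨b, h⟩) le_rfl, fun g f hfg => by
    rw [expect_pure, ← expect_const μ (g b)]
    exact expect_mono fun o ho => hfg _ _ (h o ho).1⟩

/-- The inner expectations, seen as functions of the abstract value and of the memory, satisfy the
same domination on related pairs; so the inequality of the first computation can be applied to them.
-/
theorem Refines.bind {μ : PMF (Mem × ℕ)} {κ : Mem → PMF (Mem × ℕ)} {c : ℕ} {ν : PMF β}
    {ν' : β → PMF γ} {R : β → Mem → Prop} {R' : γ → Mem → Prop} {t t' : ℕ}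
    (h : Refines μ ν R t) (h' : ∀ b s, R b s → Refines (κ s) (ν' b) R' t') :
    Refines (μ.bind fun o => addSteps (c + o.2) (κ o.1)) (ν.bind ν') R' (c + t + t') := by
  refine ⟨Ensures.bind (h.ensures.mono (fun s ⟨b, hb⟩ => (h' b s hb).ensures) le_rfl), ?_⟩
  intro g f hfg
  rw [expect_bind, expect_bind]
  simp only [expect_addSteps]
  exact h.le_expect _ (fun s => expect (κ s) fun o => f o.1)
    fun b s hb => (h' b s hb).le_expect g f hfg

theorem Refines.seq {ν : PMF β} {ν' : β → PMF γ} {R : β → Mem → Prop} {R' : γ → Mem → Prop}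
    {t t' : ℕ} (h : Refines (p.run A T s) ν R t)
    (h' : ∀ b s, R b s → Refines (q.run A T s) (ν' b) R' t') :
    Refines ((p ;; q).run A T s) (ν.bind ν') R' (t + t') := by
  have := Refines.bind (c := 0) h h'
  simp only [zero_add] at this
  exact this

theorem Refines.mono {μ : PMF (Mem × ℕ)} {ν : PMF β} {R R' : β → Mem → Prop} {t t' : ℕ}
    (h : Refines μ ν R t) (hR : ∀ b s, R b s → R' b s) (ht : t ≤ t') : Refines μ ν R' t' :=
  ⟨h.ensures.mono (fun s ⟨b, hb⟩ => ⟨b, hR b s hb⟩) ht,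
    fun g f hfg => h.le_expect g f fun b s hb => hfg b s (hR b s hb)⟩

/-- Only outcomes in the support have to be represented. This matters for coins of bias 0 or 1,
where the impossible outcome would break the relation. -/
theorem refines_flip {a : NExp} {e : RExp} {R : Bool → Mem → Prop}
    (h : ∀ b ∈ (coin (e.eval s)).support, R b (s.setNat (a.eval s) (if b then 1 else 0))) :
    Refines ((Prog.flip a e).run A T s) (coin (e.eval s)) R 1 := by
  constructor
  · intro o ho
    rw [Prog.run, PMF.mem_support_map_iff] at ho
    obtain ⟨b, hb, rfl⟩ := ho
    exact ⟨⟨b, h b hb⟩, le_rfl⟩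
  · intro g f hfg
    rw [Prog.run, expect_map]
    exact expect_mono fun b hb => hfg _ _ (h b hb)

/-- The distribution after `r` steps of an inhomogeneous Markov chain. -/
def chain (ν : ℕ → β → PMF β) (b : β) : ℕ → PMF β
  | 0 => PMF.pure b
  | r + 1 => (chain ν b r).bind (ν r)

/-- A chain grows at its end, while a loop is unfolded from its beginning; this reconciles the two.
-/
theorem chain_bind_shift (ν : ℕ → β → PMF β) (j i : ℕ) (b : β) :
    (ν i b).bind (fun b' => chain (fun l => ν (i + 1 + l)) b' j)
      = chain (fun l => ν (i + l)) b (j + 1) := by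
  induction j with
  | zero => simp [chain]
  | succ j ih =>
    rw [chain, ← ih, PMF.bind_bind]
    simp only [chain]
    congr 1
    funext b'
    congr 2
    omega

theorem refines_repeatSteps {f : Mem → PMF (Mem × ℕ)} {τ : ℕ} (R : ℕ → β → Mem → Prop)
    (ν : ℕ → β → PMF β) (r : ℕ)
    (hstep : ∀ i < r, ∀ b s, R i b s → Refines (f s) (ν i b) (R (i + 1)) τ) (j i : ℕ)
    (hij : i + j = r) (b : β) (s : Mem) (hs : R i b s) :
    Refines (repeatSteps f j s) (chain (fun l => ν (i + l)) b j) (R r) (j * (τ + 1) + 1) := by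
  induction j generalizing i b s with
  | zero => obtain rfl : i = r := by omega
            simpa [repeatSteps, chain] using (ensures_pure (Q := R i b) hs).refines
  | succ j ih =>
    have h1 := Refines.bind (c := 1) (κ := repeatSteps f j) (hstep i (by omega) b s hs)
      fun b' s' h' => ih (i + 1) (by omega) b' s' h'
    rw [chain_bind_shift] at h1
    exact h1.mono (fun _ _ h => h) (by ring_nf; omega)

theorem refines_loop {e : NExp} {τ : ℕ} (R : ℕ → β → Mem → Prop) (ν : ℕ → β → PMF β) (r : ℕ)
    (hr : e.eval s = r) (b : β) (h0 : R 0 b s)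
    (hstep : ∀ i < r, ∀ b s, R i b s → Refines (p.run A T s) (ν i b) (R (i + 1)) τ) :
    Refines ((Prog.loop e p).run A T s) (chain ν b r) (R r) (r * (τ + 1) + 1) := by
  rw [Prog.run, hr]
  simpa using refines_repeatSteps R ν r hstep r 0 (by omega) b s h0

end refines

/-! ## The algorithm

Integer cells: `0`-`3` hold `n, d, k, z`; `4` a binary logarithm of `n`; `5` the number of slots for
candidate centers; `6` the number of samples of a trial; `7` a power of two; `8` the number of
remaining points; `9` the first slot of the current round; `10` whether a trial has been saved;
`16`-`31` are scratch. Three arrays are interleaved from cell `32` on: whether a point has been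
removed, the point in a slot, the weight of a slot.
Real cells: the coordinates, then the saved threshold, the threshold, the least distance, and the
current distance; then the points for the black box. -/

/-- The number of coordinates. -/
def coordsE : NExp := cell 0 * cell 1
/-- Address of the flag telling that the point `e` has been removed. -/
def delA (e : NExp) : NExp := 3 * e + 32
/-- Address of the index of the point in slot `e`. -/
def idxA (e : NExp) : NExp := 3 * e + 33
/-- Address of the weight of slot `e`. -/
def wtA (e : NExp) : NExp := 3 * e + 34

/-- Does nothing of interest. -/
def skipP : Prog := Prog.setNat 31 0

/-- Squared distance between point `cell 18` and the point in slot `cell 20 + cell 29`. -/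
def distP : Prog :=
  Prog.setReal (coordsE + 3) (.ofNat 0) ;;
  Prog.setNat 31 0 ;;
  Prog.loop (cell 1)
    (Prog.setReal (coordsE + 3) (.load (coordsE + 3) +
      (.load (cell 1 * cell 18 + cell 31)
        - .load (cell 1 * .load (idxA (cell 20 + cell 29)) + cell 31)) *
      (.load (cell 1 * cell 18 + cell 31)
        - .load (cell 1 * .load (idxA (cell 20 + cell 29)) + cell 31))) ;;
    Prog.setNat 31 (cell 31 + 1))

/-- The closest of the slots from `cell 20` on to point `cell 18`. -/
def nearestP : Prog :=
  Prog.setNat 29 0 ;;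
  distP ;;
  Prog.setReal (coordsE + 2) (.load (coordsE + 3)) ;;
  Prog.setNat 28 0 ;;
  Prog.loop (cell 6)
    (distP ;;
    Prog.ite (.realLe (.load (coordsE + 2)) (.load (coordsE + 3))) skipP
      (Prog.setReal (coordsE + 2) (.load (coordsE + 3)) ;; Prog.setNat 28 (cell 29)) ;;
    Prog.setNat 29 (cell 29 + 1))

/-- A uniformly random remaining point, stored in slot `cell 5 + cell 16`. -/
def sampleP : Prog :=
  Prog.setNat 17 0 ;;
  Prog.setNat 18 0 ;;
  Prog.loop (cell 0)
    (Prog.setNat 17 (cell 17 + (1 - .load (delA (cell 18)))) ;;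
    -- Reservoir sampling: the l-th remaining point met replaces the stored one with probability
    -- 1/l. A removed point has bias 0, also when the quotient is 0/0 because no remaining point has
    -- been met.
    Prog.flip 19 (.ofNat (1 - .load (delA (cell 18))) / .ofNat (cell 17)) ;;
    -- The coin is 0 or 1, so this keeps or overwrites the slot without a branch.
    Prog.setNat (idxA (cell 5 + cell 16))
      (cell 19 * cell 18 + (1 - cell 19) * .load (idxA (cell 5 + cell 16))) ;;
    Prog.setNat 18 (cell 18 + 1))

/-- The samples of a trial. -/
def samplesP : Prog :=
  Prog.setNat 16 0 ;;
  -- The extra last sample is the pivot; it determines the threshold and is not a candidate center.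
  Prog.loop (cell 6 + 1) (sampleP ;; Prog.setNat 16 (cell 16 + 1))

/-- The threshold is the squared distance of the last sample to the others; clear the weights. -/
def thresholdP : Prog :=
  Prog.setNat 18 (.load (idxA (cell 5 + cell 6))) ;;
  Prog.setNat 20 (cell 5) ;;
  nearestP ;;
  Prog.setReal (coordsE + 1) (.load (coordsE + 2)) ;;
  Prog.setNat 21 0 ;;
  Prog.loop (cell 6)
    (Prog.setNat (wtA (cell 5 + cell 21)) 0 ;; Prog.setNat 21 (cell 21 + 1))

/-- Count the remaining points that are assigned to each sample. -/
def countP : Prog :=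
  Prog.setNat 18 0 ;;
  Prog.loop (cell 0)
    (Prog.ite (.natLe (.load (delA (cell 18))) 0)
      (nearestP ;;
      Prog.ite (.realLe (.load (coordsE + 2)) (.load (coordsE + 1)))
        (Prog.setNat (wtA (cell 5 + cell 28)) (.load (wtA (cell 5 + cell 28)) + 1)) skipP)
      skipP ;;
    Prog.setNat 18 (cell 18 + 1))

/-- Clear the weights of samples with few points, and sum up the others. -/
def heavyP : Prog :=
  Prog.setNat 22 0 ;;
  Prog.setNat 21 0 ;;
  Prog.loop (cell 6)
    -- With 8k samples the weight must be at least 1/(64k) of the remaining points. Clearing lighter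
    -- samples loses at most 1/8 of these points in total.
    (Prog.ite (.natLe (cell 8) (8 * cell 6 * .load (wtA (cell 5 + cell 21))))
      (Prog.setNat 22 (cell 22 + .load (wtA (cell 5 + cell 21))))
      (Prog.setNat (wtA (cell 5 + cell 21)) 0) ;;
    Prog.setNat 21 (cell 21 + 1))

/-- Save the trial. -/
def saveP : Prog :=
  Prog.setNat 10 1 ;;
  Prog.setReal coordsE (.load (coordsE + 1)) ;;
  Prog.setNat 21 0 ;;
  Prog.loop (cell 6)
    (Prog.setNat (idxA (cell 9 + cell 21)) (.load (idxA (cell 5 + cell 21))) ;;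
    Prog.setNat (wtA (cell 9 + cell 21)) (.load (wtA (cell 5 + cell 21))) ;;
    Prog.setNat 21 (cell 21 + 1))

/-- Save the trial if it covers enough points and has a smaller threshold than the saved one. -/
def selectP : Prog :=
  Prog.ite (.natLe (cell 8) (8 * cell 22))
    (Prog.ite (.natLe (cell 10) 0) saveP
      (Prog.ite (.realLe (.load coordsE) (.load (coordsE + 1))) skipP saveP))
    skipP

/-- A trial. -/
def trialP : Prog := samplesP ;; thresholdP ;; countP ;; heavyP ;; selectP

/-- Remove the points that are covered by the saved trial. -/
def removeP : Prog :=
  Prog.setNat 18 0 ;;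
  Prog.setNat 20 (cell 9) ;;
  Prog.loop (cell 0)
    (Prog.ite (.natLe (.load (delA (cell 18))) 0)
      (nearestP ;;
      Prog.ite (.realLe (.load (coordsE + 2)) (.load coordsE))
        (Prog.ite (.natLe 1 (.load (wtA (cell 9 + cell 28))))
          (Prog.setNat (delA (cell 18)) 1 ;; Prog.setNat 8 (cell 8 - 1)) skipP) skipP)
      skipP ;;
    Prog.setNat 18 (cell 18 + 1))

/-- A round. -/
def roundP : Prog :=
  -- Up to 128kz points may be left over as outliers. Above this bound, 1/(64k) of the remaining
  -- points is more than 2z, so kept samples outweigh the outliers.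
  Prog.ite (.natLe (cell 8) (128 * cell 2 * cell 3)) skipP
    (Prog.setNat 10 0 ;;
    Prog.loop (32 * cell 4) trialP ;;
    removeP) ;;
  Prog.setNat 9 (cell 9 + cell 6)

/-- Compute the parameters. -/
def setupP : Prog :=
  Prog.setNat 7 1 ;;
  Prog.loop (cell 0)
    (Prog.ite (.natLe (cell 7) (cell 0))
      (Prog.setNat 7 (2 * cell 7) ;; Prog.setNat 4 (cell 4 + 1)) skipP) ;;
  -- One block of 8k slots for each of the 6 lg rounds.
  Prog.setNat 5 (48 * cell 4 * cell 2) ;;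
  Prog.setNat 6 (8 * cell 2) ;;
  Prog.setNat 8 (cell 0)

/-- First address behind the arrays. -/
def wtsE : NExp := 3 * (cell 0 + cell 5 + cell 6) + 40

/-- Store the points and weights of all slots contiguously, and call the black box. -/
def finishP : Prog :=
  Prog.setNat 21 0 ;;
  Prog.loop (cell 5)
    (Prog.setNat 31 0 ;;
    Prog.loop (cell 1)
      (Prog.setReal (coordsE + 4 + (cell 1 * cell 21 + cell 31))
        (.load (cell 1 * .load (idxA (cell 21)) + cell 31)) ;;
      Prog.setNat 31 (cell 31 + 1)) ;;
    Prog.setNat (wtsE + cell 21) (.load (wtA (cell 21))) ;;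
    Prog.setNat 21 (cell 21 + 1)) ;;
  Prog.call (cell 5) (cell 2) (cell 1) (coordsE + 4) wtsE 0

/-- The whole algorithm. -/
def outliersP : Prog :=
  setupP ;; Prog.loop (6 * cell 4) roundP ;; finishP

/-! ## Specifications -/

/-- The data of an instance that stay fixed during a run. -/
structure Params where
  (n d k z lg : ℕ)
  coord : ℕ → ℝ

/-- The number of slots. -/
def Params.m (c : Params) : ℕ := 48 * c.lg * c.k
/-- The number of samples in a trial. -/
def Params.smp (c : Params) : ℕ := 8 * c.k
/-- The first real address behind the coordinates. -/
def Params.nd (c : Params) : ℕ := c.n * c.d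

/-- The squared distance of two points. -/
def Params.D (c : Params) (i j : ℕ) : ℝ :=
  ∑ l ∈ Finset.range c.d, (c.coord (c.d * i + l) - c.coord (c.d * j + l)) *
    (c.coord (c.d * i + l) - c.coord (c.d * j + l))

/-- The memory holds the fixed data. -/
structure Par (c : Params) (s : Mem) : Prop where
  n : s.nat 0 = c.n
  d : s.nat 1 = c.d
  k : s.nat 2 = c.k
  z : s.nat 3 = c.z
  lg : s.nat 4 = c.lg
  m : s.nat 5 = c.m
  smp : s.nat 6 = c.smp
  coord : ∀ a < c.nd, s.real a = c.coord a

theorem Par.coordsE {c : Params} {s : Mem} (h : Par c s) : coordsE.eval s = c.nd := by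
  simp [KMeansOutliers.coordsE, Params.nd, h.n, h.d]

theorem Par.frame {c : Params} {s s' : Mem} (h : Par c s) (h1 : ∀ a < 7, s'.nat a = s.nat a)
    (h2 : ∀ a < c.nd, s'.real a = s.real a) : Par c s' where
  n := by rw [h1 _ (by norm_num), h.n]
  d := by rw [h1 _ (by norm_num), h.d]
  k := by rw [h1 _ (by norm_num), h.k]
  z := by rw [h1 _ (by norm_num), h.z]
  lg := by rw [h1 _ (by norm_num), h.lg]
  m := by rw [h1 _ (by norm_num), h.m]
  smp := by rw [h1 _ (by norm_num), h.smp]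
  coord a ha := by rw [h2 a ha, h.coord a ha]

theorem coord_lt {c : Params} {i l : ℕ} (hi : i < c.n) (hl : l < c.d) : c.d * i + l < c.nd := by
  have : c.d * (i + 1) ≤ c.d * c.n := Nat.mul_le_mul_left _ hi
  rw [Params.nd, mul_comm c.n]
  linarith [mul_add c.d i 1]

/-! ### Distances and nearest samples -/

section
variable {A : KMeansAlg} {T : ℕ → ℕ → ℕ → ℕ} {c : Params}

theorem ensures_distP {s : Mem} (hs : Par c s) {i i' : ℕ} (h18 : s.nat 18 = i) (hi : i < c.n)
    (hidx : s.nat (3 * (s.nat 20 + s.nat 29) + 33) = i') (hi' : i' < c.n) :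
    Ensures (distP.run A T s) (fun s' => (∀ a, a ≠ 31 → s'.nat a = s.nat a) ∧
      (∀ a, a ≠ c.nd + 3 → s'.real a = s.real a) ∧ s'.real (c.nd + 3) = c.D i i')
      (3 * (c.d + 1)) := by
  unfold distP
  rw [show 3 * (c.d + 1) = c.d * (2 + 1) + 1 + 1 + 1 by ring]
  apply ensures_setReal_seq
  apply ensures_setNat_seq
  have hnd := hs.coordsE
  set s1 := (s.setReal _ _).setNat _ _ with hs1
  simp only [NExp.eval_hadd, hnd, NExp.eval_lit, RExp.eval_ofNat] at hs1
  refine (ensures_loop (fun l s' => (∀ a, a ≠ 31 → s'.nat a = s.nat a) ∧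
      (∀ a, a ≠ c.nd + 3 → s'.real a = s.real a) ∧ s'.nat 31 = l ∧
      s'.real (c.nd + 3) = ∑ l ∈ Finset.range l,
        (c.coord (c.d * i + l) - c.coord (c.d * i' + l)) *
        (c.coord (c.d * i + l) - c.coord (c.d * i' + l))) c.d ?_ ?_ ?_).mono ?_ le_rfl
  · simp [hs1, hs.d]
  · refine ⟨fun a ha => ?_, fun a ha => ?_, ?_, ?_⟩ <;> simp [*]
  · rintro l hl s' ⟨h1, h2, h3, h4⟩
    have hs' : Par c s' := hs.frame (fun a ha => h1 a (by omega)) fun a ha => h2 a (by omega)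
    apply ensures_setReal_seq
    apply ensures_setNat
    have e1 := coord_lt hi hl
    have e2 := coord_lt hi' hl
    have e3 : s'.nat (3 * (s.nat 20 + s.nat 29) + 33) = i' := by rw [h1 _ (by omega), hidx]
    have e4 : s'.nat 18 = i := by rw [h1 _ (by omega), h18]
    refine ⟨fun a ha => ?_, fun a ha => ?_, ?_, ?_⟩
    · simp [ha, h1]
    · simp [ha, h2, hs'.coordsE]
    · simp [h3]
    · simp [hs'.coordsE, h4, Finset.sum_range_succ, idxA, h1 20, h1 29, e3, h3, e4, hs'.d,
        hs'.coord _ e1, hs'.coord _ e2]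
  · rintro s' ⟨h1, h2, h3, h4⟩
    exact ⟨h1, h2, h4⟩

/-- The first index below `r` where `f` is minimal. -/
def firstMin (f : ℕ → ℝ) : ℕ → ℕ
  | 0 => 0
  | r + 1 => if f (firstMin f r) ≤ f r then firstMin f r else r

theorem firstMin_lt (f : ℕ → ℝ) {r : ℕ} (hr : 0 < r) : firstMin f r < r := by
  induction r with
  | zero => omega
  | succ r ih =>
    rw [firstMin]
    split_ifs
    · rcases Nat.eq_zero_or_pos r with rfl | h
      · simp [firstMin]
      · exact (ih h).trans (Nat.lt_succ_self r)
    · exact Nat.lt_succ_self r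

theorem firstMin_le (f : ℕ → ℝ) {r j : ℕ} (hj : j < r) : f (firstMin f r) ≤ f j := by
  induction r with
  | zero => omega
  | succ r ih =>
    rw [firstMin]
    rcases Nat.lt_succ_iff_lt_or_eq.mp hj with h | rfl
    · split_ifs with h1
      · exact ih h
      · exact (le_of_not_ge h1).trans (ih h)
    · split_ifs with h1
      · exact h1
      · exact le_rfl

theorem firstMin_congr {f g : ℕ → ℝ} {r : ℕ} (hr : 0 < r) (h : ∀ j < r, f j = g j) :
    firstMin f r = firstMin g r := by
  induction r with
  | zero => rfl
  | succ r ih =>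
    rcases Nat.eq_zero_or_pos r with rfl | h'
    · simp [firstMin]
    · rw [firstMin, firstMin, ih h' fun j hj => h j (by omega), h r (by omega),
        h _ ((firstMin_lt g h').trans (Nat.lt_succ_self r))]

theorem ensures_nearestP {s : Mem} (hs : Par c s) (hd : 0 < c.d) (hk : 0 < c.k) {i : ℕ} (h18 : s.nat 18 = i)
    (hi : i < c.n) {S : ℕ → ℕ} (hS : ∀ j < c.smp, s.nat (3 * (s.nat 20 + j) + 33) = S j)
    (hS' : ∀ j < c.smp, S j < c.n) :
    Ensures (nearestP.run A T s) (fun s' => (∀ a, a < 28 ∨ 31 < a → s'.nat a = s.nat a) ∧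
      (∀ a, a ≠ c.nd + 3 → a ≠ c.nd + 2 → s'.real a = s.real a) ∧
      s'.nat 28 = firstMin (fun j => c.D i (S j)) c.smp ∧
      s'.real (c.nd + 2) = c.D i (S (firstMin (fun j => c.D i (S j)) c.smp)))
      (200 * (c.d * c.k)) := by
  have hsmp : c.smp = 8 * c.k := rfl
  unfold nearestP
  refine Ensures.mono (Q := fun s' => (∀ a, a < 28 ∨ 31 < a → s'.nat a = s.nat a) ∧
      (∀ a, a ≠ c.nd + 3 → a ≠ c.nd + 2 → s'.real a = s.real a) ∧
      s'.nat 28 = firstMin (fun j => c.D i (S j)) c.smp ∧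
      s'.real (c.nd + 2) = c.D i (S (firstMin (fun j => c.D i (S j)) c.smp)))
    (t := 3 * (c.d + 1) + (c.smp * (3 * (c.d + 1) + 4 + 1) + 1 + 1 + 1) + 1) ?_
    (fun _ h => h) ?_
  swap
  · rw [hsmp]
    have : c.d ≤ c.d * c.k := Nat.le_mul_of_pos_right _ hk
    have : c.k ≤ c.d * c.k := Nat.le_mul_of_pos_left _ hd
    nlinarith
  apply ensures_setNat_seq
  set s1 := s.setNat _ _ with hs1
  simp only [NExp.eval_lit] at hs1
  have hs1p : Par c s1 := hs.frame (fun a ha => by simp [hs1]; omega) fun a ha => by simp [hs1]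
  have hpos : 0 < c.smp := by omega
  apply ensures_seq
  refine (ensures_distP hs1p (i := i) (i' := S 0) (by simp [hs1, h18]) hi
    (by simpa [hs1] using hS 0 (by omega)) (hS' 0 (by omega))).mono ?_ le_rfl
  rintro s2 ⟨f1, f2, f3⟩
  have hs2p : Par c s2 := hs1p.frame (fun a ha => f1 a (by omega)) fun a ha => f2 a (by omega)
  apply ensures_setReal_seq
  apply ensures_setNat_seq
  -- `firstMin` is 0 on the empty range, so the distance to sample 0 computed in advance makes the
  -- invariant true for r = 0; the loop then visits sample 0 again.
  refine (ensures_loop (fun r s' => (∀ a, a < 28 ∨ 31 < a → s'.nat a = s.nat a) ∧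
      (∀ a, a ≠ c.nd + 3 → a ≠ c.nd + 2 → s'.real a = s.real a) ∧ s'.nat 29 = r ∧
      s'.nat 28 = firstMin (fun j => c.D i (S j)) r ∧
      s'.real (c.nd + 2) = c.D i (S (firstMin (fun j => c.D i (S j)) r))) c.smp ?_ ?_ ?_).mono
      ?_ le_rfl
  · simp [hs2p.smp]
  · refine ⟨fun a ha => ?_, fun a h3 h2 => ?_, ?_, ?_, ?_⟩
    · have e1 : a ≠ 28 := by omega
      have e2 : a ≠ 29 := by omega
      simp [e1, f1 a (by omega), hs1, e2]
    · simp [hs2p.coordsE, h2, f2 a h3, hs1]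
    · simp [f1, hs1]
    · simp [firstMin]
    · simp [hs2p.coordsE, f3, firstMin]
  · rintro r hr s3 ⟨g1, g2, g3, g4, g5⟩
    have hs3p : Par c s3 := hs.frame (fun a ha => g1 a (by omega))
      fun a ha => g2 a (by omega) (by omega)
    apply ensures_seq
    refine (ensures_distP hs3p (i := i) (i' := S r) (by rw [g1 18 (by omega), h18]) hi
      (by rw [g1 20 (by omega), g3, g1 _ (by omega)]; exact hS r (by omega))
      (hS' r (by omega))).mono ?_ le_rfl
    rintro s4 ⟨k1, k2, k3⟩
    have hs4p : Par c s4 := hs3p.frame (fun a ha => k1 a (by omega)) fun a ha => k2 a (by omega)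
    have q29 : s4.nat 29 = r := by rw [k1 29 (by omega), g3]
    have q28 : s4.nat 28 = firstMin (fun j => c.D i (S j)) r := by rw [k1 28 (by omega), g4]
    have q2 : s4.real (c.nd + 2) = c.D i (S (firstMin (fun j => c.D i (S j)) r)) := by
      rw [k2 _ (by omega), g5]
    refine ensures_seq (t1 := 3) (t2 := 1) ?_
    refine ensures_ite (t := 2) ?_ ?_
    · intro h
      simp only [Test.holds_realLe, RExp.eval_load, NExp.eval_hadd, hs4p.coordsE,
        NExp.eval_lit, k3, q2] at h
      unfold skipP
      refine Ensures.mono (t := 1) ?_ (fun _ h => h) (by omega)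
      apply ensures_setNat
      apply ensures_setNat
      refine ⟨fun a ha => ?_, fun a h3 h2 => ?_, ?_, ?_, ?_⟩
      · have e1 : a ≠ 29 := by omega
        have e2 : a ≠ 31 := by omega
        simp [e1, e2, k1, g1 a ha]
      · simp [k2 a h3, g2 a h3 h2]
      · simp [q29]
      · simp [q28, firstMin, h]
      · simp [q2, firstMin, h]
    · intro h
      simp only [Test.holds_realLe, RExp.eval_load, NExp.eval_hadd, hs4p.coordsE,
        NExp.eval_lit, k3, q2] at h
      apply ensures_setReal_seq
      apply ensures_setNat
      apply ensures_setNat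
      refine ⟨fun a ha => ?_, fun a h3 h2 => ?_, ?_, ?_, ?_⟩
      · have e1 : a ≠ 29 := by omega
        have e2 : a ≠ 31 := by omega
        have e3 : a ≠ 28 := by omega
        simp [e1, e2, e3, k1, g1 a ha]
      · simp [h2, hs4p.coordsE, k2 a h3, g2 a h3 h2]
      · simp [q29]
      · simp [q29, firstMin, h]
      · simp [hs4p.coordsE, k3, firstMin, h]
  · rintro s' ⟨h1, h2, h3, h4, h5⟩
    exact ⟨h1, h2, h4, h5⟩

end

/-! ### Trials -/

section
variable (c : Params) (S : ℕ → ℕ) (U : Finset ℕ) (t : ℝ)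

/-- The sample to which a point is assigned. -/
def Params.near (i : ℕ) : ℕ := firstMin (fun j => c.D i (S j)) c.smp

/-- The squared distance of a point to the samples. -/
def Params.mdist (i : ℕ) : ℝ := c.D i (S (c.near S i))

/-- The points within the threshold that are assigned to sample `j`. -/
def Params.part (j : ℕ) : Finset ℕ := {i ∈ U | c.mdist S i ≤ t ∧ c.near S i = j}

/-- The weight of sample `j`: the number of points assigned to it, unless this is too small. -/
def Params.wgt (j : ℕ) : ℕ :=
  if U.card ≤ 8 * c.smp * (c.part S U t j).card then (c.part S U t j).card else 0

end

/-- The points that have not been removed. -/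
def remaining (c : Params) (s : Mem) : Finset ℕ := {i ∈ Finset.range c.n | s.nat (3 * i + 32) = 0}

theorem mem_remaining {c : Params} {s : Mem} {i : ℕ} :
    i ∈ remaining c s ↔ i < c.n ∧ s.nat (3 * i + 32) = 0 := by simp [remaining]

theorem remaining_congr {c : Params} {s s' : Mem}
    (h : ∀ i, s'.nat (3 * i + 32) = s.nat (3 * i + 32)) : remaining c s' = remaining c s := by
  simp [remaining, h]

theorem Params.near_lt {c : Params} (hk : 0 < c.k) (S : ℕ → ℕ) (i : ℕ) : c.near S i < c.smp :=
  firstMin_lt _ (by rw [Params.smp]; omega)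

/-! ### Threshold, assignment and weights in a trial -/

section
variable {A : KMeansAlg} {T : ℕ → ℕ → ℕ → ℕ} {c : Params}

/-- In the frame conditions, addresses from 32 on with residue 2, 0, 1 modulo 3 belong to removal
flags, slot indices and slot weights. Slots from `c.m` on are the working area of the current trial,
and only weights there may change. -/
theorem ensures_thresholdP {s : Mem} (hs : Par c s) (hd : 0 < c.d) (hk : 0 < c.k) {S : ℕ → ℕ}
    (hS : ∀ j ≤ c.smp, s.nat (3 * (c.m + j) + 33) = S j) (hS' : ∀ j ≤ c.smp, S j < c.n) :
    Ensures (thresholdP.run A T s) (fun s' =>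
      (∀ a, a < 16 ∨ 32 ≤ a ∧ (a % 3 ≠ 1 ∨ a < 3 * c.m + 33) → s'.nat a = s.nat a) ∧
      (∀ a, a ≤ c.nd → s'.real a = s.real a) ∧ s'.nat 20 = c.m ∧
      s'.real (c.nd + 1) = c.mdist S (S c.smp) ∧ ∀ j < c.smp, s'.nat (3 * (c.m + j) + 34) = 0)
      (300 * (c.d * c.k)) := by
  have hsmp : c.smp = 8 * c.k := rfl
  unfold thresholdP
  refine Ensures.mono (t := (200 * (c.d * c.k) + (c.smp * (1 + 1 + 1) + 1 + 1 + 1)) + 1 + 1) ?_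
    (fun _ h => h) ?_
  swap
  · rw [hsmp]
    have : c.k ≤ c.d * c.k := Nat.le_mul_of_pos_left _ hd
    omega
  apply ensures_setNat_seq
  apply ensures_setNat_seq
  set s1 := (s.setNat _ _).setNat _ _ with hs1
  simp only [NExp.eval_lit, NExp.eval_load, idxA, NExp.eval_hadd, NExp.eval_hmul, eval_cell,
    hs.m, hs.smp, hS c.smp le_rfl, Mem.setNat_nat, Nat.reduceEqDiff, if_false] at hs1
  have hs1p : Par c s1 := hs.frame
    (fun a ha => by have : a ≠ 20 ∧ a ≠ 18 := by omega
                    simp [hs1, this]) fun a ha => by simp [hs1]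
  have h20 : s1.nat 20 = c.m := by simp [hs1]
  refine ensures_seq (t1 := 200 * (c.d * c.k)) (t2 := c.smp * (1 + 1 + 1) + 1 + 1 + 1) ?_
  refine (ensures_nearestP hs1p hd hk (i := S c.smp) (S := S) (by simp [hs1]) (hS' _ le_rfl)
    (fun j hj => ?_) fun j hj => hS' j hj.le).mono ?_ le_rfl
  · rw [h20]
    have : 3 * (c.m + j) + 33 ≠ 20 ∧ 3 * (c.m + j) + 33 ≠ 18 := by omega
    simp only [hs1, Mem.setNat_nat, this, if_false, hS j hj.le]
  rintro s2 ⟨f1, f2, -, f4⟩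
  have hs2p : Par c s2 := hs1p.frame (fun a ha => f1 a (by omega))
    fun a ha => f2 a (by omega) (by omega)
  apply ensures_setReal_seq
  apply ensures_setNat_seq
  refine (ensures_loop (fun r s' =>
      (∀ a, a < 16 ∨ 32 ≤ a ∧ (a % 3 ≠ 1 ∨ a < 3 * c.m + 33) → s'.nat a = s.nat a) ∧
      (∀ a, a ≤ c.nd → s'.real a = s.real a) ∧ s'.nat 20 = c.m ∧
      s'.real (c.nd + 1) = c.mdist S (S c.smp) ∧ s'.nat 21 = r ∧
      ∀ j < r, s'.nat (3 * (c.m + j) + 34) = 0) c.smp ?_ ?_ ?_).mono ?_ le_rfl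
  · simp [hs2p.smp]
  · refine ⟨fun a ha => ?_, fun a ha => ?_, ?_, ?_, ?_, ?_⟩
    · have : a ≠ 18 ∧ a ≠ 20 ∧ a ≠ 21 := by omega
      simp [this, f1 a (by omega), hs1]
    · have : a ≠ c.nd + 1 := by omega
      simp [hs2p.coordsE, this, f2 a (by omega) (by omega), hs1]
    · simp [f1 20, h20]
    · simpa [hs2p.coordsE, Params.mdist, Params.near] using f4
    · simp
    · simp
  · rintro r hr s3 ⟨g1, g2, g3, g4, g5, g6⟩
    have hs3p : Par c s3 := hs.frame (fun a ha => g1 a (by omega)) fun a ha => g2 a (by omega)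
    apply ensures_setNat_seq
    apply ensures_setNat
    refine ⟨fun a ha => ?_, fun a ha => ?_, ?_, ?_, ?_, fun j hj => ?_⟩
    · have : a ≠ 21 ∧ a ≠ 3 * (c.m + r) + 34 := by omega
      simp [wtA, hs3p.m, g5, this, g1 a ha]
    · simp [g2 a ha]
    · simp [wtA, g3]
    · simp [g4]
    · simp [wtA, g5]
    · rcases Nat.lt_succ_iff_lt_or_eq.mp hj with h | rfl
      · have : j ≠ r := h.ne
        simp [wtA, hs3p.m, g5, g6 j h]
      · simp [wtA, hs3p.m, g5]
  · rintro s' ⟨h1, h2, h3, h4, h5, h6⟩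
    exact ⟨h1, h2, h3, h4, h6⟩

theorem ensures_countP {s : Mem} (hs : Par c s) (hd : 0 < c.d) (hk : 0 < c.k) {S : ℕ → ℕ}
    (hS : ∀ j ≤ c.smp, s.nat (3 * (c.m + j) + 33) = S j) (hS' : ∀ j ≤ c.smp, S j < c.n)
    {U : Finset ℕ} (hU : U = remaining c s) {t : ℝ} (ht : s.real (c.nd + 1) = t)
    (h20 : s.nat 20 = c.m) (hw : ∀ j < c.smp, s.nat (3 * (c.m + j) + 34) = 0) :
    Ensures (countP.run A T s) (fun s' =>
      (∀ a, a < 16 ∨ 32 ≤ a ∧ (a % 3 ≠ 1 ∨ a < 3 * c.m + 33) → s'.nat a = s.nat a) ∧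
      (∀ a, a ≤ c.nd + 1 → s'.real a = s.real a) ∧
      ∀ j < c.smp, s'.nat (3 * (c.m + j) + 34) = (c.part S U t j).card)
      (c.n * (200 * (c.d * c.k) + 5) + 2) := by
  unfold countP
  apply ensures_setNat_seq
  set s1 := s.setNat _ _ with hs1
  simp only [NExp.eval_lit] at hs1
  have hs1p : Par c s1 := hs.frame
    (fun a ha => by have : a ≠ 18 := by omega
                    simp [hs1, this]) fun a ha => by simp [hs1]
  refine (ensures_loop (τ := 200 * (c.d * c.k) + 4) (fun r s' =>
      (∀ a, a < 16 ∨ 32 ≤ a ∧ (a % 3 ≠ 1 ∨ a < 3 * c.m + 33) → s'.nat a = s.nat a) ∧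
      (∀ a, a ≤ c.nd + 1 → s'.real a = s.real a) ∧ s'.nat 20 = c.m ∧ s'.nat 18 = r ∧
      ∀ j < c.smp, s'.nat (3 * (c.m + j) + 34) =
        ((Finset.range r).filter fun i => i ∈ U ∧ c.mdist S i ≤ t ∧ c.near S i = j).card)
      c.n ?_ ?_ ?_).mono ?_ le_rfl
  · simp [hs1p.n]
  · refine ⟨fun a ha => ?_, fun a ha => ?_, ?_, ?_, fun j hj => ?_⟩
    · have : a ≠ 18 := by omega
      simp [hs1, this]
    · simp [hs1]
    · simp [hs1, h20]
    · simp [hs1]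
    · simpa [hs1] using hw j hj
  · rintro i hi s2 ⟨f1, f2, f3, f4, f5⟩
    have hs2p : Par c s2 := hs.frame (fun a ha => f1 a (by omega)) fun a ha => f2 a (by omega)
    have hdel : s2.nat (3 * i + 32) = s.nat (3 * i + 32) := f1 _ (by omega)
    have hiU : i ∈ U ↔ s.nat (3 * i + 32) = 0 := by rw [hU, mem_remaining]; simp [hi]
    refine ensures_seq (t1 := 200 * (c.d * c.k) + 2 + 1) (t2 := 1) ?_
    apply ensures_ite
    · intro h
      simp only [Test.holds_natLe, NExp.eval_load, delA, NExp.eval_hadd, NExp.eval_hmul,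
        NExp.eval_lit, eval_cell, f4, hdel, Nat.le_zero] at h
      have hi' := hiU.mpr h
      apply ensures_seq
      refine (ensures_nearestP hs2p hd hk (i := i) (S := S) f4 hi
        (fun j hj => by rw [f3, f1 _ (by omega), hS j hj.le]) fun j hj => hS' j hj.le).mono ?_ le_rfl
      rintro s3 ⟨g1, g2, g3, g4⟩
      have hs3p : Par c s3 := hs2p.frame (fun a ha => g1 a (by omega))
        fun a ha => g2 a (by omega) (by omega)
      change s3.nat 28 = c.near S i at g3
      change s3.real (c.nd + 2) = c.mdist S i at g4
      have q1 : s3.real (c.nd + 1) = t := by rw [g2 _ (by omega) (by omega), f2 _ (by omega), ht]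
      have hlt := Params.near_lt hk S i
      apply ensures_ite
      · intro h'
        simp only [Test.holds_realLe, RExp.eval_load, NExp.eval_hadd, hs3p.coordsE,
          NExp.eval_lit, g4, q1] at h'
        apply ensures_setNat
        apply ensures_setNat
        refine ⟨fun a ha => ?_, fun a ha => ?_, ?_, ?_, fun j hj => ?_⟩
        · have : a ≠ 18 ∧ a ≠ 3 * (c.m + c.near S i) + 34 := by omega
          simp [wtA, hs3p.m, g3, this, g1 a (by omega), f1 a ha]
        · simp [g2 a (by omega) (by omega), f2 a ha]
        · simp [wtA, g1 20, f3]
        · simp [wtA, g1 18, f4]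
        · rw [Finset.range_add_one, Finset.filter_insert]
          by_cases hj' : c.near S i = j
          · subst hj'
            simp [wtA, hs3p.m, g3, g1 (3 * (c.m + c.near S i) + 34) (by omega), f5 _ hlt, hi', h']
          · have : j ≠ c.near S i := fun h => hj' h.symm
            simp [wtA, hs3p.m, g3, g1 (3 * (c.m + j) + 34) (by omega), f5 _ hj, hj', this]
      · intro h'
        simp only [Test.holds_realLe, RExp.eval_load, NExp.eval_hadd, hs3p.coordsE,
          NExp.eval_lit, g4, q1] at h'
        apply ensures_setNat
        apply ensures_setNat
        refine ⟨fun a ha => ?_, fun a ha => ?_, ?_, ?_, fun j hj => ?_⟩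
        · have : a ≠ 18 ∧ a ≠ 31 := by omega
          simp [this, g1 a (by omega), f1 a ha]
        · simp [g2 a (by omega) (by omega), f2 a ha]
        · simp [g1 20, f3]
        · simp [g1 18, f4]
        · rw [Finset.range_add_one, Finset.filter_insert]
          simp [g1 (3 * (c.m + j) + 34) (by omega), f5 _ hj, h']
    · intro h
      simp only [Test.holds_natLe, NExp.eval_load, delA, NExp.eval_hadd, NExp.eval_hmul,
        NExp.eval_lit, eval_cell, f4, hdel, Nat.le_zero] at h
      have hi' := mt hiU.mp h
      refine Ensures.mono (t := 1) ?_ (fun _ h => h) (by omega)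
      apply ensures_setNat
      apply ensures_setNat
      refine ⟨fun a ha => ?_, fun a ha => ?_, ?_, ?_, fun j hj => ?_⟩
      · have : a ≠ 18 ∧ a ≠ 31 := by omega
        simp [this, f1 a ha]
      · simp [f2 a ha]
      · simp [f3]
      · simp [f4]
      · rw [Finset.range_add_one, Finset.filter_insert]
        simp [f5 _ hj, hi']
  · rintro s' ⟨h1, h2, h3, h4, h5⟩
    refine ⟨h1, h2, fun j hj => ?_⟩
    rw [h5 j hj, Params.part]
    congr 1
    ext i
    simp only [Finset.mem_filter, Finset.mem_range, hU, mem_remaining]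
    tauto

theorem ensures_heavyP {s : Mem} (hs : Par c s) {S : ℕ → ℕ}
    {U : Finset ℕ} (hN : s.nat 8 = U.card) {t : ℝ}
    (hw : ∀ j < c.smp, s.nat (3 * (c.m + j) + 34) = (c.part S U t j).card) :
    Ensures (heavyP.run A T s) (fun s' =>
      (∀ a, a < 16 ∨ 32 ≤ a ∧ (a % 3 ≠ 1 ∨ a < 3 * c.m + 33) → s'.nat a = s.nat a) ∧
      s'.real = s.real ∧ s'.nat 22 = ∑ j ∈ Finset.range c.smp, c.wgt S U t j ∧
      ∀ j < c.smp, s'.nat (3 * (c.m + j) + 34) = c.wgt S U t j)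
      (c.smp * 4 + 3) := by
  unfold heavyP
  apply ensures_setNat_seq
  apply ensures_setNat_seq
  refine (ensures_loop (τ := 3) (fun r s' =>
      (∀ a, a < 16 ∨ 32 ≤ a ∧ (a % 3 ≠ 1 ∨ a < 3 * c.m + 33) → s'.nat a = s.nat a) ∧
      s'.real = s.real ∧ s'.nat 22 = ∑ j ∈ Finset.range r, c.wgt S U t j ∧ s'.nat 21 = r ∧
      ∀ j < c.smp, s'.nat (3 * (c.m + j) + 34) = if j < r then c.wgt S U t j
        else (c.part S U t j).card)
      c.smp ?_ ?_ ?_).mono ?_ le_rfl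
  · simp [hs.smp]
  · refine ⟨fun a ha => ?_, ?_, ?_, ?_, fun j hj => ?_⟩
    · have : a ≠ 21 ∧ a ≠ 22 := by omega
      simp [this]
    · simp
    · simp
    · simp
    · simp [hw j hj]
  · rintro r hr s2 ⟨f1, f2, f3, f4, f5⟩
    have hs2p : Par c s2 := hs.frame (fun a ha => f1 a (by omega)) fun a ha => by rw [f2]
    have hN' : s2.nat 8 = U.card := by rw [f1 _ (by omega), hN]
    have hr' := f5 r hr
    simp only [lt_irrefl, if_false] at hr'
    refine ensures_seq (t1 := 1 + 1) (t2 := 1) ?_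
    apply ensures_ite
    · intro h
      simp only [Test.holds_natLe, NExp.eval_load, wtA, NExp.eval_hadd, NExp.eval_hmul,
        NExp.eval_lit, eval_cell, hs2p.m, hs2p.smp, hN', f4, hr'] at h
      have hwr : c.wgt S U t r = (c.part S U t r).card := by rw [Params.wgt, if_pos h]
      apply ensures_setNat
      apply ensures_setNat
      refine ⟨fun a ha => ?_, ?_, ?_, ?_, fun j hj => ?_⟩
      · have : a ≠ 21 ∧ a ≠ 22 := by omega
        simp [this, f1 a ha]
      · simp [f2]
      · simp [wtA, hs2p.m, f4, f3, Finset.sum_range_succ, hr', hwr]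
      · simp [f4]
      · simp only [Mem.setNat_nat, NExp.eval_lit, Nat.reduceEqDiff, if_false, f5 j hj]
        rcases lt_trichotomy j r with h1 | rfl | h1
        · simp [h1, h1.trans (Nat.lt_succ_self r)]
        · simp [hwr]
        · simp [h1.not_gt, show ¬ j < r + 1 by omega]
    · intro h
      simp only [Test.holds_natLe, NExp.eval_load, wtA, NExp.eval_hadd, NExp.eval_hmul,
        NExp.eval_lit, eval_cell, hs2p.m, hs2p.smp, hN', f4, hr'] at h
      have hwr : c.wgt S U t r = 0 := by rw [Params.wgt, if_neg h]
      apply ensures_setNat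
      apply ensures_setNat
      refine ⟨fun a ha => ?_, ?_, ?_, ?_, fun j hj => ?_⟩
      · have : a ≠ 21 ∧ a ≠ 3 * (c.m + r) + 34 := by omega
        simp [wtA, hs2p.m, f4, this, f1 a ha]
      · simp [f2]
      · simp [wtA, hs2p.m, f4, f3, Finset.sum_range_succ, hwr]
      · simp [wtA, f4]
      · simp only [Mem.setNat_nat, NExp.eval_lit, Nat.reduceEqDiff, if_false, f5 j hj, wtA,
          NExp.eval_hadd, NExp.eval_hmul, eval_cell, hs2p.m, f4]
        rcases lt_trichotomy j r with h1 | rfl | h1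
        · simp [h1, h1.trans (Nat.lt_succ_self r), h1.ne]
        · simp [hwr]
        · simp [h1.not_gt, show ¬ j < r + 1 by omega, h1.ne']
  · rintro s' ⟨h1, h2, h3, h4, h5⟩
    refine ⟨h1, h2, h3, fun j hj => ?_⟩
    rw [h5 j hj, if_pos hj]

end

/-- The slots from `rb` on hold the best trial so far of a round that started with `U`, if any. -/
def Saved (c : Params) (U : Finset ℕ) (rb : ℕ) (s : Mem) : Prop :=
  ∃ S : ℕ → ℕ, (∀ j < c.smp, S j < c.n) ∧ (∀ j < c.smp, s.nat (3 * (rb + j) + 33) = S j) ∧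
    ((s.nat 10 = 0 ∧ ∀ j < c.smp, s.nat (3 * (rb + j) + 34) = 0) ∨
     (s.nat 10 = 1 ∧ U.card ≤ 8 * ∑ j ∈ Finset.range c.smp, c.wgt S U (s.real c.nd) j ∧
      ∀ j < c.smp, s.nat (3 * (rb + j) + 34) = c.wgt S U (s.real c.nd) j))

/-! ### Keeping the best trial and removing what it covers -/

section
variable {A : KMeansAlg} {T : ℕ → ℕ → ℕ → ℕ} {c : Params}

theorem ensures_saveP {s : Mem} (hs : Par c s) {rb : ℕ} (h9 : s.nat 9 = rb)
    (hrb : rb + c.smp ≤ c.m) {v w : ℕ → ℕ}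
    (hv : ∀ j < c.smp, s.nat (3 * (c.m + j) + 33) = v j)
    (hw : ∀ j < c.smp, s.nat (3 * (c.m + j) + 34) = w j) :
    Ensures (saveP.run A T s) (fun s' =>
      (∀ a, a < 16 ∧ a ≠ 10 ∨ 32 ≤ a ∧ (a % 3 = 2 ∨ a < 3 * rb + 33 ∨
        3 * (rb + c.smp) + 33 ≤ a) → s'.nat a = s.nat a) ∧
      (∀ a, a < c.nd → s'.real a = s.real a) ∧ s'.nat 10 = 1 ∧
      s'.real c.nd = s.real (c.nd + 1) ∧
      (∀ j < c.smp, s'.nat (3 * (rb + j) + 33) = v j) ∧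
      ∀ j < c.smp, s'.nat (3 * (rb + j) + 34) = w j)
      (c.smp * 4 + 4) := by
  unfold saveP
  apply ensures_setNat_seq
  apply ensures_setReal_seq
  apply ensures_setNat_seq
  refine (ensures_loop (τ := 3) (fun r s' =>
      (∀ a, a < 16 ∧ a ≠ 10 ∨ 32 ≤ a ∧ (a % 3 = 2 ∨ a < 3 * rb + 33 ∨
        3 * (rb + c.smp) + 33 ≤ a) → s'.nat a = s.nat a) ∧
      (∀ a, a < c.nd → s'.real a = s.real a) ∧ s'.nat 10 = 1 ∧
      s'.real c.nd = s.real (c.nd + 1) ∧ s'.nat 21 = r ∧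
      (∀ j < r, s'.nat (3 * (rb + j) + 33) = v j) ∧
      ∀ j < r, s'.nat (3 * (rb + j) + 34) = w j)
      c.smp ?_ ?_ ?_).mono ?_ le_rfl
  · simp [hs.smp]
  · refine ⟨fun a ha => ?_, fun a ha => ?_, ?_, ?_, ?_, ?_, ?_⟩
    · have : a ≠ 21 ∧ a ≠ 10 := by omega
      simp [this]
    · simp [coordsE, hs.n, hs.d]
      intro h
      exact absurd h ha.ne
    · simp
    · simp [coordsE, hs.n, hs.d, Params.nd]
    · simp
    · simp
    · simp
  · rintro r hr s2 ⟨f1, f2, f3, f4, f5, f6, f7⟩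
    have hs2p : Par c s2 := hs.frame (fun a ha => f1 a (by omega)) f2
    have e9 : s2.nat 9 = rb := by rw [f1 _ (by omega), h9]
    apply ensures_setNat_seq
    apply ensures_setNat_seq
    apply ensures_setNat
    have ev : s2.nat (3 * (c.m + r) + 33) = v r := by rw [f1 _ (by omega), hv r hr]
    have ew : s2.nat (3 * (c.m + r) + 34) = w r := by rw [f1 _ (by omega), hw r hr]
    have n1 : 3 * (c.m + r) + 34 ≠ 3 * (rb + r) + 33 := by omega
    refine ⟨fun a ha => ?_, fun a ha => ?_, ?_, ?_, ?_, fun j hj => ?_, fun j hj => ?_⟩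
    · have : a ≠ 21 ∧ a ≠ 3 * (rb + r) + 33 ∧ a ≠ 3 * (rb + r) + 34 := by omega
      simp [wtA, idxA, f5, e9, this, f1 a ha]
    · simp [f2 a ha]
    · simp [wtA, idxA, f3]
    · simp [f4]
    · simp [wtA, idxA, f5]
    · rcases Nat.lt_succ_iff_lt_or_eq.mp hj with h | rfl
      · simp [wtA, idxA, f5, e9, h.ne, f6 j h]
        omega
      · simp [wtA, idxA, f5, e9, hs2p.m, ev]
    · have : 3 * (rb + j) + 34 ≠ 3 * (rb + r) + 33 := by omega
      rcases Nat.lt_succ_iff_lt_or_eq.mp hj with h | rfl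
      · simp [wtA, idxA, f5, e9, this, h.ne, f7 j h]
      · simp [wtA, idxA, f5, e9, hs2p.m, ew, n1]
  · rintro s' ⟨h1, h2, h3, h4, h5, h6⟩
    exact ⟨h1, h2, h3, h4, h6⟩

/-- The last two clauses of the postcondition say that the saved threshold is at most that of any
trial with enough coverage, and never increases once a trial is saved. So a good trial cannot be
lost. -/
theorem ensures_selectP {s : Mem} (hs : Par c s) {rb : ℕ} (h9 : s.nat 9 = rb)
    (hrb : rb + c.smp ≤ c.m) {U : Finset ℕ} (hN : s.nat 8 = U.card) {S : ℕ → ℕ}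
    (hS' : ∀ j < c.smp, S j < c.n)
    (hv : ∀ j < c.smp, s.nat (3 * (c.m + j) + 33) = S j)
    (hw : ∀ j < c.smp, s.nat (3 * (c.m + j) + 34) = c.wgt S U (s.real (c.nd + 1)) j)
    (h22 : s.nat 22 = ∑ j ∈ Finset.range c.smp, c.wgt S U (s.real (c.nd + 1)) j)
    (hsaved : Saved c U rb s) :
    Ensures (selectP.run A T s) (fun s' =>
      (∀ a, a < 16 ∧ a ≠ 10 ∨ 32 ≤ a ∧ (a % 3 = 2 ∨ a < 3 * rb + 33 ∨
        3 * (rb + c.smp) + 33 ≤ a) → s'.nat a = s.nat a) ∧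
      (∀ a, a < c.nd → s'.real a = s.real a) ∧ Saved c U rb s' ∧
      (U.card ≤ 8 * ∑ j ∈ Finset.range c.smp, c.wgt S U (s.real (c.nd + 1)) j →
        s'.nat 10 = 1 ∧ s'.real c.nd ≤ s.real (c.nd + 1)) ∧
      (s.nat 10 = 1 → s'.nat 10 = 1 ∧ s'.real c.nd ≤ s.real c.nd))
      (c.smp * 4 + 7) := by
  unfold selectP
  have hsave : ∀ h : U.card ≤ 8 * ∑ j ∈ Finset.range c.smp, c.wgt S U (s.real (c.nd + 1)) j,
      (s.nat 10 = 1 → s.real (c.nd + 1) ≤ s.real c.nd) →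
      Ensures (saveP.run A T s) (fun s' =>
      (∀ a, a < 16 ∧ a ≠ 10 ∨ 32 ≤ a ∧ (a % 3 = 2 ∨ a < 3 * rb + 33 ∨
        3 * (rb + c.smp) + 33 ≤ a) → s'.nat a = s.nat a) ∧
      (∀ a, a < c.nd → s'.real a = s.real a) ∧ Saved c U rb s' ∧
      (U.card ≤ 8 * ∑ j ∈ Finset.range c.smp, c.wgt S U (s.real (c.nd + 1)) j →
        s'.nat 10 = 1 ∧ s'.real c.nd ≤ s.real (c.nd + 1)) ∧
      (s.nat 10 = 1 → s'.nat 10 = 1 ∧ s'.real c.nd ≤ s.real c.nd))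
      (c.smp * 4 + 4) := by
    intro h hle
    refine (ensures_saveP hs h9 hrb hv hw).mono ?_ le_rfl
    rintro s' ⟨g1, g2, g3, g4, g5, g6⟩
    refine ⟨g1, g2, ⟨S, hS', g5, Or.inr ⟨g3, ?_, ?_⟩⟩, fun _ => ⟨g3, g4.le⟩,
      fun h1 => ⟨g3, by rw [g4]; exact hle h1⟩⟩
    · rw [g4]; exact h
    · rw [g4]; exact g6
  have hskip : ∀ h : (U.card ≤ 8 * ∑ j ∈ Finset.range c.smp, c.wgt S U (s.real (c.nd + 1)) j →
        s.nat 10 = 1 ∧ s.real c.nd ≤ s.real (c.nd + 1)),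
      Ensures (skipP.run A T s) (fun s' =>
      (∀ a, a < 16 ∧ a ≠ 10 ∨ 32 ≤ a ∧ (a % 3 = 2 ∨ a < 3 * rb + 33 ∨
        3 * (rb + c.smp) + 33 ≤ a) → s'.nat a = s.nat a) ∧
      (∀ a, a < c.nd → s'.real a = s.real a) ∧ Saved c U rb s' ∧
      (U.card ≤ 8 * ∑ j ∈ Finset.range c.smp, c.wgt S U (s.real (c.nd + 1)) j →
        s'.nat 10 = 1 ∧ s'.real c.nd ≤ s.real (c.nd + 1)) ∧
      (s.nat 10 = 1 → s'.nat 10 = 1 ∧ s'.real c.nd ≤ s.real c.nd)) 1 := by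
    intro h
    apply ensures_setNat
    refine ⟨fun a ha => ?_, fun a ha => ?_, ?_, ?_, ?_⟩
    · have : a ≠ 31 := by omega
      simp [this]
    · simp
    · simpa [Saved] using hsaved
    · simpa using h
    · intro h1; simpa using h1
  have e1 : (Test.natLe (cell 8) (8 * cell 22)).holds s ↔
      U.card ≤ 8 * ∑ j ∈ Finset.range c.smp, c.wgt S U (s.real (c.nd + 1)) j := by
    simp [hN, h22]
  apply ensures_ite
  · intro h
    rw [e1] at h
    apply ensures_ite
    · intro h'
      refine (hsave h fun h1 => ?_).mono (fun _ h => h) (by omega)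
      simp [h1] at h'
    · intro h'
      refine ensures_ite (t := c.smp * 4 + 4) ?_ ?_
      · intro h''
        simp only [Test.holds_realLe, RExp.eval_load, NExp.eval_hadd, hs.coordsE,
          NExp.eval_lit] at h''
        refine (hskip fun _ => ⟨?_, h''⟩).mono (fun _ h => h) (by omega)
        obtain ⟨S0, -, -, h0 | h0⟩ := hsaved
        · simp [h0.1] at h'
        · exact h0.1
      · intro h''
        simp only [Test.holds_realLe, RExp.eval_load, NExp.eval_hadd, hs.coordsE,
          NExp.eval_lit] at h''
        exact hsave h fun _ => (le_of_not_ge h'')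
  · intro h
    rw [e1] at h
    exact (hskip fun h' => absurd h' h).mono (fun _ h => h) (by omega)

theorem ensures_removeP {s : Mem} (hs : Par c s) (hd : 0 < c.d) (hk : 0 < c.k) {rb : ℕ}
    (h9 : s.nat 9 = rb) {U : Finset ℕ} (hU : U = remaining c s) (hN : s.nat 8 = U.card)
    {S w : ℕ → ℕ} (hS' : ∀ j < c.smp, S j < c.n)
    (hv : ∀ j < c.smp, s.nat (3 * (rb + j) + 33) = S j)
    (hw : ∀ j < c.smp, s.nat (3 * (rb + j) + 34) = w j) :
    Ensures (removeP.run A T s) (fun s' =>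
      (∀ a, a < 16 ∧ a ≠ 8 ∨ 32 ≤ a ∧ a % 3 ≠ 2 → s'.nat a = s.nat a) ∧
      (∀ a, a ≤ c.nd → s'.real a = s.real a) ∧
      remaining c s' = {i ∈ U | ¬ (c.mdist S i ≤ s.real c.nd ∧ 1 ≤ w (c.near S i))} ∧
      s'.nat 8 = (remaining c s').card)
      (c.n * (200 * (c.d * c.k) + 7) + 3) := by
  unfold removeP
  apply ensures_setNat_seq
  apply ensures_setNat_seq
  set s1 := (s.setNat _ _).setNat _ _ with hs1
  simp only [NExp.eval_lit, eval_cell, Mem.setNat_nat, Nat.reduceEqDiff, if_false, h9] at hs1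
  have hs1p : Par c s1 := hs.frame
    (fun a ha => by have : a ≠ 18 ∧ a ≠ 20 := by omega
                    simp [hs1, this]) fun a ha => by simp [hs1]
  set X : ℕ → Prop := fun i => c.mdist S i ≤ s.real c.nd ∧ 1 ≤ w (c.near S i) with hX
  refine (ensures_loop (τ := 200 * (c.d * c.k) + 6) (fun r s' =>
      (∀ a, a < 16 ∧ a ≠ 8 ∨ 32 ≤ a ∧ a % 3 ≠ 2 → s'.nat a = s.nat a) ∧
      (∀ a, a ≤ c.nd → s'.real a = s.real a) ∧ s'.nat 20 = rb ∧ s'.nat 18 = r ∧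
      (∀ i, c.n ≤ i ∨ r ≤ i → s'.nat (3 * i + 32) = s.nat (3 * i + 32)) ∧
      remaining c s' = {i ∈ U | ¬ (X i ∧ i < r)} ∧
      s'.nat 8 = (remaining c s').card)
      c.n ?_ ?_ ?_).mono ?_ le_rfl
  · simp [hs1p.n]
  · have hrem : remaining c s1 = U := by
      rw [hU]
      refine remaining_congr fun i => ?_
      simp [hs1]
    refine ⟨fun a ha => ?_, fun a ha => ?_, ?_, ?_, fun i _ => ?_, ?_, ?_⟩
    · have : a ≠ 18 ∧ a ≠ 20 := by omega
      simp [hs1, this]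
    · simp [hs1]
    · simp [hs1]
    · simp [hs1]
    · simp [hs1]
    · rw [hrem]; simp
    · rw [hrem]; simp [hs1, hN]
  · rintro i hi s2 ⟨f1, f2, f3, f4, f5, f6, f7⟩
    have hs2p : Par c s2 := hs.frame (fun a ha => f1 a (by omega)) fun a ha => f2 a (by omega)
    have hdel : s2.nat (3 * i + 32) = s.nat (3 * i + 32) := f5 _ (by omega)
    have hiU : i ∈ U ↔ s.nat (3 * i + 32) = 0 := by rw [hU, mem_remaining]; simp [hi]
    -- Shared by all iterations that do not remove point i, for whichever reason.
    have hkeep : ∀ s', (∀ a, a < 16 ∨ 32 ≤ a → s'.nat a = s2.nat a) →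
        (∀ a, a ≤ c.nd → s'.real a = s2.real a) → s'.nat 20 = rb → s'.nat 18 = i + 1 →
        ¬ (i ∈ U ∧ X i) →
        (∀ a, a < 16 ∧ a ≠ 8 ∨ 32 ≤ a ∧ a % 3 ≠ 2 → s'.nat a = s.nat a) ∧
        (∀ a, a ≤ c.nd → s'.real a = s.real a) ∧ s'.nat 20 = rb ∧ s'.nat 18 = i + 1 ∧
        (∀ i', c.n ≤ i' ∨ i + 1 ≤ i' → s'.nat (3 * i' + 32) = s.nat (3 * i' + 32)) ∧
        remaining c s' = {i' ∈ U | ¬ (X i' ∧ i' < i + 1)} ∧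
        s'.nat 8 = (remaining c s').card := by
      intro s' k1 k2 k3 k4 k5
      have hrem : remaining c s' = remaining c s2 := remaining_congr fun i => k1 _ (by omega)
      refine ⟨fun a ha => ?_, fun a ha => ?_, k3, k4, fun i' hi' => ?_, ?_, ?_⟩
      · rw [k1 a (by omega), f1 a ha]
      · rw [k2 a ha, f2 a ha]
      · rw [k1 _ (by omega), f5 _ (by omega)]
      · rw [hrem, f6]
        refine Finset.filter_congr fun i' hi' => ?_
        rw [not_iff_not]
        constructor
        · rintro ⟨h1, h2⟩; exact ⟨h1, by omega⟩
        · rintro ⟨h1, h2⟩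
          refine ⟨h1, lt_of_le_of_ne (by omega) ?_⟩
          rintro rfl
          exact k5 ⟨hi', h1⟩
      · rw [hrem, ← f7, k1 8 (by omega)]
    refine ensures_seq (t1 := 200 * (c.d * c.k) + 4 + 1) (t2 := 1) ?_
    apply ensures_ite
    · intro h
      simp only [Test.holds_natLe, NExp.eval_load, delA, NExp.eval_hadd, NExp.eval_hmul,
        NExp.eval_lit, eval_cell, f4, hdel, Nat.le_zero] at h
      have hi' := hiU.mpr h
      apply ensures_seq
      refine (ensures_nearestP hs2p hd hk (i := i) (S := S) f4 hi
        (fun j hj => by rw [f3, f1 _ (by omega), hv j hj]) hS').mono ?_ le_rfl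
      rintro s3 ⟨g1, g2, g3, g4⟩
      have hs3p : Par c s3 := hs2p.frame (fun a ha => g1 a (by omega))
        fun a ha => g2 a (by omega) (by omega)
      change s3.nat 28 = c.near S i at g3
      change s3.real (c.nd + 2) = c.mdist S i at g4
      have q1 : s3.real c.nd = s.real c.nd := by
        rw [g2 _ (by omega) (by omega), f2 _ (by omega)]
      have hlt := Params.near_lt hk S i
      have q9 : s3.nat 9 = rb := by rw [g1 _ (by omega), f1 _ (by omega), h9]
      have qw : s3.nat (3 * (rb + c.near S i) + 34) = w (c.near S i) := by
        rw [g1 _ (by omega), f1 _ (by omega), hw _ hlt]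
      have qskip : ¬ X i → ∀ s', s' = (s3.setNat 31 0).setNat 18 (i + 1) →
        (∀ a, a < 16 ∧ a ≠ 8 ∨ 32 ≤ a ∧ a % 3 ≠ 2 → s'.nat a = s.nat a) ∧
        (∀ a, a ≤ c.nd → s'.real a = s.real a) ∧ s'.nat 20 = rb ∧ s'.nat 18 = i + 1 ∧
        (∀ i', c.n ≤ i' ∨ i + 1 ≤ i' → s'.nat (3 * i' + 32) = s.nat (3 * i' + 32)) ∧
        remaining c s' = {i' ∈ U | ¬ (X i' ∧ i' < i + 1)} ∧
        s'.nat 8 = (remaining c s').card := by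
        rintro hx s' rfl
        refine hkeep _ (fun a ha => ?_) (fun a ha => ?_) ?_ ?_ fun h => hx h.2
        · have : a ≠ 18 ∧ a ≠ 31 := by omega
          simp [this, g1 a (by omega)]
        · simp [g2 a (by omega) (by omega)]
        · simp [g1 20, f3]
        · simp
      have e18 : s3.nat 18 = i := by rw [g1 18 (by omega), f4]
      refine ensures_ite (t := 3) ?_ ?_
      · intro h'
        simp only [Test.holds_realLe, RExp.eval_load, NExp.eval_hadd, hs3p.coordsE,
          NExp.eval_lit, g4, q1] at h'
        refine ensures_ite (t := 2) ?_ ?_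
        · intro hx
          simp only [Test.holds_natLe, NExp.eval_load, wtA, NExp.eval_hadd, NExp.eval_hmul,
            NExp.eval_lit, eval_cell, q9, g3, qw] at hx
          apply ensures_setNat_seq
          apply ensures_setNat
          apply ensures_setNat
          have key : ∀ s', s' = ((s3.setNat (3 * i + 32) 1).setNat 8 (s3.nat 8 - 1)).setNat 18 (i + 1)
            → (∀ a, a < 16 ∧ a ≠ 8 ∨ 32 ≤ a ∧ a % 3 ≠ 2 → s'.nat a = s.nat a) ∧
            (∀ a, a ≤ c.nd → s'.real a = s.real a) ∧ s'.nat 20 = rb ∧ s'.nat 18 = i + 1 ∧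
            (∀ i', c.n ≤ i' ∨ i + 1 ≤ i' → s'.nat (3 * i' + 32) = s.nat (3 * i' + 32)) ∧
            remaining c s' = {i' ∈ U | ¬ (X i' ∧ i' < i + 1)} ∧
            s'.nat 8 = (remaining c s').card := by
            rintro s' rfl
            have hr : remaining c (((s3.setNat (3 * i + 32) 1).setNat 8 (s3.nat 8 - 1)).setNat 18
                (i + 1)) = (remaining c s2).erase i := by
              ext i'
              rw [Finset.mem_erase, mem_remaining, mem_remaining]
              by_cases hii : i' = i
              · subst hii; simp
              · simp [hii, g1 (3 * i' + 32) (by omega)]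
            refine ⟨fun a ha => ?_, fun a ha => ?_, ?_, ?_, fun i' hi' => ?_, ?_, ?_⟩
            · have : a ≠ 18 ∧ a ≠ 8 ∧ a ≠ 3 * i + 32 := by omega
              simp [this, g1 a (by omega), f1 a ha]
            · simp [g2 a (by omega) (by omega), f2 a ha]
            · simp [g1 20, f3]
            · simp
            · have : i' ≠ i := by omega
              simp [this, g1 (3 * i' + 32) (by omega), f5 i' (by omega)]
            · rw [hr, f6]
              ext i'
              simp only [Finset.mem_erase, Finset.mem_filter, not_and, not_lt]
              constructor
              · rintro ⟨h1, h2, h3⟩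
                exact ⟨h2, fun h => by have := h3 h; omega⟩
              · rintro ⟨h1, h2⟩
                refine ⟨?_, h1, fun h => by have := h2 h; omega⟩
                rintro rfl
                have := h2 ⟨h', hx⟩
                omega
            · rw [hr, Finset.card_erase_of_mem]
              · simp [g1 8, f7]
              · rw [f6, Finset.mem_filter]
                exact ⟨hi', fun h => lt_irrefl _ h.2⟩
          refine key _ ?_
          simp [delA, e18]
        · intro hx
          simp only [Test.holds_natLe, NExp.eval_load, wtA, NExp.eval_hadd, NExp.eval_hmul,
            NExp.eval_lit, eval_cell, q9, g3, qw] at hx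
          refine Ensures.mono (t := 1) ?_ (fun _ h => h) (by omega)
          apply ensures_setNat
          apply ensures_setNat
          exact qskip (fun h => hx h.2) _ (by simp [e18])
      · intro h'
        simp only [Test.holds_realLe, RExp.eval_load, NExp.eval_hadd, hs3p.coordsE,
          NExp.eval_lit, g4, q1] at h'
        refine Ensures.mono (t := 1) ?_ (fun _ h => h) (by omega)
        apply ensures_setNat
        apply ensures_setNat
        exact qskip (fun h => h' h.1) _ (by simp [e18])
    · intro h
      simp only [Test.holds_natLe, NExp.eval_load, delA, NExp.eval_hadd, NExp.eval_hmul,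
        NExp.eval_lit, eval_cell, f4, hdel, Nat.le_zero] at h
      refine Ensures.mono (t := 1) ?_ (fun _ h => h) (by omega)
      apply ensures_setNat
      apply ensures_setNat
      refine hkeep _ (fun a ha => ?_) (fun a ha => ?_) ?_ ?_ fun h' => h (hiU.mp h'.1)
      · have : a ≠ 18 ∧ a ≠ 31 := by omega
        simp [this]
      · simp
      · simp [f3]
      · simp [f4]
  · rintro s' ⟨h1, h2, h3, h4, h5, h6, h7⟩
    refine ⟨h1, h2, ?_, h7⟩
    rw [h6]
    refine Finset.filter_congr fun i hi => ?_
    have : i < c.n := by rw [hU, mem_remaining] at hi; exact hi.1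
    simp [hX, this]

end

/-! ### Sampling -/

/-- One step of reservoir sampling from `U`. -/
def reservoir (U : Finset ℕ) (i b : ℕ) : PMF ℕ :=
  (coin ((if i ∈ U then 1 else 0) / ({x ∈ U | x < i + 1} : Finset ℕ).card)).map
    fun t => if t then i else b

/-- The result of reservoir sampling from `U` among the numbers below `n`. -/
def pick (n : ℕ) (U : Finset ℕ) (b : ℕ) : PMF ℕ := chain (reservoir U) b n

theorem true_mem_coin {r : ℝ} (h : true ∈ (coin r).support) : 0 < r := by
  rw [PMF.mem_support_iff, coin, PMF.ofFintype_apply] at h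
  by_contra h'
  apply h
  have : min 1 r ≤ 0 := (min_le_right _ _).trans (not_lt.mp h')
  simp [this]

theorem false_mem_coin {r : ℝ} (h : false ∈ (coin r).support) : r < 1 := by
  rw [PMF.mem_support_iff, coin, PMF.ofFintype_apply] at h
  by_contra h'
  apply h
  simp [min_eq_left (not_lt.mp h')]

theorem expect_coin {r : ℝ} (h0 : 0 ≤ r) (h1 : r ≤ 1) (f : Bool → ℝ≥0∞) :
    expect (coin r) f = ENNReal.ofReal r * f true + ENNReal.ofReal (1 - r) * f false := by
  rw [expect, tsum_bool, coin, PMF.ofFintype_apply, PMF.ofFintype_apply, min_eq_right h1,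
    max_eq_right h0, add_comm]
  simp

/-- Induction on n: when N elements of U have been met, the newest is stored with probability 1/N,
and each older one, by induction, with probability (1 - 1/N) · 1/(N - 1). Multiplying by the number
of elements avoids the division. -/
theorem expect_reservoir (U : Finset ℕ) (b n : ℕ) (f : ℕ → ℝ≥0∞)
    (hU : ({x ∈ U | x < n} : Finset ℕ).Nonempty) :
    ({x ∈ U | x < n} : Finset ℕ).card * expect (chain (reservoir U) b n) f
      = ∑ x ∈ U with x < n, f x := by
  induction n with
  | zero => simp at hU
  | succ n ih =>
    simp only [chain, expect_bind, reservoir, expect_map]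
    set N := ({x ∈ U | x < n + 1} : Finset ℕ).card with hN
    have hN0 : 0 < N := Finset.card_pos.mpr hU
    by_cases hn : n ∈ U
    · have hins : ({x ∈ U | x < n + 1} : Finset ℕ) = insert n ({x ∈ U | x < n} : Finset ℕ) := by
        ext x
        simp only [Finset.mem_filter, Finset.mem_insert]
        constructor
        · rintro ⟨h1, h2⟩
          rcases Nat.lt_succ_iff_lt_or_eq.mp h2 with h | h
          · exact Or.inr ⟨h1, h⟩
          · exact Or.inl h
        · rintro (rfl | ⟨h1, h2⟩)
          · exact ⟨hn, by omega⟩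
          · exact ⟨h1, by omega⟩
      have hnot : n ∉ ({x ∈ U | x < n} : Finset ℕ) := by simp
      have hcard : N = ({x ∈ U | x < n} : Finset ℕ).card + 1 := by
        rw [hN, hins, Finset.card_insert_of_notMem hnot]
      have hNr : (1 : ℝ) ≤ N := by exact_mod_cast hN0
      have e1 : (N : ℝ≥0∞) * ENNReal.ofReal (1 / N) = 1 := by
        rw [← ENNReal.ofReal_natCast, ← ENNReal.ofReal_mul (by positivity),
          mul_one_div_cancel (by positivity), ENNReal.ofReal_one]
      have e2 : (N : ℝ≥0∞) * ENNReal.ofReal (1 - 1 / N)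
          = ({x ∈ U | x < n} : Finset ℕ).card := by
        rw [← ENNReal.ofReal_natCast, ← ENNReal.ofReal_mul (by positivity), mul_sub,
          mul_one_div_cancel (by positivity), hcard, ← ENNReal.ofReal_natCast]
        simp
      have hr1 : (1 : ℝ) / N ≤ 1 := (div_le_one (by linarith)).mpr hNr
      simp only [if_pos hn, expect_coin (by positivity : (0 : ℝ) ≤ 1 / N) hr1, if_true,
        Bool.false_eq_true, if_false]
      rw [expect_add, expect_const, expect_const_mul, mul_add, ← mul_assoc, ← mul_assoc, e1, e2,
        one_mul, hins, Finset.sum_insert hnot]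
      congr 1
      -- For the first element of U the old value has weight N - 1 = 0, so the initial content of
      -- the slot is forgotten.
      rcases ({x ∈ U | x < n} : Finset ℕ).eq_empty_or_nonempty with h | h
      · simp [h]
      · exact ih h
    · have hsame : ({x ∈ U | x < n + 1} : Finset ℕ) = ({x ∈ U | x < n} : Finset ℕ) := by
        refine Finset.filter_congr fun x hx => ?_
        have : x ≠ n := by rintro rfl; exact hn hx
        omega
      simp only [if_neg hn, zero_div, expect_coin le_rfl zero_le_one, ENNReal.ofReal_zero, zero_mul,
        zero_add, sub_zero, ENNReal.ofReal_one, one_mul, Bool.false_eq_true, if_false]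
      rw [hsame] at hN hU ⊢
      rw [hN]
      exact ih hU

theorem expect_pick {n : ℕ} {U : Finset ℕ} (hUn : U ⊆ Finset.range n) (hU : U.Nonempty) (b : ℕ)
    (f : ℕ → ℝ≥0∞) : U.card * expect (pick n U b) f = ∑ x ∈ U, f x := by
  have h : ({x ∈ U | x < n} : Finset ℕ) = U :=
    Finset.filter_true_of_mem fun x hx => Finset.mem_range.mp (hUn hx)
  have := expect_reservoir U b n f (by rwa [h])
  rwa [h] at this

theorem Refines.setNat_seq {β : Type*} {A : KMeansAlg} {T : ℕ → ℕ → ℕ → ℕ} {a e : NExp} {q : Prog}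
    {s : Mem} {ν : PMF β} {R : β → Mem → Prop} {t : ℕ}
    (h : Refines (q.run A T (s.setNat (a.eval s) (e.eval s))) ν R t) :
    Refines ((Prog.setNat a e ;; q).run A T s) ν R (t + 1) := by
  have h1 : Refines ((Prog.setNat a e).run A T s) (PMF.pure ())
      (fun _ s' => s' = s.setNat (a.eval s) (e.eval s)) 1 :=
    Ensures.refines (b := ()) (R := fun _ s' => s' = s.setNat (a.eval s) (e.eval s))
      (ensures_setNat rfl)
  have := h1.seq (ν' := fun _ => ν) (R' := R) (t' := t) (q := q)
    (by rintro _ _ rfl; exact h)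
  rw [PMF.pure_bind, add_comm] at this
  exact this

theorem Refines.seq_ensures {β γ : Type*} {A : KMeansAlg} {T : ℕ → ℕ → ℕ → ℕ} {p q : Prog}
    {s : Mem} {ν : PMF β} {R : β → Mem → Prop} {R' : γ → Mem → Prop} {t t' : ℕ} (φ : β → γ)
    (h : Refines (p.run A T s) ν R t)
    (h' : ∀ b s, R b s → Ensures (q.run A T s) (R' (φ b)) t') :
    Refines ((p ;; q).run A T s) (ν.map φ) R' (t + t') :=
  h.seq fun b s hb => (h' b s hb).refines

section
variable {A : KMeansAlg} {T : ℕ → ℕ → ℕ → ℕ} {c : Params}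

theorem refines_sampleP {s : Mem} (hs : Par c s) {U : Finset ℕ} (hU : U = remaining c s)
    (hne : U.Nonempty) {jj : ℕ} (h16 : s.nat 16 = jj) :
    Refines (sampleP.run A T s) (pick c.n U (s.nat (3 * (c.m + jj) + 33))) (fun v s' =>
      (∀ a, a ≤ 16 ∨ 32 ≤ a ∧ a ≠ 3 * (c.m + jj) + 33 → s'.nat a = s.nat a) ∧
      s'.real = s.real ∧ s'.nat (3 * (c.m + jj) + 33) = v ∧ v ∈ U)
      (c.n * 5 + 3) := by
  unfold sampleP
  apply Refines.setNat_seq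
  apply Refines.setNat_seq
  refine (refines_loop (τ := 4) (fun r v s' =>
      (∀ a, a ≤ 16 ∨ 32 ≤ a ∧ a ≠ 3 * (c.m + jj) + 33 → s'.nat a = s.nat a) ∧
      s'.real = s.real ∧ s'.nat (3 * (c.m + jj) + 33) = v ∧ s'.nat 18 = r ∧
      s'.nat 17 = ({x ∈ U | x < r} : Finset ℕ).card ∧ ∀ x ∈ U, x < r → v ∈ U)
      (reservoir U) c.n ?_ _ ?_ ?_).mono ?_ le_rfl
  · simp [hs.n]
  · refine ⟨fun a ha => ?_, ?_, ?_, ?_, ?_, ?_⟩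
    · have : a ≠ 17 ∧ a ≠ 18 := by omega
      simp [this]
    · simp
    · simp
    · simp
    · simp
    · simp
  · rintro i hi v s2 ⟨f1, f2, f3, f4, f5, f6⟩
    have hs2p : Par c s2 := hs.frame (fun a ha => f1 a (by omega)) fun a ha => by rw [f2]
    have hdel : s2.nat (3 * i + 32) = s.nat (3 * i + 32) := f1 _ (by omega)
    have hiU : i ∈ U ↔ s.nat (3 * i + 32) = 0 := by rw [hU, mem_remaining]; simp [hi]
    have hcount : ({x ∈ U | x < i + 1} : Finset ℕ).card
        = ({x ∈ U | x < i} : Finset ℕ).card + (1 - s2.nat (3 * i + 32)) := by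
      rw [hdel]
      have hsplit : ({x ∈ U | x < i + 1} : Finset ℕ)
          = ({x ∈ U | x < i} : Finset ℕ) ∪ ({x ∈ U | x = i} : Finset ℕ) := by
        rw [← Finset.filter_or]
        exact Finset.filter_congr fun x _ => Nat.lt_succ_iff_lt_or_eq
      rw [hsplit, Finset.card_union_of_disjoint]
      · congr 1
        by_cases h : s.nat (3 * i + 32) = 0
        · rw [Finset.filter_eq' U i, if_pos (hiU.mpr h), h]; simp
        · rw [Finset.filter_eq' U i, if_neg (mt hiU.mp h)]
          simp; omega
      · rw [Finset.disjoint_filter]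
        intro x _ h1 h2
        omega
    apply Refines.setNat_seq
    set s3 := s2.setNat _ _ with hs3
    simp only [NExp.eval_lit, NExp.eval_load, delA, NExp.eval_hadd, NExp.eval_hmul, NExp.eval_hsub,
      eval_cell, f4, f5, ← hcount] at hs3
    have hbias : (RExp.ofNat (1 - .load (delA (cell 18))) / .ofNat (cell 17)).eval s3
        = (if i ∈ U then 1 else 0) / ({x ∈ U | x < i + 1} : Finset ℕ).card := by
      simp only [RExp.eval_hdiv, RExp.eval_ofNat, NExp.eval_hsub, NExp.eval_load, delA,
        NExp.eval_hadd, NExp.eval_hmul, NExp.eval_lit, eval_cell, hs3, Mem.setNat_nat,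
        Nat.reduceEqDiff, if_false, if_true, f4, hdel]
      congr 1
      by_cases h : s.nat (3 * i + 32) = 0
      · simp [hiU.mpr h, h]
      · simp [mt hiU.mp h]; omega
    have hflip : Refines ((Prog.flip 19 (.ofNat (1 - .load (delA (cell 18))) / .ofNat (cell 17))).run
        A T s3) (coin ((if i ∈ U then 1 else 0) / ({x ∈ U | x < i + 1} : Finset ℕ).card))
        (fun b s' => b ∈ (coin ((if i ∈ U then 1 else 0) /
          ({x ∈ U | x < i + 1} : Finset ℕ).card)).support ∧
          s' = s3.setNat 19 (if b then 1 else 0)) 1 := by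
      rw [← hbias]
      exact refines_flip fun b hb => ⟨hb, rfl⟩
    refine Refines.mono (t := 1 + (1 + 1)) ?_ (fun _ _ h => h) (by omega)
    refine hflip.seq_ensures (fun b => if b then i else v) ?_
    rintro b s4 ⟨hb, rfl⟩
    apply ensures_setNat_seq
    apply ensures_setNat
    have e5 : s2.nat 5 = c.m := hs2p.m
    have e16 : s2.nat 16 = jj := by rw [f1 _ (by omega), h16]
    refine ⟨fun a ha => ?_, ?_, ?_, ?_, ?_, fun x hx hxi => ?_⟩
    · have : a ≠ 17 ∧ a ≠ 18 ∧ a ≠ 19 ∧ (32 ≤ a → a ≠ 3 * (c.m + jj) + 33) ∧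
        a ≠ 3 * (c.m + jj) + 33 := by omega
      simp [idxA, hs3, e5, e16, this, f1 a ha]
    · simp [hs3, f2]
    · cases b <;> simp [idxA, hs3, e5, e16, f3, f4]
    · simp [idxA, hs3, f4]
    · simp [idxA, hs3]
    · cases b
      -- A coin that can show 0 has bias below 1. If i is in U, this means that i is not the first
      -- element of U, so the stored value is already in U.
      · have h1 := false_mem_coin hb
        simp only [Bool.false_eq_true, if_false]
        by_cases hiU' : i ∈ U
        · rw [if_pos hiU', div_lt_one] at h1
          · have h2 : 1 < ({x ∈ U | x < i + 1} : Finset ℕ).card := by exact_mod_cast h1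
            obtain ⟨y, hy, hyi⟩ := Finset.exists_mem_ne h2 i
            rw [Finset.mem_filter] at hy
            exact f6 y hy.1 (by omega)
          · exact_mod_cast Finset.card_pos.mpr ⟨x, by simp [hx]; omega⟩
        · refine f6 x hx (lt_of_le_of_ne (by omega) ?_)
          rintro rfl
          exact hiU' hx
      · have h1 := true_mem_coin hb
        simp only [if_true]
        by_contra hiU'
        simp [hiU'] at h1
  · rintro v s' ⟨h1, h2, h3, h4, h5, h6⟩
    obtain ⟨x, hx⟩ := hne
    refine ⟨h1, h2, h3, h6 x hx ?_⟩
    rw [hU, mem_remaining] at hx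
    exact hx.1

/-- The step of the sampling process that draws sample `j`. -/
def drawStep (n : ℕ) (U : Finset ℕ) (j : ℕ) (b : ℕ → ℕ) : PMF (ℕ → ℕ) :=
  (pick n U (b j)).map (Function.update b j)

theorem refines_samplesP {s : Mem} (hs : Par c s) {U : Finset ℕ} (hU : U = remaining c s)
    (hne : U.Nonempty) :
    Refines (samplesP.run A T s)
      (chain (drawStep c.n U) (fun j => s.nat (3 * (c.m + j) + 33)) (c.smp + 1)) (fun S s' =>
      (∀ a, a < 16 ∨ 32 ≤ a ∧ (a % 3 ≠ 0 ∨ a < 3 * c.m + 33) → s'.nat a = s.nat a) ∧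
      s'.real = s.real ∧ ∀ j ≤ c.smp, s'.nat (3 * (c.m + j) + 33) = S j ∧ S j ∈ U)
      ((c.smp + 1) * (c.n * 5 + 5) + 2) := by
  unfold samplesP
  apply Refines.setNat_seq
  refine (refines_loop (τ := c.n * 5 + 3 + 1) (fun r S s' =>
      (∀ a, a < 16 ∨ 32 ≤ a ∧ (a % 3 ≠ 0 ∨ a < 3 * c.m + 33) → s'.nat a = s.nat a) ∧
      s'.real = s.real ∧ (∀ j, s'.nat (3 * (c.m + j) + 33) = S j) ∧ (∀ j < r, S j ∈ U) ∧
      s'.nat 16 = r)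
      (drawStep c.n U) (c.smp + 1) ?_ _ ?_ ?_).mono ?_ le_rfl
  · simp [hs.smp]
  · refine ⟨fun a ha => ?_, ?_, ?_, ?_, ?_⟩
    · have : a ≠ 16 := by omega
      simp [this]
    · simp
    · simp
    · simp
    · simp
  · rintro r hr S s2 ⟨f1, f2, f3, f4, f5⟩
    have hs2p : Par c s2 := hs.frame (fun a ha => f1 a (by omega)) fun a ha => by rw [f2]
    have hrem : U = remaining c s2 := by
      rw [hU]; exact (remaining_congr fun i => f1 _ (by omega)).symm
    have hp := refines_sampleP (A := A) (T := T) hs2p hrem hne f5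
    rw [f3] at hp
    refine hp.seq_ensures (Function.update S r) ?_
    rintro v s3 ⟨g1, g2, g3, g4⟩
    apply ensures_setNat
    refine ⟨fun a ha => ?_, ?_, fun j => ?_, fun j hj => ?_, ?_⟩
    · have : a ≠ 16 := by omega
      simp [this, g1 a (by omega), f1 a ha]
    · simp [g2, f2]
    · by_cases h : j = r
      · subst h; simp [g3]
      · simp [h, g1 (3 * (c.m + j) + 33) (by omega), f3]
    · by_cases h : j = r
      · subst h; simp [g4]
      · simp only [Function.update_apply, h, if_false]
        exact f4 j (by omega)
    · simp [g1 16, f5]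
  · rintro S s' ⟨h1, h2, h3, h4, h5⟩
    exact ⟨h1, h2, fun j hj => ⟨h3 j, h4 j (by omega)⟩⟩

end

/-! ### A trial succeeds with constant probability -/

section
variable {c : Params}

/-- The samples cover enough points, and many of the points of `U` are not much closer to the
centers than the threshold; here `a i` is the squared distance of point `i` to the centers. -/
def GoodSample (c : Params) (U : Finset ℕ) (a : ℕ → ℝ) (S : ℕ → ℕ) : Prop :=
  U.card ≤ 8 * ∑ j ∈ Finset.range c.smp, c.wgt S U (c.mdist S (S c.smp)) j ∧
  U.card ≤ 8 * ({i ∈ U | c.mdist S (S c.smp) ≤ 4 * a i} : Finset ℕ).card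

/-- Nearest samples, distances and weights do not depend on the pivot, which is entry `c.smp`. This
allows drawing the pivot after fixing the other samples. -/
theorem near_congr (hk : 0 < c.k) {S S' : ℕ → ℕ} (h : ∀ j < c.smp, S j = S' j) (i : ℕ) :
    c.near S i = c.near S' i :=
  firstMin_congr (by rw [Params.smp]; omega) fun j hj => by rw [h j hj]

theorem mdist_congr (hk : 0 < c.k) {S S' : ℕ → ℕ} (h : ∀ j < c.smp, S j = S' j) (i : ℕ) :
    c.mdist S i = c.mdist S' i := by
  rw [Params.mdist, Params.mdist, near_congr hk h, h _ (Params.near_lt hk S' i)]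

theorem wgt_congr (hk : 0 < c.k) {S S' : ℕ → ℕ} (h : ∀ j < c.smp, S j = S' j) (U : Finset ℕ)
    (t : ℝ) (j : ℕ) : c.wgt S U t j = c.wgt S' U t j := by
  have : c.part S U t j = c.part S' U t j := by
    unfold Params.part
    exact Finset.filter_congr fun i _ => by rw [mdist_congr hk h, near_congr hk h]
  rw [Params.wgt, Params.wgt, this]

theorem mdist_le (S : ℕ → ℕ) (i : ℕ) {j : ℕ} (hj : j < c.smp) : c.mdist S i ≤ c.D i (S j) :=
  firstMin_le (fun j => c.D i (S j)) hj

theorem sum_card_part (hk : 0 < c.k) (S : ℕ → ℕ) (U : Finset ℕ) (t : ℝ) :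
    ∑ j ∈ Finset.range c.smp, (c.part S U t j).card
      = ({i ∈ U | c.mdist S i ≤ t} : Finset ℕ).card := by
  rw [Finset.card_eq_sum_card_fiberwise (f := c.near S) (t := Finset.range c.smp)]
  · refine Finset.sum_congr rfl fun j _ => ?_
    rw [Params.part, Finset.filter_filter]
  · intro i _
    simpa using Params.near_lt hk S i

/-- Each cleared sample loses fewer than 1/(8 `c.smp`) of the points of U, hence all together at
most 1/8 of U; a quarter minus an eighth remains. -/
theorem card_le_sum_wgt (hk : 0 < c.k) (S : ℕ → ℕ) (U : Finset ℕ) (t : ℝ)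
    (h : U.card ≤ 4 * ({i ∈ U | c.mdist S i ≤ t} : Finset ℕ).card) :
    U.card ≤ 8 * ∑ j ∈ Finset.range c.smp, c.wgt S U t j := by
  have h1 : ∀ j ∈ Finset.range c.smp, 8 * c.smp * (c.part S U t j).card
      ≤ 8 * c.smp * c.wgt S U t j + U.card := by
    intro j _
    rw [Params.wgt]
    split_ifs with hj <;> omega
  have h2 := Finset.sum_le_sum h1
  rw [← Finset.mul_sum, sum_card_part hk, Finset.sum_add_distrib, ← Finset.mul_sum,
    Finset.sum_const, Finset.card_range, smul_eq_mul] at h2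
  have hs : 0 < c.smp := by rw [Params.smp]; omega
  have h3 : c.smp * (8 * ({i ∈ U | c.mdist S i ≤ t} : Finset ℕ).card)
      ≤ c.smp * (8 * ∑ j ∈ Finset.range c.smp, c.wgt S U t j + U.card) := by linarith
  have h4 := Nat.le_of_mul_le_mul_left h3 hs
  omega

/-- Take μ as the least value attained on U that has 7/8 of U at or below it. The points strictly
below μ are fewer than 7/8 of U, since otherwise their maximum would be a smaller choice. -/
theorem exists_quantile (U : Finset ℕ) (hU : U.Nonempty) (a : ℕ → ℝ) :
    ∃ μ : ℝ, 7 * U.card ≤ 8 * ({i ∈ U | a i ≤ μ} : Finset ℕ).card ∧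
      U.card ≤ 8 * ({i ∈ U | μ ≤ a i} : Finset ℕ).card := by
  have hpos := Finset.card_pos.mpr hU
  let V : Finset ℕ := {v ∈ U | 7 * U.card ≤ 8 * ({i ∈ U | a i ≤ a v} : Finset ℕ).card}
  have hV : V.Nonempty := by
    obtain ⟨v, hv, hmax⟩ := Finset.exists_max_image U a hU
    refine ⟨v, Finset.mem_filter.mpr ⟨hv, ?_⟩⟩
    rw [Finset.filter_true_of_mem hmax]
    omega
  obtain ⟨v, hv, hmin⟩ := Finset.exists_min_image V a hV
  have hv' := Finset.mem_filter.mp hv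
  refine ⟨a v, hv'.2, ?_⟩
  have hsplit := Finset.card_filter_add_card_filter_not (s := U) fun i => a v ≤ a i
  have hlt : 8 * ({i ∈ U | ¬ a v ≤ a i} : Finset ℕ).card < 7 * U.card := by
    by_contra hcon
    have hne : ({i ∈ U | ¬ a v ≤ a i} : Finset ℕ).Nonempty := by
      rw [← Finset.card_pos]; omega
    obtain ⟨w, hw, hmax⟩ := Finset.exists_max_image _ a hne
    have hw' := Finset.mem_filter.mp hw
    refine hw'.2 (hmin w (Finset.mem_filter.mpr ⟨hw'.1, ?_⟩))
    refine (not_lt.mp hcon).trans (Nat.mul_le_mul_left 8 (Finset.card_le_card fun i hi => ?_))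
    exact Finset.mem_filter.mpr ⟨(Finset.mem_filter.mp hi).1, hmax i hi⟩
  omega

/-- All points of low rank lie at or below the one among them with the largest value, whose own rank
is less than a quarter. This bounds the number of pivots whose threshold covers too few points. -/
theorem card_low_rank (U : Finset ℕ) (f : ℕ → ℝ) :
    4 * ({p ∈ U | 4 * ({i ∈ U | f i ≤ f p} : Finset ℕ).card < U.card} : Finset ℕ).card
      ≤ U.card := by
  set B : Finset ℕ := {p ∈ U | 4 * ({i ∈ U | f i ≤ f p} : Finset ℕ).card < U.card} with hB
  rcases B.eq_empty_or_nonempty with h | h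
  · rw [h]; simp
  · obtain ⟨p, hp, hmax⟩ := Finset.exists_max_image B f h
    have hp' := (Finset.mem_filter.mp hp).2
    have : B.card ≤ ({i ∈ U | f i ≤ f p} : Finset ℕ).card :=
      Finset.card_le_card fun i hi =>
        Finset.mem_filter.mpr ⟨(Finset.mem_filter.mp hi).1, hmax i hi⟩
    omega

/-- These are two terms of the binomial expansion. With q the size of a cluster and p + q = N, it
bounds the expected number of its points when r samples miss it, q (p/N)^r, by N/(r + 1). -/
theorem mul_pow_mul_le_pow (p q r : ℕ) : (r + 1) * (p ^ r * q) + p ^ (r + 1) ≤ (p + q) ^ (r + 1) := by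
  induction r with
  | zero => simp; omega
  | succ r ih =>
    calc (r + 1 + 1) * (p ^ (r + 1) * q) + p ^ (r + 1 + 1)
        ≤ ((r + 1) * (p ^ r * q) + p ^ (r + 1)) * (p + q) := by
          have : 0 ≤ (r + 1) * (p ^ r * q) * q := Nat.zero_le _
          ring_nf at this ⊢
          nlinarith
      _ ≤ (p + q) ^ (r + 1) * (p + q) := Nat.mul_le_mul_right _ ih
      _ = _ := by ring

theorem expect_pick_notMem {n : ℕ} {U Q : Finset ℕ} (hUn : U ⊆ Finset.range n) (hU : U.Nonempty)
    (b : ℕ) : U.card * expect (pick n U b) (ind fun v => v ∉ Q) = (U \ Q).card := by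
  rw [expect_pick hUn hU, ← Finset.filter_notMem_eq_sdiff, Finset.card_filter]
  push_cast
  refine Finset.sum_congr rfl fun i _ => ?_
  by_cases h : i ∈ Q <;> simp [ind, h]

/-- The draws are independent and uniform, so r draws miss Q with probability (|U \ Q| / |U|)^r;
again the denominators are multiplied out. -/
theorem expect_draw_miss {n : ℕ} {U Q : Finset ℕ} (hUn : U ⊆ Finset.range n) (hU : U.Nonempty)
    (S0 : ℕ → ℕ) (r : ℕ) :
    (U.card : ℝ≥0∞) ^ r * expect (chain (drawStep n U) S0 r) (ind fun S => ∀ j < r, S j ∉ Q)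
      = ((U \ Q).card : ℝ≥0∞) ^ r := by
  induction r with
  | zero => simp [chain, expect_pure, ind]
  | succ r ih =>
    have h : ∀ (S : ℕ → ℕ) (v : ℕ), ind (fun S : ℕ → ℕ => ∀ j < r + 1, S j ∉ Q)
        (Function.update S r v) = ind (fun S : ℕ → ℕ => ∀ j < r, S j ∉ Q) S *
          ind (fun v => v ∉ Q) v := by
      intro S v
      have : (∀ j < r + 1, Function.update S r v j ∉ Q) ↔ (∀ j < r, S j ∉ Q) ∧ v ∉ Q := by
        constructor
        · intro h
          refine ⟨fun j hj => ?_, by simpa using h r (by omega)⟩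
          have := h j (by omega)
          rwa [Function.update_of_ne hj.ne] at this
        · rintro ⟨h1, h2⟩ j hj
          by_cases hjr : j = r
          · subst hjr; simpa using h2
          · rw [Function.update_of_ne hjr]; exact h1 j (by omega)
      by_cases h1 : ∀ j < r, S j ∉ Q
      · rw [ind_of (Q := fun S : ℕ → ℕ => ∀ j < r, S j ∉ Q) h1, one_mul]
        by_cases h2 : v ∉ Q
        · rw [ind_of (Q := fun v => v ∉ Q) h2, ind_of (this.mpr ⟨h1, h2⟩)]
        · rw [ind_of_not (Q := fun v => v ∉ Q) h2, ind_of_not fun h => h2 (this.mp h).2]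
      · rw [ind_of_not (Q := fun S : ℕ → ℕ => ∀ j < r, S j ∉ Q) h1, zero_mul,
          ind_of_not fun h => h1 (this.mp h).1]
    simp only [chain, expect_bind, drawStep, expect_map, h, expect_const_mul]
    rw [pow_succ, pow_succ, ← ih, mul_assoc, mul_assoc, ← expect_const_mul]
    congr 1
    rw [mul_comm (expect _ _), ← expect_const_mul]
    congr 1
    funext S
    rw [mul_left_comm, expect_pick_notMem hUn hU, mul_comm]

/-! ### Samples against the clusters of a fixed solution -/

variable {E : Type*} [PseudoMetricSpace E] {x : ℕ → E} {C : Fin c.k → E} {cl : ℕ → Fin c.k}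
  {a : ℕ → ℝ}

/-- Both points are within √μ of their common center, so they are within 2√μ of each other. -/
theorem mdist_le_of_same_cluster (hD : ∀ i j, c.D i j = dist (x i) (x j) ^ 2)
    (ha : ∀ i, a i = dist (x i) (C (cl i)) ^ 2) {μ : ℝ} (S : ℕ → ℕ) {i j : ℕ} (hj : j < c.smp)
    (hi : a i ≤ μ) (hSj : a (S j) ≤ μ) (hcl : cl (S j) = cl i) : c.mdist S i ≤ 4 * μ := by
  refine (mdist_le S i hj).trans ?_
  rw [hD]
  rw [ha] at hi hSj
  rw [hcl] at hSj
  have := dist_triangle_right (x i) (x (S j)) (C (cl i))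
  have h0 := dist_nonneg (x := x i) (y := x (S j))
  nlinarith [sq_nonneg (dist (x i) (C (cl i)) - dist (x (S j)) (C (cl i)))]

/-- A cheap point i is uncovered only if every sample misses the cheap part `Q (cl i)` of its
cluster. Each of the k parts contributes in expectation at most |U| / (8k), by `expect_draw_miss`
and `mul_pow_mul_le_pow` with 8k samples. -/
theorem expect_uncovered_le (hk : 0 < c.k) {U : Finset ℕ} (hUn : U ⊆ Finset.range c.n)
    (hU : U.Nonempty) (hD : ∀ i j, c.D i j = dist (x i) (x j) ^ 2)
    (ha : ∀ i, a i = dist (x i) (C (cl i)) ^ 2) (μ : ℝ) (S0 : ℕ → ℕ) :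
    8 * expect (chain (drawStep c.n U) S0 c.smp) (fun S =>
      (({i ∈ U | a i ≤ μ ∧ ¬ c.mdist S i ≤ 4 * μ} : Finset ℕ).card : ℝ≥0∞)) ≤ U.card := by
  set G : Finset ℕ := {i ∈ U | a i ≤ μ} with hG
  set Q : Fin c.k → Finset ℕ := fun l => {i ∈ G | cl i = l} with hQ
  have hQU : ∀ l, Q l ⊆ U := fun l =>
    (Finset.filter_subset _ _).trans (Finset.filter_subset _ _)
  have h1 : ∀ S : ℕ → ℕ,
      (({i ∈ U | a i ≤ μ ∧ ¬ c.mdist S i ≤ 4 * μ} : Finset ℕ).card : ℝ≥0∞)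
      ≤ ∑ i ∈ G, ind (fun S : ℕ → ℕ => ∀ j < c.smp, S j ∉ Q (cl i)) S := by
    intro S
    rw [← Finset.filter_filter, Finset.card_filter]
    push_cast
    refine Finset.sum_le_sum fun i hi => ?_
    by_cases h : ∀ j < c.smp, S j ∉ Q (cl i)
    · rw [ind_of (Q := fun S : ℕ → ℕ => ∀ j < c.smp, S j ∉ Q (cl i)) h]
      split_ifs <;> simp
    · push Not at h
      obtain ⟨j, hj, hSj⟩ := h
      rw [hQ, Finset.mem_filter, hG, Finset.mem_filter] at hSj
      rw [if_neg]
      · exact zero_le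
      · rw [not_not]
        exact mdist_le_of_same_cluster hD ha S hj (Finset.mem_filter.mp hi).2 hSj.1.2 hSj.2
  have hN : (U.card : ℝ≥0∞) ≠ 0 := by simp [hU.ne_empty]
  have hNpow : (U.card : ℝ≥0∞) ^ c.smp ≠ 0 := pow_ne_zero _ hN
  have hNtop : (U.card : ℝ≥0∞) ^ c.smp ≠ ⊤ := by finiteness
  rw [← ENNReal.mul_le_mul_iff_right hNpow hNtop]
  calc (U.card : ℝ≥0∞) ^ c.smp * (8 * expect (chain (drawStep c.n U) S0 c.smp) (fun S =>
      (({i ∈ U | a i ≤ μ ∧ ¬ c.mdist S i ≤ 4 * μ} : Finset ℕ).card : ℝ≥0∞)))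
      ≤ (U.card : ℝ≥0∞) ^ c.smp * (8 * expect (chain (drawStep c.n U) S0 c.smp) (fun S =>
        ∑ i ∈ G, ind (fun S : ℕ → ℕ => ∀ j < c.smp, S j ∉ Q (cl i)) S)) := by
        gcongr
        exact expect_mono fun S _ => h1 S
    _ = 8 * ∑ i ∈ G, ((U \ Q (cl i)).card : ℝ≥0∞) ^ c.smp := by
        rw [expect_finset_sum, mul_left_comm, Finset.mul_sum]
        congr 1
        exact Finset.sum_congr rfl fun i _ => expect_draw_miss hUn hU S0 c.smp
    _ = 8 * ∑ l, ((Q l).card * (U \ Q l).card ^ c.smp : ℕ) := by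
        congr 1
        rw [← Finset.sum_fiberwise G cl]
        push_cast
        refine Finset.sum_congr rfl fun l _ => ?_
        rw [Finset.sum_congr rfl (g := fun _ => ((U \ Q l).card : ℝ≥0∞) ^ c.smp)
          fun i hi => by rw [(Finset.mem_filter.mp hi).2], Finset.sum_const, nsmul_eq_mul]
    _ ≤ (U.card ^ (c.smp + 1) : ℕ) := by
        have h2 : ∀ l ∈ Finset.univ, c.smp * ((Q l).card * (U \ Q l).card ^ c.smp)
            ≤ U.card ^ (c.smp + 1) := by
          intro l _
          have e := Finset.card_sdiff_add_card_eq_card (hQU l)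
          have := mul_pow_mul_le_pow (U \ Q l).card (Q l).card c.smp
          rw [e] at this
          calc c.smp * ((Q l).card * (U \ Q l).card ^ c.smp)
              ≤ (c.smp + 1) * ((U \ Q l).card ^ c.smp * (Q l).card) := by
                rw [mul_comm (Q l).card]; exact Nat.mul_le_mul_right _ (Nat.le_succ _)
            _ ≤ _ := by omega
        have h3 := Finset.sum_le_sum h2
        rw [← Finset.mul_sum, Finset.sum_const, Finset.card_univ, Fintype.card_fin, smul_eq_mul,
          Params.smp] at h3
        have h4 : c.k * (8 * ∑ l, ((Q l).card * (U \ Q l).card ^ c.smp))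
            ≤ c.k * U.card ^ (c.smp + 1) := by
          rw [← mul_assoc, mul_comm c.k 8]
          simpa only [Params.smp] using h3
        exact_mod_cast Nat.le_of_mul_le_mul_left h4 hk
    _ = (U.card : ℝ≥0∞) ^ c.smp * U.card := by push_cast; rw [pow_succ]

theorem half_le_of_add_eq_one {u v : ℝ≥0∞} (h : u + v = 1) (hv : 2 * v ≤ 1) : 1 / 2 ≤ u := by
  have h' : v ≤ 1 / 2 := by
    rw [ENNReal.le_div_iff_mul_le (by simp) (by simp), mul_comm]
    exact hv
  have h2 : u = 1 - v := ENNReal.eq_sub_of_add_eq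
    (ne_top_of_le_ne_top (by simp) h') h
  rw [h2]
  refine le_trans (le_of_eq ?_) (tsub_le_tsub_left h' 1)
  rw [one_div, ENNReal.one_sub_inv_two]

/-- The probability 1/8 is 1/2 for the samples covering 5/8 of U within 4μ, times 1/4 for a suitable
pivot given such samples. -/
theorem expect_goodSample (hk : 0 < c.k) {U : Finset ℕ} (hUn : U ⊆ Finset.range c.n)
    (hU : U.Nonempty) (hD : ∀ i j, c.D i j = dist (x i) (x j) ^ 2)
    (ha : ∀ i, a i = dist (x i) (C (cl i)) ^ 2) (S0 : ℕ → ℕ) :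
    1 / 8 ≤ expect (chain (drawStep c.n U) S0 (c.smp + 1)) (ind (GoodSample c U a)) := by
  obtain ⟨μ, hμ1, hμ2⟩ := exists_quantile U hU a
  set Cov : (ℕ → ℕ) → Prop := fun S =>
    5 * U.card ≤ 8 * ({i ∈ U | c.mdist S i ≤ 4 * μ} : Finset ℕ).card with hCov
  have hN : (U.card : ℝ≥0∞) ≠ 0 := by simp [hU.ne_empty]
  have hNtop : (U.card : ℝ≥0∞) ≠ ⊤ := by finiteness
  have hcov : 1 / 2 ≤ expect (chain (drawStep c.n U) S0 c.smp) (ind Cov) := by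
    -- Markov's inequality: if `Cov` fails, more than 7/8 - 5/8 = 1/4 of U is cheap but uncovered,
    -- whereas the expectation of this share is at most 1/8.
    have h1 : (U.card : ℝ≥0∞) * expect (chain (drawStep c.n U) S0 c.smp) (ind fun S => ¬ Cov S)
        ≤ 4 * expect (chain (drawStep c.n U) S0 c.smp) (fun S =>
      (({i ∈ U | a i ≤ μ ∧ ¬ c.mdist S i ≤ 4 * μ} : Finset ℕ).card : ℝ≥0∞)) := by
      rw [← expect_const_mul, ← expect_const_mul]
      refine expect_mono fun S _ => ?_
      by_cases h : Cov S
      · rw [ind_of_not (Q := fun S => ¬ Cov S) (not_not.mpr h), mul_zero]; exact zero_le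
      · rw [ind_of (Q := fun S => ¬ Cov S) h, mul_one]
        rw [hCov, not_le] at h
        have e : ({i ∈ U | a i ≤ μ} : Finset ℕ).card
            ≤ ({i ∈ U | a i ≤ μ ∧ ¬ c.mdist S i ≤ 4 * μ} : Finset ℕ).card
              + ({i ∈ U | c.mdist S i ≤ 4 * μ} : Finset ℕ).card := by
          refine (Finset.card_le_card fun i hi => ?_).trans (Finset.card_union_le _ _)
          rw [Finset.mem_filter] at hi
          rw [Finset.mem_union, Finset.mem_filter, Finset.mem_filter]
          by_cases h' : c.mdist S i ≤ 4 * μ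
          · exact Or.inr ⟨hi.1, h'⟩
          · exact Or.inl ⟨hi.1, hi.2, h'⟩
        exact_mod_cast (by omega : U.card ≤
          4 * ({i ∈ U | a i ≤ μ ∧ ¬ c.mdist S i ≤ 4 * μ} : Finset ℕ).card)
    have h2 := expect_uncovered_le hk hUn hU hD ha μ S0
    have h3 : (U.card : ℝ≥0∞) * (2 * expect (chain (drawStep c.n U) S0 c.smp)
        (ind fun S => ¬ Cov S)) ≤ U.card * 1 := by
      calc _ = 2 * ((U.card : ℝ≥0∞) * expect (chain (drawStep c.n U) S0 c.smp)
            (ind fun S => ¬ Cov S)) := by ring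
        _ ≤ 2 * (4 * expect (chain (drawStep c.n U) S0 c.smp) (fun S =>
            (({i ∈ U | a i ≤ μ ∧ ¬ c.mdist S i ≤ 4 * μ} : Finset ℕ).card : ℝ≥0∞))) := by gcongr
        _ = 8 * expect (chain (drawStep c.n U) S0 c.smp) (fun S =>
            (({i ∈ U | a i ≤ μ ∧ ¬ c.mdist S i ≤ 4 * μ} : Finset ℕ).card : ℝ≥0∞)) := by ring
        _ ≤ _ := by rw [mul_one]; exact h2
    rw [ENNReal.mul_le_mul_iff_right hN hNtop] at h3
    exact half_le_of_add_eq_one (expect_ind_not (chain (drawStep c.n U) S0 c.smp) Cov) h3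
  have hpivot : ∀ S, Cov S → 1 / 4 ≤ expect (pick c.n U (S c.smp))
      (fun v => ind (GoodSample c U a) (Function.update S c.smp v)) := by
    intro S hS
    have hcongr : ∀ v, ∀ j < c.smp, Function.update S c.smp v j = S j := fun v j hj =>
      Function.update_of_ne hj.ne _ _
    have hgood : ∀ v ∈ U, c.mdist S v ≤ 4 * μ →
        ¬ 4 * ({i ∈ U | c.mdist S i ≤ c.mdist S v} : Finset ℕ).card < U.card →
        GoodSample c U a (Function.update S c.smp v) := by
      intro v hv h1 h2
      unfold GoodSample
      simp only [Function.update_self, mdist_congr hk (hcongr v), wgt_congr hk (hcongr v)]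
      refine ⟨card_le_sum_wgt hk S U _ (not_lt.mp h2), hμ2.trans ?_⟩
      refine Nat.mul_le_mul_left 8 (Finset.card_le_card fun i hi => ?_)
      rw [Finset.mem_filter] at hi ⊢
      exact ⟨hi.1, h1.trans (by linarith [hi.2])⟩
    have hlow := card_low_rank U (c.mdist S)
    set B : Finset ℕ := {p ∈ U | 4 * ({i ∈ U | c.mdist S i ≤ c.mdist S p} : Finset ℕ).card
      < U.card} with hB
    set K : Finset ℕ := {i ∈ U | c.mdist S i ≤ 4 * μ} with hK
    -- Pivots in K keep the threshold below 4μ, those in B have too low a rank; 5/8 - 1/4 = 3/8 of U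
    -- exceeds the quarter needed.
    have hKB : U.card ≤ 4 * (K \ B).card := by
      have := Finset.le_card_sdiff B K
      have hS' : 5 * U.card ≤ 8 * K.card := hS
      omega
    have h1 : ((K \ B).card : ℝ≥0∞) ≤ U.card * expect (pick c.n U (S c.smp))
        (fun v => ind (GoodSample c U a) (Function.update S c.smp v)) := by
      rw [expect_pick hUn hU]
      calc ((K \ B).card : ℝ≥0∞) = ∑ v ∈ K \ B, 1 := by simp
        _ = ∑ v ∈ K \ B, ind (GoodSample c U a) (Function.update S c.smp v) := by
          refine Finset.sum_congr rfl fun v hv => ?_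
          rw [Finset.mem_sdiff, hK, hB, Finset.mem_filter, Finset.mem_filter] at hv
          rw [ind_of (hgood v hv.1.1 hv.1.2 fun h => hv.2 ⟨hv.1.1, h⟩)]
        _ ≤ _ := Finset.sum_le_sum_of_subset
          (Finset.sdiff_subset.trans (Finset.filter_subset _ _))
    have h2 : (U.card : ℝ≥0∞) * 1 ≤ U.card * (4 * expect (pick c.n U (S c.smp))
        (fun v => ind (GoodSample c U a) (Function.update S c.smp v))) := by
      calc (U.card : ℝ≥0∞) * 1 ≤ 4 * (K \ B).card := by rw [mul_one]; exact_mod_cast hKB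
        _ ≤ 4 * (U.card * expect (pick c.n U (S c.smp))
          (fun v => ind (GoodSample c U a) (Function.update S c.smp v))) := by gcongr
        _ = _ := by ring
    rw [ENNReal.mul_le_mul_iff_right hN hNtop] at h2
    rw [ENNReal.div_le_iff_le_mul (by simp) (by simp), mul_comm]
    exact h2
  have hfin : 1 / 4 * (1 / 2 : ℝ≥0∞) ≤ expect (chain (drawStep c.n U) S0 (c.smp + 1))
      (ind (GoodSample c U a)) := by
    rw [chain, expect_bind]
    refine (mul_le_mul_right hcov (1 / 4)).trans ?_
    rw [← expect_const_mul]
    refine expect_mono fun S _ => ?_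
    rw [drawStep, expect_map]
    by_cases h : Cov S
    · rw [ind_of h, mul_one]; exact hpivot S h
    · rw [ind_of_not h, mul_zero]; exact zero_le
  refine le_trans (le_of_eq ?_) hfin
  rw [one_div, one_div, one_div, ← ENNReal.mul_inv (by simp) (by simp)]
  norm_num

end

/-! ### One trial, and all trials of a round -/

section
variable {A : KMeansAlg} {T : ℕ → ℕ → ℕ → ℕ} {c : Params}

theorem Saved.congr {U : Finset ℕ} {rb : ℕ} {s s' : Mem} (h : Saved c U rb s)
    (h10 : s'.nat 10 = s.nat 10) (hbt : s'.real c.nd = s.real c.nd)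
    (h1 : ∀ j < c.smp, s'.nat (3 * (rb + j) + 33) = s.nat (3 * (rb + j) + 33))
    (h2 : ∀ j < c.smp, s'.nat (3 * (rb + j) + 34) = s.nat (3 * (rb + j) + 34)) :
    Saved c U rb s' := by
  obtain ⟨S, hS, hv, hw⟩ := h
  refine ⟨S, hS, fun j hj => by rw [h1 j hj, hv j hj], ?_⟩
  rw [h10, hbt]
  rcases hw with ⟨ha, hb⟩ | ⟨ha, hb, hc⟩
  · exact Or.inl ⟨ha, fun j hj => by rw [h2 j hj, hb j hj]⟩
  · exact Or.inr ⟨ha, hb, fun j hj => by rw [h2 j hj, hc j hj]⟩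

/-- The invariant of the trials of a round that starts in memory `s0`. -/
structure TrialInv (c : Params) (U : Finset ℕ) (rb : ℕ) (s0 s : Mem) : Prop where
  nat : ∀ a, a < 16 ∧ a ≠ 10 ∨ 32 ≤ a ∧ (a % 3 = 2 ∨ a < 3 * rb + 33 ∨
    3 * (rb + c.smp) + 33 ≤ a ∧ a < 3 * c.m + 33) → s.nat a = s0.nat a
  real : ∀ a < c.nd, s.real a = s0.real a
  saved : Saved c U rb s

/-- A trial with a small threshold has been saved. -/
def GoodSaved (c : Params) (U : Finset ℕ) (a : ℕ → ℝ) (s : Mem) : Prop :=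
  s.nat 10 = 1 ∧ U.card ≤ 8 * ({i ∈ U | s.real c.nd ≤ 4 * a i} : Finset ℕ).card

/-- This is why keeping the least threshold is right: it inherits the quality of any good trial,
without knowledge of `a`. -/
theorem card_filter_le_of_le {U : Finset ℕ} {a : ℕ → ℝ} {t t' : ℝ} (h : t' ≤ t)
    (hU : U.card ≤ 8 * ({i ∈ U | t ≤ 4 * a i} : Finset ℕ).card) :
    U.card ≤ 8 * ({i ∈ U | t' ≤ 4 * a i} : Finset ℕ).card :=
  hU.trans (Nat.mul_le_mul_left 8 (Finset.card_le_card fun i hi => by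
    rw [Finset.mem_filter] at hi ⊢
    exact ⟨hi.1, h.trans hi.2⟩))

/-- Only the sampling is random. The remaining steps are deterministic, so the samples alone serve
as the abstract value of the whole trial. -/
theorem refines_trialP (hd : 0 < c.d) (hk : 0 < c.k) {s0 s : Mem} (hs0 : Par c s0) {rb : ℕ}
    (h9 : s0.nat 9 = rb) (hrb : rb + c.smp ≤ c.m) {U : Finset ℕ} (hU : U = remaining c s0)
    (hN : s0.nat 8 = U.card) (hne : U.Nonempty) (a : ℕ → ℝ) (hs : TrialInv c U rb s0 s) :
    Refines (trialP.run A T s)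
      (chain (drawStep c.n U) (fun j => s.nat (3 * (c.m + j) + 33)) (c.smp + 1)) (fun S s' =>
      TrialInv c U rb s0 s' ∧ (GoodSample c U a S → GoodSaved c U a s') ∧
      (GoodSaved c U a s → GoodSaved c U a s'))
      (((c.smp + 1) * (c.n * 5 + 5) + 2) + (300 * (c.d * c.k) +
        (c.n * (200 * (c.d * c.k) + 5) + 2 + (c.smp * 4 + 3 + (c.smp * 4 + 7))))) := by
  have hsp : Par c s := hs0.frame (fun a ha => hs.nat a (by omega)) hs.real
  have hUs : U = remaining c s := by
    rw [hU]; exact (remaining_congr fun i => hs.nat _ (by omega)).symm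
  have hNs : s.nat 8 = U.card := by rw [hs.nat 8 (by omega), hN]
  have h9s : s.nat 9 = rb := by rw [hs.nat 9 (by omega), h9]
  unfold trialP
  rw [← PMF.map_id (chain _ _ _)]
  refine (refines_samplesP hsp hUs hne).seq_ensures id ?_
  rintro S s2 ⟨f1, f2, f3⟩
  have hs2 : Par c s2 := hsp.frame (fun a ha => f1 a (by omega)) fun a ha => by rw [f2]
  have hlt : ∀ j ≤ c.smp, S j < c.n := fun j hj => by
    have := (f3 j hj).2
    rw [hU, mem_remaining] at this
    exact this.1
  refine ensures_seq (t1 := 300 * (c.d * c.k)) ?_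
  refine (ensures_thresholdP hs2 hd hk (fun j hj => (f3 j hj).1) hlt).mono ?_ le_rfl
  rintro s3 ⟨g1, g2, g3, g4, g5⟩
  have hs3 : Par c s3 := hs2.frame (fun a ha => g1 a (by omega)) fun a ha => g2 a ha.le
  have v3 : ∀ j ≤ c.smp, s3.nat (3 * (c.m + j) + 33) = S j := fun j hj => by
    rw [g1 _ (by omega), (f3 j hj).1]
  refine ensures_seq (t1 := c.n * (200 * (c.d * c.k) + 5) + 2) ?_
  have hU3 : U = remaining c s3 := by
    rw [hUs]
    exact (remaining_congr fun i => by rw [g1 _ (by omega), f1 _ (by omega)]).symm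
  refine (ensures_countP hs3 hd hk v3 hlt hU3 g4 g3 g5).mono ?_ le_rfl
  rintro s4 ⟨k1, k2, k3⟩
  have hs4 : Par c s4 := hs3.frame (fun a ha => k1 a (by omega)) fun a ha => k2 a (by omega)
  refine ensures_seq (t1 := c.smp * 4 + 3) ?_
  have hN4 : s4.nat 8 = U.card := by
    rw [k1 _ (by omega), g1 _ (by omega), f1 _ (by omega), hNs]
  refine (ensures_heavyP hs4 hN4 k3).mono ?_ le_rfl
  rintro s5 ⟨l1, l2, l3, l4⟩
  have hs5 : Par c s5 := hs4.frame (fun a ha => l1 a (by omega)) fun a ha => by rw [l2]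
  have fr : ∀ a, a < 16 ∨ 32 ≤ a ∧ (a % 3 = 2 ∨ a < 3 * c.m + 33) → s5.nat a = s.nat a :=
    fun a ha => by
      rw [l1 _ (by omega), k1 _ (by omega), g1 _ (by omega), f1 _ (by omega)]
  have frr : ∀ a, a ≤ c.nd → s5.real a = s.real a := fun a ha => by
    rw [l2, k2 a (by omega), g2 a ha, f2]
  have ht : s5.real (c.nd + 1) = c.mdist S (S c.smp) := by rw [l2, k2 _ le_rfl, g4]
  have hsv : Saved c U rb s5 := hs.saved.congr (fr 10 (by omega)) (frr _ le_rfl)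
    (fun j hj => fr _ (by omega)) fun j hj => fr _ (by omega)
  refine (ensures_selectP hs5 (by rw [fr 9 (by omega), h9s]) hrb
    (by rw [fr 8 (by omega), hNs]) (fun j hj => hlt j hj.le)
    (fun j hj => by rw [l1 _ (by omega), k1 _ (by omega), v3 j hj.le])
    (by rw [ht]; exact l4) (by rw [ht]; exact l3) hsv).mono ?_ le_rfl
  rintro s6 ⟨m1, m2, m3, m4, m5⟩
  rw [ht] at m4
  refine ⟨⟨fun a ha => ?_, fun a ha => ?_, m3⟩, fun hg => ?_, fun hg => ?_⟩
  · rw [m1 a (by omega), fr a (by omega), hs.nat a ha]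
  · rw [m2 a ha, frr a ha.le, hs.real a ha]
  · exact ⟨(m4 hg.1).1, card_filter_le_of_le (m4 hg.1).2 hg.2⟩
  · have := m5 (by rw [fr 10 (by omega), hg.1])
    exact ⟨this.1, card_filter_le_of_le (by rw [← frr _ le_rfl]; exact this.2) hg.2⟩

/-- A bound for the running time of a trial. -/
def trialTime (c : Params) : ℕ := 1000 * (c.n * (c.d * c.k))

theorem trialTime_ge (hn : 2 ≤ c.n) (hd : 0 < c.d) (hk : 0 < c.k) :
    ((c.smp + 1) * (c.n * 5 + 5) + 2) + (300 * (c.d * c.k) +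
        (c.n * (200 * (c.d * c.k) + 5) + 2 + (c.smp * 4 + 3 + (c.smp * 4 + 7)))) ≤ trialTime c := by
  rw [trialTime, Params.smp]
  have h1 : c.k ≤ c.d * c.k := Nat.le_mul_of_pos_left _ hd
  have h2 : 2 * (c.d * c.k) ≤ c.n * (c.d * c.k) := Nat.mul_le_mul_right _ hn
  have h3 : c.n * c.k ≤ c.n * (c.d * c.k) := Nat.mul_le_mul_left _ h1
  have h4 : c.n * 1 ≤ c.n * c.k := Nat.mul_le_mul_left _ hk
  have h5 : (8 * c.k + 1) * (c.n * 5 + 5) = 40 * (c.n * c.k) + 40 * c.k + 5 * c.n + 5 := by ring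
  have h6 : c.n * (200 * (c.d * c.k) + 5) = 200 * (c.n * (c.d * c.k)) + 5 * c.n := by ring
  rw [h5, h6]
  omega

variable {E : Type*} [PseudoMetricSpace E] {x : ℕ → E} {C : Fin c.k → E} {cl : ℕ → Fin c.k}
  {a : ℕ → ℝ}

theorem ensures_trialP (hn : 2 ≤ c.n) (hd : 0 < c.d) (hk : 0 < c.k) {s0 s : Mem} (hs0 : Par c s0)
    {rb : ℕ} (h9 : s0.nat 9 = rb) (hrb : rb + c.smp ≤ c.m) {U : Finset ℕ}
    (hU : U = remaining c s0) (hN : s0.nat 8 = U.card) (hne : U.Nonempty)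
    (hs : TrialInv c U rb s0 s) :
    Ensures (trialP.run A T s) (fun s' => TrialInv c U rb s0 s' ∧
      (GoodSaved c U a s → GoodSaved c U a s')) (trialTime c) :=
  (refines_trialP hd hk hs0 h9 hrb hU hN hne a hs).ensures.mono
    (fun _ ⟨_, h⟩ => ⟨h.1, h.2.2⟩) (trialTime_ge hn hd hk)

theorem success_trialP (hd : 0 < c.d) (hk : 0 < c.k)
    (hD : ∀ i j, c.D i j = dist (x i) (x j) ^ 2) (ha : ∀ i, a i = dist (x i) (C (cl i)) ^ 2)
    {s0 s : Mem} (hs0 : Par c s0)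
    {rb : ℕ} (h9 : s0.nat 9 = rb) (hrb : rb + c.smp ≤ c.m) {U : Finset ℕ}
    (hU : U = remaining c s0) (hN : s0.nat 8 = U.card) (hne : U.Nonempty)
    (hs : TrialInv c U rb s0 s) : 1 / 8 ≤ success (trialP.run A T s) (GoodSaved c U a) := by
  refine (expect_goodSample hk ?_ hne hD ha _).trans
    ((refines_trialP hd hk hs0 h9 hrb hU hN hne a hs).le_expect _ _ fun S s' h => ind_mono h.2.1)
  rw [hU]
  exact Finset.filter_subset _ _

theorem ensures_trials (hn : 2 ≤ c.n) (hd : 0 < c.d) (hk : 0 < c.k) {s0 : Mem} (hs0 : Par c s0)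
    {rb : ℕ} (h9 : s0.nat 9 = rb) (hrb : rb + c.smp ≤ c.m) {U : Finset ℕ}
    (hU : U = remaining c s0) (hN : s0.nat 8 = U.card) (hne : U.Nonempty) (hsv : Saved c U rb s0) :
    Ensures ((Prog.loop (32 * cell 4) trialP).run A T s0) (TrialInv c U rb s0)
      (32 * c.lg * (trialTime c + 1) + 1) := by
  refine ensures_loop (fun _ => TrialInv c U rb s0) (32 * c.lg) (by simp [hs0.lg])
    ⟨fun _ _ => rfl, fun _ _ => rfl, hsv⟩ fun i _ s hs => ?_
  exact (ensures_trialP (a := fun _ => 0) hn hd hk hs0 h9 hrb hU hN hne hs).mono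
    (fun _ h => h.1) le_rfl

/-- From any memory that satisfies the invariant a trial succeeds with probability at least 1/8, and
success persists; so all 32 lg trials fail with probability at most (7/8)^(32 lg). -/
theorem success_trials (hn : 2 ≤ c.n) (hd : 0 < c.d) (hk : 0 < c.k)
    (hD : ∀ i j, c.D i j = dist (x i) (x j) ^ 2) (ha : ∀ i, a i = dist (x i) (C (cl i)) ^ 2)
    {s0 : Mem} (hs0 : Par c s0)
    {rb : ℕ} (h9 : s0.nat 9 = rb) (hrb : rb + c.smp ≤ c.m) {U : Finset ℕ}
    (hU : U = remaining c s0) (hN : s0.nat 8 = U.card) (hne : U.Nonempty) (hsv : Saved c U rb s0) :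
    1 - (7 / 8) ^ (32 * c.lg) ≤
      success ((Prog.loop (32 * cell 4) trialP).run A T s0) (GoodSaved c U a) := by
  have h := success_loop_some (f := trialP.run A T) (τ := trialTime c) (a := 1 / 8)
    (TrialInv c U rb s0) (fun s => TrialInv c U rb s0 s ∧ GoodSaved c U a s)
    (fun s hs => (ensures_trialP (a := a) hn hd hk hs0 h9 hrb hU hN hne hs).mono
      (fun _ h => h.1) le_rfl)
    (fun s hs hg => (ensures_trialP (a := a) hn hd hk hs0 h9 hrb hU hN hne hs).mono
      (fun _ h => ⟨h.1, h.2 hg.2⟩) le_rfl)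
    (fun s hs => (success_trialP hd hk hD ha hs0 h9 hrb hU hN hne hs).trans
      (success_mono (ensures_trialP (a := a) hn hd hk hs0 h9 hrb hU hN hne hs)
        fun _ h1 h2 => ⟨h1.1, h2⟩))
    (32 * c.lg) s0 ⟨fun _ _ => rfl, fun _ _ => rfl, hsv⟩
  have e : (1 : ℝ≥0∞) - 1 / 8 = 7 / 8 := by
    refine ENNReal.sub_eq_of_eq_add (by simp) ?_
    rw [← ENNReal.add_div]
    norm_num
    rw [ENNReal.div_self (by simp) (by simp)]
  rw [e] at h
  have h2 := expect_ind_not (repeatSteps (trialP.run A T) (32 * c.lg) s0)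
    (fun o => TrialInv c U rb s0 o.1 ∧ GoodSaved c U a o.1)
  rw [Prog.run, show (32 * cell 4 : NExp).eval s0 = 32 * c.lg by simp [hs0.lg]]
  rw [← h2]
  refine (tsub_le_tsub_left h _).trans ?_
  refine (ENNReal.add_sub_cancel_right ?_).le.trans ?_
  · exact ne_top_of_le_ne_top ENNReal.one_ne_top (expect_le_one fun _ => ind_le_one _ _)
  · exact expect_mono fun o _ => ind_mono And.right

end

/-! ### Rounds -/

/-- The invariant of the rounds: `r` is the number of the round. -/
structure Slots (c : Params) (r : ℕ) (s : Mem) : Prop where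
  par : Par c s
  card : s.nat 8 = (remaining c s).card
  idx : ∀ y < c.m, s.nat (3 * y + 33) < c.n
  wt : ∀ y, r * c.smp ≤ y → y < c.m → s.nat (3 * y + 34) = 0

/-- What a good round with threshold `t` makes of the remaining points. -/
def Shrinks (c : Params) (a : ℕ → ℝ) (U U' : Finset ℕ) (t : ℝ) : Prop :=
  (U.card ≤ 128 * c.k * c.z ∧ U' = U ∧ t = 0) ∨
  (128 * c.k * c.z < U.card ∧ 8 * U'.card ≤ 7 * U.card ∧ U' ⊆ U ∧ 0 ≤ t ∧
    U.card ≤ 8 * ({i ∈ U | t ≤ 4 * a i} : Finset ℕ).card)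

/-- All of the first `r` rounds were good: `V q` and `t q` are the remaining points and the
threshold of round `q`, and `asg i` is the slot of a removed point `i`. -/
def RoundsGood (c : Params) (a : ℕ → ℝ) (r : ℕ) (s : Mem) : Prop :=
  ∃ (V : ℕ → Finset ℕ) (t : ℕ → ℝ) (asg : ℕ → ℕ),
    V 0 = Finset.range c.n ∧ V r = remaining c s ∧ (∀ q < r, Shrinks c a (V q) (V (q + 1)) (t q)) ∧
    (∀ i ∈ Finset.range c.n \ remaining c s, asg i < r * c.smp) ∧
    (∀ y < r * c.smp, s.nat (3 * y + 34) =
        ({i ∈ Finset.range c.n \ remaining c s | asg i = y} : Finset ℕ).card ∧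
      (0 < s.nat (3 * y + 34) → 2 * c.z ≤ s.nat (3 * y + 34))) ∧
    ∑ i ∈ Finset.range c.n \ remaining c s, c.D i (s.nat (3 * asg i + 33))
      ≤ ∑ q ∈ Finset.range r, ((V q).card : ℝ) * t q

/-! ### The effect of a round -/

section
variable {A : KMeansAlg} {T : ℕ → ℕ → ℕ → ℕ} {c : Params} {a : ℕ → ℝ}

theorem Slots.congr {r : ℕ} {s s' : Mem} (h : Slots c r s) (h1 : ∀ b < 7, s'.nat b = s.nat b)
    (h8 : s'.nat 8 = s.nat 8)
    (h2 : ∀ b, 32 ≤ b → s'.nat b = s.nat b) (h3 : ∀ b < c.nd, s'.real b = s.real b) :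
    Slots c r s' where
  par := h.par.frame h1 h3
  card := by rw [h8, remaining_congr fun i => h2 _ (by omega), h.card]
  idx y hy := by rw [h2 _ (by omega)]; exact h.idx y hy
  wt y hy hy' := by rw [h2 _ (by omega)]; exact h.wt y hy hy'

theorem Slots.succ {r : ℕ} {s : Mem} (h : Slots c r s) : Slots c (r + 1) s :=
  ⟨h.par, h.card, h.idx, fun y hy hy' => h.wt y (le_trans (by gcongr; omega) hy) hy'⟩

theorem RoundsGood.congr {r : ℕ} {s s' : Mem} (h : RoundsGood c a r s)
    (h2 : ∀ b, 32 ≤ b → s'.nat b = s.nat b) : RoundsGood c a r s' := by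
  have hrem : remaining c s' = remaining c s := remaining_congr fun i => h2 _ (by omega)
  have h3 : ∀ y, s'.nat (3 * y + 33) = s.nat (3 * y + 33) := fun y => h2 _ (by omega)
  have h4 : ∀ y, s'.nat (3 * y + 34) = s.nat (3 * y + 34) := fun y => h2 _ (by omega)
  simpa only [RoundsGood, hrem, h3, h4] using h

/-- A skipped round repeats the set of remaining points with threshold 0. Its slots still have
weight 0, and no point is assigned to them. -/
theorem RoundsGood.skip {r : ℕ} {s : Mem} (hs : Slots c r s) (hr : (r + 1) * c.smp ≤ c.m)
    (h : RoundsGood c a r s) (hU : (remaining c s).card ≤ 128 * c.k * c.z) :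
    RoundsGood c a (r + 1) s := by
  obtain ⟨V, t, asg, h1, h2, h3, h4, h5, h6⟩ := h
  have hmul : (r + 1) * c.smp = r * c.smp + c.smp := by ring
  refine ⟨fun q => if q ≤ r then V q else remaining c s, fun q => if q < r then t q else 0, asg,
    by simpa using h1, by simp, fun q hq => ?_, fun i hi => (h4 i hi).trans_le (by omega),
    fun y hy => ?_, ?_⟩
  · rcases Nat.lt_succ_iff_lt_or_eq.mp hq with h | rfl
    · have e1 : q ≤ r := h.le
      have e2 : q + 1 ≤ r := h
      simpa [h, e1, e2] using h3 q h
    · refine Or.inl ?_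
      simp [h2, hU]
  · by_cases hy' : y < r * c.smp
    · exact h5 y hy'
    · have h0 := hs.wt y (not_lt.mp hy') (by omega)
      rw [h0]
      refine ⟨?_, by simp⟩
      symm
      rw [Finset.card_eq_zero, Finset.filter_eq_empty_iff]
      intro i hi
      have := h4 i hi
      omega
  · rw [Finset.sum_range_succ]
    simp only [lt_irrefl, if_false, mul_zero, add_zero]
    refine h6.trans (le_of_eq (Finset.sum_congr rfl fun q hq => ?_))
    have := Finset.mem_range.mp hq
    simp [this, this.le]

/-- The stored weights count exactly the removed points, because the points of a cleared sample are
not removed. -/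
theorem card_covered (S : ℕ → ℕ) (U : Finset ℕ) (t : ℝ) {j : ℕ} :
    ({i ∈ {i ∈ U | c.mdist S i ≤ t ∧ 1 ≤ c.wgt S U t (c.near S i)} | c.near S i = j} :
      Finset ℕ).card = c.wgt S U t j := by
  rw [Finset.filter_filter]
  by_cases h : 1 ≤ c.wgt S U t j
  · have h1 : c.wgt S U t j = (c.part S U t j).card := by
      unfold Params.wgt at h ⊢
      split_ifs at h ⊢ with h2
      · rfl
      · omega
    rw [h1, Params.part]
    congr 1
    refine Finset.filter_congr fun i _ => ?_
    constructor
    · rintro ⟨⟨h2, -⟩, h3⟩; exact ⟨h2, h3⟩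
    · rintro ⟨h2, rfl⟩; exact ⟨⟨h2, h⟩, rfl⟩
  · have : c.wgt S U t j = 0 := by omega
    rw [this, Finset.card_eq_zero, Finset.filter_eq_empty_iff]
    rintro i - ⟨⟨-, h2⟩, rfl⟩
    exact h h2

theorem RoundsGood.active (hk : 0 < c.k) (hD : ∀ i j, 0 ≤ c.D i j) {r : ℕ} {s s' : Mem}
    (h : RoundsGood c a r s) {S : ℕ → ℕ} {t : ℝ}
    (hN : 128 * c.k * c.z < (remaining c s).card)
    (hold : ∀ y < r * c.smp, s'.nat (3 * y + 33) = s.nat (3 * y + 33) ∧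
      s'.nat (3 * y + 34) = s.nat (3 * y + 34))
    (hv : ∀ j < c.smp, s'.nat (3 * (r * c.smp + j) + 33) = S j)
    (hw : ∀ j < c.smp, s'.nat (3 * (r * c.smp + j) + 34) = c.wgt S (remaining c s) t j)
    (hcov : (remaining c s).card ≤
      8 * ∑ j ∈ Finset.range c.smp, c.wgt S (remaining c s) t j)
    (hsmall : (remaining c s).card ≤ 8 * ({i ∈ remaining c s | t ≤ 4 * a i} : Finset ℕ).card)
    (hrem : remaining c s' = {i ∈ remaining c s | ¬ (c.mdist S i ≤ t ∧
      1 ≤ c.wgt S (remaining c s) t (c.near S i))}) :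
    RoundsGood c a (r + 1) s' := by
  obtain ⟨V, tt, asg, h1, h2, h3, h4, h5, h6⟩ := h
  have hmul : (r + 1) * c.smp = r * c.smp + c.smp := by ring
  set U := remaining c s with hUdef
  set U' := remaining c s' with hU'def
  set W : Finset ℕ := {i ∈ U | c.mdist S i ≤ t ∧ 1 ≤ c.wgt S U t (c.near S i)} with hW
  have hUn : U ⊆ Finset.range c.n := Finset.filter_subset _ _
  have hcardW : W.card = ∑ j ∈ Finset.range c.smp, c.wgt S U t j := by
    rw [Finset.card_eq_sum_card_fiberwise (f := c.near S) (t := Finset.range c.smp)]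
    · exact Finset.sum_congr rfl fun j _ => card_covered S U t
    · intro i _
      simpa using Params.near_lt hk S i
  have hsplit : W.card + U'.card = U.card := by
    rw [hrem, hW]; exact Finset.card_filter_add_card_filter_not _
  have hWne : 0 < W.card := by omega
  have ht0 : 0 ≤ t := by
    obtain ⟨i, hi⟩ := Finset.card_pos.mp hWne
    exact (hD _ _).trans (Finset.mem_filter.mp hi).2.1
  have hunion : Finset.range c.n \ U' = (Finset.range c.n \ U) ∪ W := by
    ext i
    rw [hrem, hW]
    simp only [Finset.mem_sdiff, Finset.mem_union, Finset.mem_filter]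
    have := @hUn i
    tauto
  have hdisj : Disjoint (Finset.range c.n \ U) W :=
    Finset.disjoint_of_subset_right (Finset.filter_subset _ _) Finset.sdiff_disjoint
  have hWU : ∀ i ∈ W, i ∈ U := fun i hi => (Finset.mem_filter.mp hi).1
  -- The assignment is redefined on all of U, also for points that stay; this is harmless, as only
  -- removed points are asked about.
  refine ⟨fun q => if q ≤ r then V q else U', fun q => if q < r then tt q else t,
    fun i => if i ∈ U then r * c.smp + c.near S i else asg i,
    by simpa using h1, by simpa using hU'def, fun q hq => ?_, fun i hi => ?_, fun y hy => ?_, ?_⟩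
  · rcases Nat.lt_succ_iff_lt_or_eq.mp hq with h | rfl
    · have e1 : q ≤ r := h.le
      have e2 : q + 1 ≤ r := h
      simpa [h, e1, e2] using h3 q h
    · refine Or.inr ?_
      simp only [le_refl, if_true, h2, Nat.not_succ_le_self, if_false, lt_irrefl]
      refine ⟨hN, by omega, ?_, ht0, hsmall⟩
      rw [hrem]; exact Finset.filter_subset _ _
  · have := Params.near_lt hk S i
    dsimp only
    split_ifs with hiU
    · omega
    · exact (h4 i (Finset.mem_sdiff.mpr ⟨(Finset.mem_sdiff.mp hi).1, hiU⟩)).trans_le (by omega)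
  · rw [hunion, Finset.filter_union, Finset.card_union_of_disjoint
      (Finset.disjoint_filter_filter hdisj)]
    have e1 : ({i ∈ Finset.range c.n \ U | (if i ∈ U then r * c.smp + c.near S i else asg i) = y} :
        Finset ℕ) = {i ∈ Finset.range c.n \ U | asg i = y} :=
      Finset.filter_congr fun i hi => by rw [if_neg (Finset.mem_sdiff.mp hi).2]
    have e2 : ({i ∈ W | (if i ∈ U then r * c.smp + c.near S i else asg i) = y} :
        Finset ℕ) = {i ∈ W | r * c.smp + c.near S i = y} :=
      Finset.filter_congr fun i hi => by rw [if_pos (hWU i hi)]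
    rw [e1, e2]
    by_cases hy' : y < r * c.smp
    · have e3 : ({i ∈ W | r * c.smp + c.near S i = y} : Finset ℕ) = ∅ := by
        rw [Finset.filter_eq_empty_iff]
        intro i _
        omega
      rw [e3, Finset.card_empty, add_zero, (hold y hy').2]
      exact h5 y hy'
    · obtain ⟨j, rfl⟩ := Nat.exists_eq_add_of_le (not_lt.mp hy')
      have hj : j < c.smp := by omega
      have e3 : ({i ∈ Finset.range c.n \ U | asg i = r * c.smp + j} : Finset ℕ) = ∅ := by
        rw [Finset.filter_eq_empty_iff]
        intro i hi
        have := h4 i hi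
        omega
      have e4 : ({i ∈ W | r * c.smp + c.near S i = r * c.smp + j} : Finset ℕ)
          = {i ∈ W | c.near S i = j} := Finset.filter_congr fun i _ => by omega
      rw [e3, Finset.card_empty, zero_add, e4, hW, card_covered, hw j hj]
      refine ⟨rfl, fun hpos => ?_⟩
      have e5 : U.card ≤ 8 * c.smp * c.wgt S U t j := by
        unfold Params.wgt at hpos ⊢
        split_ifs at hpos ⊢ with e6
        · exact e6
        · omega
      -- The bound for being active was chosen for this: a kept weight is at least |U| / (64k),
      -- which is more than 2z.
      have e7 : 64 * c.k * (2 * c.z) < 64 * c.k * c.wgt S U t j := by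
        calc 64 * c.k * (2 * c.z) = 128 * c.k * c.z := by ring
          _ < U.card := hN
          _ ≤ 8 * c.smp * c.wgt S U t j := e5
          _ = 64 * c.k * c.wgt S U t j := by rw [Params.smp]; ring
      exact (Nat.lt_of_mul_lt_mul_left e7).le
  · rw [hunion, Finset.sum_union hdisj, Finset.sum_range_succ]
    simp only [le_refl, if_true, lt_irrefl, if_false, h2]
    refine add_le_add ?_ ?_
    · refine le_trans (le_of_eq ?_) (h6.trans (le_of_eq ?_))
      · refine Finset.sum_congr rfl fun i hi => ?_
        rw [if_neg (Finset.mem_sdiff.mp hi).2, (hold _ (h4 i hi)).1]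
      · refine Finset.sum_congr rfl fun q hq => ?_
        have := Finset.mem_range.mp hq
        simp [this, this.le]
    · calc ∑ i ∈ W, c.D i (s'.nat (3 * (if i ∈ U then r * c.smp + c.near S i else asg i) + 33))
          ≤ ∑ i ∈ W, t := by
            refine Finset.sum_le_sum fun i hi => ?_
            rw [if_pos (hWU i hi), hv _ (Params.near_lt hk S i)]
            exact (Finset.mem_filter.mp hi).2.1
        _ = (W.card : ℝ) * t := by rw [Finset.sum_const, nsmul_eq_mul]
        _ ≤ (U.card : ℝ) * t := by
            refine mul_le_mul_of_nonneg_right ?_ ht0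
            exact_mod_cast (by omega : W.card ≤ U.card)

/-- A bound for the running time of a round. -/
def roundTime (c : Params) : ℕ := 40000 * (c.lg * (c.n * (c.d * c.k)))

theorem roundTime_ge (hn : 2 ≤ c.n) (hd : 0 < c.d) (hk : 0 < c.k) (hlg : 0 < c.lg) :
    32 * c.lg * (trialTime c + 1) + 1 + (c.n * (200 * (c.d * c.k) + 7) + 3) + 3 ≤ roundTime c := by
  rw [trialTime, roundTime]
  have h0 : 0 < c.d * c.k := Nat.mul_pos hd hk
  have h1 : 2 * 1 ≤ c.n * (c.d * c.k) := Nat.mul_le_mul hn h0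
  have h2 : c.n * 1 ≤ c.n * (c.d * c.k) := Nat.mul_le_mul_left _ h0
  have h3 : 1 * (c.n * (c.d * c.k)) ≤ c.lg * (c.n * (c.d * c.k)) := Nat.mul_le_mul_right _ hlg
  have h4 : c.lg * 1 ≤ c.lg * (c.n * (c.d * c.k)) := Nat.mul_le_mul_left _ (by omega)
  have h5 : 32 * c.lg * (1000 * (c.n * (c.d * c.k)) + 1)
      = 32000 * (c.lg * (c.n * (c.d * c.k))) + 32 * c.lg := by ring
  have h6 : c.n * (200 * (c.d * c.k) + 7) = 200 * (c.n * (c.d * c.k)) + 7 * c.n := by ring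
  rw [h5, h6]
  omega

theorem ensures_removeP_round (hd : 0 < c.d) (hk : 0 < c.k) (hD : ∀ i j, 0 ≤ c.D i j) {r : ℕ}
    {s0 s : Mem} (hs0 : Slots c r s0) (h9 : s0.nat 9 = r * c.smp)
    (hN : 128 * c.k * c.z < (remaining c s0).card)
    (hs : TrialInv c (remaining c s0) (r * c.smp) s0 s) :
    Ensures (removeP.run A T s) (fun s' => Slots c (r + 1) s' ∧ s'.nat 9 = r * c.smp ∧
      (GoodSaved c (remaining c s0) a s → RoundsGood c a r s0 → RoundsGood c a (r + 1) s'))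
      (c.n * (200 * (c.d * c.k) + 7) + 3) := by
  have hmul : (r + 1) * c.smp = r * c.smp + c.smp := by ring
  have hsp : Par c s := hs0.par.frame (fun a ha => hs.nat a (by omega)) hs.real
  have hU : remaining c s0 = remaining c s :=
    (remaining_congr fun i => hs.nat _ (by omega)).symm
  obtain ⟨S, hS, hv, hw⟩ := hs.saved
  refine (ensures_removeP hsp hd hk (by rw [hs.nat 9 (by omega), h9]) hU
    (by rw [hs.nat 8 (by omega), hs0.card]) hS hv (w := fun j => s.nat (3 * (r * c.smp + j) + 34))
    fun j _ => rfl).mono ?_ le_rfl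
  rintro s' ⟨f1, f2, f3, f4⟩
  refine ⟨⟨hsp.frame (fun a ha => f1 a (by omega)) fun a ha => f2 a ha.le, f4, fun y hy => ?_,
    fun y hy hy' => ?_⟩, ?_, fun hg hgood => ?_⟩
  · rw [f1 _ (by omega)]
    by_cases hy' : r * c.smp ≤ y ∧ y < r * c.smp + c.smp
    · obtain ⟨j, rfl⟩ := Nat.exists_eq_add_of_le hy'.1
      rw [hv j (by omega)]
      exact hS j (by omega)
    · rw [hs.nat _ (by omega)]
      exact hs0.idx y hy
  · rw [f1 _ (by omega), hs.nat _ (by omega)]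
    exact hs0.wt y (by omega) hy'
  · rw [f1 9 (by omega), hs.nat 9 (by omega), h9]
  -- A good saved trial rules out the case that the round has saved nothing.
  · rcases hw with ⟨h10, -⟩ | ⟨-, hcov, hw⟩
    · rw [hg.1] at h10; omega
    refine hgood.active hk hD hN (S := S) (t := s.real c.nd) (fun y hy => ⟨?_, ?_⟩)
      (fun j hj => ?_) (fun j hj => ?_) hcov hg.2 ?_
    · rw [f1 _ (by omega), hs.nat _ (by omega)]
    · rw [f1 _ (by omega), hs.nat _ (by omega)]
    · rw [f1 _ (by omega), hv j hj]
    · rw [f1 _ (by omega), hw j hj]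
    · rw [f3]
      refine Finset.filter_congr fun i _ => ?_
      rw [hw _ (Params.near_lt hk S i)]

theorem roundP_start {r : ℕ} (hr : (r + 1) * c.smp ≤ c.m) {s : Mem} (hs : Slots c r s) :
    Slots c r (s.setNat 10 0) ∧ remaining c (s.setNat 10 0) = remaining c s ∧
      Saved c (remaining c s) (r * c.smp) (s.setNat 10 0) := by
  have hmul : (r + 1) * c.smp = r * c.smp + c.smp := by ring
  refine ⟨hs.congr (fun b hb => ?_) (by simp) (fun b hb => ?_) (by simp),
    remaining_congr fun i => by simp, ?_⟩
  · have : b ≠ 10 := by omega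
    simp [this]
  · have : b ≠ 10 := by omega
    simp [this]
  · refine ⟨fun j => s.nat (3 * (r * c.smp + j) + 33), fun j hj => hs.idx _ (by omega),
      fun j hj => by simp, Or.inl ⟨by simp, fun j hj => ?_⟩⟩
    simpa using hs.wt (r * c.smp + j) (by omega) (by omega)

theorem ensures_roundP (hn : 2 ≤ c.n) (hd : 0 < c.d) (hk : 0 < c.k) (hlg : 0 < c.lg)
    (hD : ∀ i j, 0 ≤ c.D i j) {r : ℕ}
    (hr : (r + 1) * c.smp ≤ c.m) {s : Mem} (hs : Slots c r s) (h9 : s.nat 9 = r * c.smp) :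
    Ensures (roundP.run A T s) (fun s' => Slots c (r + 1) s' ∧ s'.nat 9 = (r + 1) * c.smp)
      (roundTime c) := by
  have hmul : (r + 1) * c.smp = r * c.smp + c.smp := by ring
  have htest : (Test.natLe (cell 8) (128 * cell 2 * cell 3)).holds s ↔
      (remaining c s).card ≤ 128 * c.k * c.z := by
    simp [hs.card, hs.par.k, hs.par.z]
  refine Ensures.mono (t := (32 * c.lg * (trialTime c + 1) + 1 +
    (c.n * (200 * (c.d * c.k) + 7) + 3) + 1 + 1) + 1) ?_ (fun _ h => h)
    (roundTime_ge hn hd hk hlg)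
  unfold roundP
  apply ensures_seq
  refine Ensures.mono (Q := fun s' => Slots c (r + 1) s' ∧ s'.nat 9 = r * c.smp) ?_ ?_ le_rfl
  · apply ensures_ite
    · intro _
      refine Ensures.mono (t := 1) ?_ (fun _ h => h) (by omega)
      apply ensures_setNat
      refine ⟨(hs.congr (fun b hb => ?_) (by simp) (fun b hb => ?_) (by simp)).succ, by simpa⟩
      · have : b ≠ 31 := by omega
        simp [this]
      · have : b ≠ 31 := by omega
        simp [this]
    · intro h
      rw [htest, not_le] at h
      obtain ⟨hs1, hrem, hsv⟩ := roundP_start hr hs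
      apply ensures_setNat_seq
      change Ensures (Prog.run A T _ (s.setNat 10 0)) _ _
      refine ensures_seq ?_
      refine (ensures_trials hn hd hk hs1.par (rb := r * c.smp) (by simpa using h9) (by omega)
        hrem.symm (by rw [hs1.card, hrem]) (Finset.card_pos.mp (by omega)) hsv).mono ?_ le_rfl
      intro s2 hs2
      rw [← hrem] at hs2 h
      exact (ensures_removeP_round (a := fun _ => 0) hd hk hD hs1 (by simpa using h9) h hs2).mono
        (fun _ h => ⟨h.1, h.2.1⟩) le_rfl
  · rintro s2 ⟨h1, h2⟩
    apply ensures_setNat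
    refine ⟨h1.congr (fun b hb => ?_) (by simp) (fun b hb => ?_) (by simp), ?_⟩
    · have : b ≠ 9 := by omega
      simp [this]
    · have : b ≠ 9 := by omega
      simp [this]
    · simp [h2, h1.par.smp, hmul]

variable {E : Type*} [PseudoMetricSpace E] {x : ℕ → E} {C : Fin c.k → E} {cl : ℕ → Fin c.k}

theorem success_roundP (hn : 2 ≤ c.n) (hd : 0 < c.d) (hk : 0 < c.k)
    (hD : ∀ i j, c.D i j = dist (x i) (x j) ^ 2) (ha : ∀ i, a i = dist (x i) (C (cl i)) ^ 2)
    {r : ℕ} (hr : (r + 1) * c.smp ≤ c.m) {s : Mem} (hs : Slots c r s) (h9 : s.nat 9 = r * c.smp)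
    (hg : RoundsGood c a r s) :
    1 - (7 / 8) ^ (32 * c.lg) ≤ success (roundP.run A T s) (RoundsGood c a (r + 1)) := by
  have hmul : (r + 1) * c.smp = r * c.smp + c.smp := by ring
  have hD0 : ∀ i j, 0 ≤ c.D i j := fun i j => by rw [hD]; positivity
  have htest : (Test.natLe (cell 8) (128 * cell 2 * cell 3)).holds s ↔
      (remaining c s).card ≤ 128 * c.k * c.z := by
    simp [hs.card, hs.par.k, hs.par.z]
  have hlast : ∀ s', RoundsGood c a (r + 1) s' →
      (1 : ℝ≥0∞) ≤ success ((Prog.setNat 9 (cell 9 + cell 6)).run A T s')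
        (RoundsGood c a (r + 1)) := by
    intro s' hs'
    refine (Ensures.success (Q := RoundsGood c a (r + 1)) (t := 1) ?_ fun _ h => h).ge
    apply ensures_setNat
    refine hs'.congr fun b hb => ?_
    have : b ≠ 9 := by omega
    simp [this]
  unfold roundP
  -- Success probabilities multiply along the sequence, and the final update of the slot counter
  -- succeeds with probability 1.
  rw [← one_mul (1 - _)]
  by_cases h : (remaining c s).card ≤ 128 * c.k * c.z
  · have hsk : Ensures ((Prog.ite (.natLe (cell 8) (128 * cell 2 * cell 3)) skipP
        (Prog.setNat 10 0 ;; Prog.loop (32 * cell 4) trialP ;; removeP)).run A T s)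
        (RoundsGood c a (r + 1)) (1 + 1) := by
      apply ensures_ite
      · intro _
        apply ensures_setNat
        refine (hg.skip hs hr h).congr fun b hb => ?_
        have : b ≠ 31 := by omega
        simp [this]
      · intro h'
        exact absurd (htest.mpr h) h'
    exact success_seq_ge hsk (by rw [hsk.success fun _ h => h]; exact tsub_le_self)
      fun s' h' _ => hlast s' h'
  · obtain ⟨hs1, hrem, hsv⟩ := roundP_start hr hs
    have hne : (remaining c s).Nonempty := Finset.card_pos.mp (by omega)
    have h9' : (s.setNat 10 0).nat 9 = r * c.smp := by simpa using h9
    have htr := ensures_trials (A := A) (T := T) hn hd hk hs1.par h9' (by omega)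
        hrem.symm (by rw [hs1.card, hrem]) hne hsv
    have hst := success_trials (A := A) (T := T) hn hd hk hD ha hs1.par h9' (by omega)
        hrem.symm (by rw [hs1.card, hrem]) hne hsv
    have hg1 : RoundsGood c a r (s.setNat 10 0) := hg.congr fun b hb => by
      have : b ≠ 10 := by omega
      simp [this]
    have hrm : ∀ s2, TrialInv c (remaining c s) (r * c.smp) (s.setNat 10 0) s2 →
        GoodSaved c (remaining c s) a s2 →
        (1 : ℝ≥0∞) ≤ success (removeP.run A T s2) (RoundsGood c a (r + 1)) := by
      intro s2 h2 h3
      rw [← hrem] at h2 h3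
      exact ((ensures_removeP_round hd hk hD0 hs1 h9' (by rw [hrem]; exact not_le.mp h) h2).success
        fun s' h => h.2.2 h3 hg1).ge
    have hall := success_seq_ge htr hst hrm
    rw [one_mul] at hall
    have hset : Ensures ((Prog.setNat 10 0).run A T s) (fun s' => s' = s.setNat 10 0) 1 :=
      ensures_setNat rfl
    have h2 := success_seq_ge (b := 1 - (7 / 8) ^ (32 * c.lg))
      (q := Prog.loop (32 * cell 4) trialP ;; removeP) hset
      (hset.success fun _ h => h).ge
      (fun s1 _ h1 => by rw [h1]; exact hall)
    rw [mul_one] at h2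
    have hens : Ensures ((Prog.ite (.natLe (cell 8) (128 * cell 2 * cell 3)) skipP
        (Prog.setNat 10 0 ;; Prog.loop (32 * cell 4) trialP ;; removeP)).run A T s)
        (fun _ => True) (1 + (32 * c.lg * (trialTime c + 1) + 1 +
          (c.n * (200 * (c.d * c.k) + 7) + 3)) + 1) := by
      apply ensures_ite
      · intro h'; exact absurd (htest.mp h') h
      · intro _
        apply ensures_seq
        refine hset.mono ?_ le_rfl
        rintro _ rfl
        apply ensures_seq
        refine htr.mono (fun s2 h2 => ?_) le_rfl
        rw [← hrem] at h2
        exact (ensures_removeP_round (a := fun _ => 0) hd hk hD0 hs1 h9' (by rw [hrem]; exact not_le.mp h)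
          h2).mono (fun _ _ => trivial) le_rfl
    exact success_seq_ge hens (success_ite (fun h' => absurd (htest.mp h') h) fun _ => h2)
      fun s' _ h' => hlast s' h'

end

/-! ### The whole algorithm -/

/-- The points of the instance. -/
def Params.pt (c : Params) (i : ℕ) : Pt c.d := WithLp.toLp 2 fun l => c.coord (c.d * i + l)

theorem Params.D_eq (c : Params) (i j : ℕ) : c.D i j = dist (c.pt i) (c.pt j) ^ 2 := by
  rw [EuclideanSpace.dist_sq_eq, Params.D, Finset.sum_range]
  refine Finset.sum_congr rfl fun l _ => ?_
  rw [Real.dist_eq, sq_abs, sq]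
  rfl

/-! ### Setup, final call and the whole run -/

section
variable {A : KMeansAlg} {T : ℕ → ℕ → ℕ → ℕ}

theorem ensures_call {s : Mem} {m k d pts wts out : NExp} {m' k' d' p' w' o' : ℕ} {Q : Mem → Prop}
    (hm : m.eval s = m') (hk : k.eval s = k') (hd : d.eval s = d') (hp : pts.eval s = p')
    (hw : wts.eval s = w') (ho : out.eval s = o')
    (h : ∀ C ∈ (A m' k' d' (s.readPts p' m' d') fun i => s.nat (w' + (i : ℕ))).support,
      Q (s.writePts o' C)) :
    Ensures ((Prog.call m k d pts wts out).run A T s) Q (1 + T m' k' d') := by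
  subst hm hk hd hp hw ho
  intro o ho
  rw [Prog.run, PMF.mem_support_map_iff] at ho
  obtain ⟨C, hC, rfl⟩ := ho
  exact ⟨h C hC, le_rfl⟩

theorem ensures_setupP {s : Mem} {n d k z : ℕ} (h0 : s.nat 0 = n) (h1 : s.nat 1 = d)
    (h2 : s.nat 2 = k) (h3 : s.nat 3 = z) (h4 : ∀ b, 4 ≤ b → s.nat b = 0) (hn : 0 < n) :
    Ensures (setupP.run A T s)
      (fun s' => Slots ⟨n, d, k, z, n.size, s.real⟩ 0 s' ∧ s'.nat 9 = 0 ∧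
        remaining ⟨n, d, k, z, n.size, s.real⟩ s' = Finset.range n)
      (n * 4 + 5) := by
  unfold setupP
  refine Ensures.mono (t := (n * (2 + 1 + 1) + 1 + (1 + 1 + 1)) + 1) ?_ (fun _ h => h) (by omega)
  apply ensures_setNat_seq
  refine Ensures.mono (t := (n * (2 + 1 + 1) + 1) + 3) ?_ (fun _ h => h) (by omega)
  refine ensures_seq (t1 := n * (2 + 1 + 1) + 1) (t2 := 3) ?_
  refine (ensures_loop (fun i s' => (∀ b, b < 4 ∨ 9 ≤ b ∧ b ≠ 31 → s'.nat b = s.nat b) ∧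
    s'.real = s.real ∧ s'.nat 4 = min i n.size ∧ s'.nat 7 = 2 ^ (min i n.size)) n ?_ ?_ ?_).mono
    ?_ le_rfl
  · simp [h0]
  · refine ⟨fun b hb => ?_, ?_, ?_, ?_⟩
    · have : b ≠ 7 := by omega
      simp [this]
    · simp
    · simp [h4]
    · simp
  · rintro i hi s2 ⟨f1, f2, f3, f4⟩
    have e0 : s2.nat 0 = n := by rw [f1 _ (by omega), h0]
    apply ensures_ite
    · intro h
      simp only [Test.holds_natLe, eval_cell, f4, e0] at h
      rw [← Nat.lt_size] at h
      have e1 : min i n.size = i := by omega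
      have e2 : min (i + 1) n.size = i + 1 := by omega
      apply ensures_setNat_seq
      apply ensures_setNat
      refine ⟨fun b hb => ?_, ?_, ?_, ?_⟩
      · have : b ≠ 7 ∧ b ≠ 4 := by omega
        simp [this, f1 b hb]
      · simp [f2]
      · simp [f3, e1, e2]
      · simp [f4, e1, e2, pow_succ, mul_comm]
    · intro h
      simp only [Test.holds_natLe, eval_cell, f4, e0] at h
      rw [← Nat.lt_size] at h
      have e1 : min i n.size = n.size := by omega
      have e2 : min (i + 1) n.size = n.size := by omega
      refine Ensures.mono (t := 1) ?_ (fun _ h => h) (by omega)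
      apply ensures_setNat
      refine ⟨fun b hb => ?_, ?_, ?_, ?_⟩
      · have : b ≠ 31 := by omega
        simp [this, f1 b hb]
      · simp [f2]
      · simp [f3, e1, e2]
      · simp [f4, e1, e2]
  · rintro s2 ⟨f1, f2, f3, f4⟩
    -- Hence n iterations suffice for the doubling to stop.
    have hsize : n.size ≤ n := Nat.size_le.mpr Nat.lt_two_pow_self
    rw [min_eq_right hsize] at f3 f4
    apply ensures_setNat_seq
    apply ensures_setNat_seq
    apply ensures_setNat
    set c : Params := ⟨n, d, k, z, n.size, s.real⟩ with hc
    set s3 := ((s2.setNat _ _).setNat _ _).setNat _ _ with hs3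
    have g1 : ∀ b, b < 5 ∨ 9 ≤ b ∧ b ≠ 31 → s3.nat b = s2.nat b := fun b hb => by
      have : b ≠ 5 ∧ b ≠ 6 ∧ b ≠ 8 := by omega
      simp [hs3, this]
    have hz : ∀ b, 9 ≤ b → b ≠ 31 → s3.nat b = 0 := fun b hb hb' => by
      rw [g1 b (by omega), f1 b (by omega), h4 b (by omega)]
    have e0 : s3.nat 0 = n := by rw [g1 _ (by omega), f1 _ (by omega), h0]
    have e2 : s3.nat 2 = k := by rw [g1 _ (by omega), f1 _ (by omega), h2]
    have e4 : s3.nat 4 = n.size := by rw [g1 _ (by omega), f3]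
    have hrem : remaining c s3 = Finset.range n :=
      Finset.filter_true_of_mem fun i _ => hz _ (by omega) (by omega)
    refine ⟨⟨⟨e0, ?_, e2, ?_, e4, ?_, ?_, ?_⟩, ?_, fun y _ => ?_, fun y _ _ => ?_⟩, ?_, hrem⟩
    · rw [g1 _ (by omega), f1 _ (by omega), h1]
    · rw [g1 _ (by omega), f1 _ (by omega), h3]
    · simp [hs3, f3, f1 2, h2, hc, Params.m]
    · simp [hs3, f1 2, h2, hc, Params.smp]
    · intro b _; simp [hs3, f2, hc]
    · rw [hrem]; simp [hs3, f1 0, h0]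
    -- Unused slots point to point 0 and have weight 0, so they can be passed to the black box.
    · rw [hz _ (by omega) (by omega)]; exact hn
    · exact hz _ (by omega) (by omega)
    · exact hz _ (by omega) (by omega)

variable {c : Params}

theorem ensures_finishP {r : ℕ} {s : Mem} (hs : Slots c r s) :
    Ensures (finishP.run A T s) (fun s' => output s' c.k c.d ∈
      (A c.m c.k c.d (fun y => c.pt (s.nat (3 * (y : ℕ) + 33)))
        fun y => s.nat (3 * (y : ℕ) + 34)).support)
      (c.m * (c.d * 3 + 5) + 3 + T c.m c.k c.d) := by
  unfold finishP
  refine Ensures.mono (t := (c.m * ((c.d * (1 + 1 + 1) + 1 + (1 + 1)) + 1 + 1) + 1 +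
    (1 + T c.m c.k c.d)) + 1) ?_ (fun _ h => h) (by ring_nf; omega)
  apply ensures_setNat_seq
  set W := 3 * (c.n + c.m + c.smp) + 40 with hW
  refine ensures_seq ?_
  refine (ensures_loop (fun r s' => (∀ b, b ≠ 21 → b ≠ 31 → b < W → s'.nat b = s.nat b) ∧
    (∀ b < c.nd, s'.real b = s.real b) ∧ s'.nat 21 = r ∧ (∀ y < r, s'.nat (W + y) =
      s.nat (3 * y + 34)) ∧
    ∀ y < r, ∀ l < c.d, s'.real (c.nd + 4 + (c.d * y + l)) =
      c.coord (c.d * s.nat (3 * y + 33) + l)) c.m ?_ ?_ ?_).mono ?_ le_rfl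
  · simp [hs.par.m]
  · refine ⟨fun b hb _ _ => ?_, fun b hb => ?_, ?_, ?_, ?_⟩
    · simp [hb]
    · simp
    · simp
    · simp
    · simp
  · rintro y hy s2 ⟨f1, f2, f3, f4, f5⟩
    have hs2 : Par c s2 := hs.par.frame (fun b hb => f1 b (by omega) (by omega) (by omega)) f2
    apply ensures_setNat_seq
    refine Ensures.mono (t := (c.d * (1 + 1 + 1) + 1) + 2) ?_ (fun _ h => h) (by omega)
    refine ensures_seq (t1 := c.d * (1 + 1 + 1) + 1) (t2 := 2) ?_
    refine (ensures_loop (fun r s' => (∀ b, b ≠ 31 → s'.nat b = s2.nat b) ∧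
      (∀ b, b < c.nd + 4 + c.d * y → s'.real b = s2.real b) ∧ s'.nat 31 = r ∧
      ∀ l < r, s'.real (c.nd + 4 + (c.d * y + l)) =
        c.coord (c.d * s.nat (3 * y + 33) + l)) c.d ?_ ?_ ?_).mono ?_ le_rfl
    · simp [hs2.d]
    · refine ⟨fun b hb => ?_, fun b hb => ?_, ?_, ?_⟩
      · simp [hb]
      · simp
      · simp
      · simp
    · rintro l hl s3 ⟨g1, g2, g3, g4⟩
      have hs3 : Par c s3 := hs2.frame (fun b hb => g1 b (by omega)) fun b hb => g2 b (by omega)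
      apply ensures_setReal_seq
      apply ensures_setNat
      have e21 : s3.nat 21 = y := by rw [g1 _ (by omega), f3]
      have ei : s3.nat (3 * y + 33) = s.nat (3 * y + 33) := by
        rw [g1 _ (by omega), f1 _ (by omega) (by omega) (by omega)]
      refine ⟨fun b hb => ?_, fun b hb => ?_, ?_, fun l' hl' => ?_⟩
      · simp [hb, g1 b hb]
      · have : b ≠ c.nd + 4 + (c.d * y + l) := by omega
        simp [hs3.coordsE, hs3.d, e21, g3, this, g2 b hb]
      · simp [g3]
      · rcases Nat.lt_succ_iff_lt_or_eq.mp hl' with h | rfl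
        · simp [hs3.coordsE, hs3.d, e21, g3, h.ne, g4 l' h]
        · simp [hs3.coordsE, hs3.d, e21, g3, idxA, ei,
            hs3.coord _ (coord_lt (hs.idx y hy) hl)]
    · rintro s3 ⟨g1, g2, g3, g4⟩
      have hs3 : Par c s3 := hs2.frame (fun b hb => g1 b (by omega)) fun b hb => g2 b (by omega)
      apply ensures_setNat_seq
      apply ensures_setNat
      have e21 : s3.nat 21 = y := by rw [g1 _ (by omega), f3]
      have ew : wtsE.eval s3 = W := by simp [wtsE, hs3.n, hs3.m, hs3.smp, hW]
      have ei : s3.nat (3 * y + 34) = s.nat (3 * y + 34) := by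
        rw [g1 _ (by omega), f1 _ (by omega) (by omega) (by omega)]
      refine ⟨fun b hb hb' hb'' => ?_, fun b hb => ?_, ?_, fun y' hy' => ?_, fun y' hy' l hl => ?_⟩
      · have : b ≠ W + y := by omega
        simp [hb, ew, e21, this, g1 b hb', f1 b hb hb' hb'']
      · simp [g2 b (by omega), f2 b hb]
      · have : 21 ≠ W + y := by omega
        simp [ew, e21, this]
      · have : W + y' ≠ 21 := by omega
        rcases Nat.lt_succ_iff_lt_or_eq.mp hy' with h | rfl
        · simp [ew, e21, this, h.ne, g1 (W + y') (by omega), f4 y' h]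
        · simp [ew, e21, this, wtA, ei]
      · rcases Nat.lt_succ_iff_lt_or_eq.mp hy' with h | rfl
        · have : c.d * (y' + 1) ≤ c.d * y := Nat.mul_le_mul_left _ h
          rw [mul_add, mul_one] at this
          simp [g2 (c.nd + 4 + (c.d * y' + l)) (by omega), f5 y' h l hl]
        · simp [g4 l hl]
  · rintro s2 ⟨f1, f2, f3, f4, f5⟩
    have hs2 : Par c s2 := hs.par.frame (fun b hb => f1 b (by omega) (by omega) (by omega)) f2
    refine ensures_call (m' := c.m) (k' := c.k) (d' := c.d) (p' := c.nd + 4) (w' := W) (o' := 0)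
      (by simp [hs2.m]) (by simp [hs2.k]) (by simp [hs2.d]) (by simp [hs2.coordsE])
      (by simp [wtsE, hs2.n, hs2.m, hs2.smp, hW]) (by simp) fun C hC => ?_
    rw [output, Mem.readPts_writePts]
    convert hC using 2
    congr 1
    · funext y
      ext l
      simp only [Mem.readPts, Params.pt]
      exact (f5 y y.2 l l.2).symm
    · funext y
      exact (f4 y y.2).symm

/-- What a successful run of the rounds and the final call guarantee. -/
def GoodOutput (A : KMeansAlg) (c : Params) (a : ℕ → ℝ) (s' : Mem) : Prop :=
  ∃ s, Slots c (6 * c.lg) s ∧ RoundsGood c a (6 * c.lg) s ∧ output s' c.k c.d ∈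
    (A c.m c.k c.d (fun y => c.pt (s.nat (3 * (y : ℕ) + 33)))
        fun y => s.nat (3 * (y : ℕ) + 34)).support

theorem slot_bound (c : Params) {r : ℕ} (hr : r < 6 * c.lg) : (r + 1) * c.smp ≤ c.m := by
  calc (r + 1) * c.smp ≤ 6 * c.lg * c.smp := Nat.mul_le_mul_right _ hr
    _ = c.m := by rw [Params.smp, Params.m]; ring

theorem ensures_rounds (hn : 2 ≤ c.n) (hd : 0 < c.d) (hk : 0 < c.k) (hlg : 0 < c.lg) {s : Mem}
    (hs : Slots c 0 s) (h9 : s.nat 9 = 0) :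
    Ensures ((Prog.loop (6 * cell 4) roundP).run A T s) (Slots c (6 * c.lg))
      (6 * c.lg * (roundTime c + 1) + 1) := by
  refine (ensures_loop (fun r s => Slots c r s ∧ s.nat 9 = r * c.smp) (6 * c.lg)
    (by simp [hs.par.lg]) ⟨hs, by simpa using h9⟩ fun r hr s hs => ?_).mono (fun _ h => h.1) le_rfl
  exact ensures_roundP hn hd hk hlg (fun i j => by rw [c.D_eq]; positivity) (slot_bound c hr)
    hs.1 hs.2

variable {C : Fin c.k → Pt c.d} {cl : ℕ → Fin c.k} {a : ℕ → ℝ}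

theorem success_rounds (hn : 2 ≤ c.n) (hd : 0 < c.d) (hk : 0 < c.k) (hlg : 0 < c.lg)
    (ha : ∀ i, a i = dist (c.pt i) (C (cl i)) ^ 2) {s : Mem} (hs : Slots c 0 s)
    (h9 : s.nat 9 = 0) (hrem : remaining c s = Finset.range c.n) :
    (1 - (7 / 8) ^ (32 * c.lg)) ^ (6 * c.lg) ≤
      success ((Prog.loop (6 * cell 4) roundP).run A T s) (RoundsGood c a (6 * c.lg)) := by
  rw [Prog.run, show (6 * cell 4 : NExp).eval s = 6 * c.lg by simp [hs.par.lg]]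
  refine success_loop_all (τ := roundTime c) (fun r s => Slots c r s ∧ s.nat 9 = r * c.smp)
    (RoundsGood c a) (6 * c.lg)
    (fun r hr s hs => ensures_roundP hn hd hk hlg (fun i j => by rw [c.D_eq]; positivity)
      (slot_bound c hr) hs.1 hs.2)
    (fun r hr s hs hg => success_roundP hn hd hk c.D_eq ha (slot_bound c hr) hs.1 hs.2 hg)
    (6 * c.lg) 0 (by omega) s ⟨hs, by simpa using h9⟩ ?_
  -- Before the first round nothing is removed, so thresholds and assignment are arbitrary.
  exact ⟨fun _ => Finset.range c.n, fun _ => 0, fun _ => 0, rfl, hrem.symm, by simp,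
    by simp [hrem], by simp, by simp [hrem]⟩

/-- A bound for the running time of the algorithm without the call of the black box. -/
def totalTime (c : Params) : ℕ := 1000000 * (c.lg * (c.lg * (c.n * (c.d * c.k))))

theorem totalTime_ge (hn : 2 ≤ c.n) (hd : 0 < c.d) (hk : 0 < c.k) (hlg : 0 < c.lg) :
    c.n * 4 + 5 + (6 * c.lg * (roundTime c + 1) + 1 + (c.m * (c.d * 3 + 5) + 3))
      ≤ totalTime c := by
  rw [totalTime, roundTime, Params.m]
  have h0 : 0 < c.d * c.k := Nat.mul_pos hd hk
  have h1 : 2 * 1 ≤ c.n * (c.d * c.k) := Nat.mul_le_mul hn h0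
  have h2 : c.n * 1 ≤ c.n * (c.d * c.k) := Nat.mul_le_mul_left _ h0
  have h3 : 1 * (c.n * (c.d * c.k)) ≤ c.lg * (c.n * (c.d * c.k)) := Nat.mul_le_mul_right _ hlg
  have h3' : 1 * (c.lg * (c.n * (c.d * c.k))) ≤ c.lg * (c.lg * (c.n * (c.d * c.k))) :=
    Nat.mul_le_mul_right _ hlg
  have h4 : c.lg * 1 ≤ c.lg * (c.n * (c.d * c.k)) := Nat.mul_le_mul_left _ (by omega)
  have h5 : 6 * c.lg * (40000 * (c.lg * (c.n * (c.d * c.k))) + 1)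
      = 240000 * (c.lg * (c.lg * (c.n * (c.d * c.k)))) + 6 * c.lg := by ring
  have h6 : 48 * c.lg * c.k * (c.d * 3 + 5) = 144 * (c.lg * (c.d * c.k)) + 240 * (c.lg * c.k) := by
    ring
  have h7 : c.k ≤ c.d * c.k := Nat.le_mul_of_pos_left _ hd
  have h8 : c.d * c.k ≤ c.n * (c.d * c.k) := Nat.le_mul_of_pos_left _ (by omega)
  have h9 : c.lg * (c.d * c.k) ≤ c.lg * (c.n * (c.d * c.k)) := Nat.mul_le_mul_left _ h8
  have h10 : c.lg * c.k ≤ c.lg * (c.n * (c.d * c.k)) := Nat.mul_le_mul_left _ (h7.trans h8)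
  rw [h5, h6]
  omega

theorem ensures_outliersP {s : Mem} (h0 : s.nat 0 = c.n) (h1 : s.nat 1 = c.d)
    (h2 : s.nat 2 = c.k) (h3 : s.nat 3 = c.z) (h4 : ∀ b, 4 ≤ b → s.nat b = 0) (hlg : c.lg = c.n.size)
    (hreal : s.real = c.coord) (hn : 2 ≤ c.n) (hd : 0 < c.d) (hk : 0 < c.k) :
    Ensures (outliersP.run A T s) (fun _ => True) (totalTime c + T c.m c.k c.d) := by
  have hlg0 : 0 < c.lg := by rw [hlg, Nat.size_pos]; omega
  have hc : c = ⟨c.n, c.d, c.k, c.z, c.n.size, s.real⟩ := by rw [← hlg, hreal]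
  unfold outliersP
  refine Ensures.mono (t := (c.n * 4 + 5) + ((6 * c.lg * (roundTime c + 1) + 1) +
    (c.m * (c.d * 3 + 5) + 3 + T c.m c.k c.d))) ?_ (fun _ h => h)
    (by have := totalTime_ge hn hd hk hlg0; omega)
  apply ensures_seq
  refine (ensures_setupP h0 h1 h2 h3 h4 (by omega)).mono ?_ le_rfl
  rw [← hc]
  rintro s1 ⟨f1, f2, -⟩
  apply ensures_seq
  refine (ensures_rounds hn hd hk hlg0 f1 f2).mono ?_ le_rfl
  intro s2 g
  exact (ensures_finishP g).mono (fun _ _ => trivial) le_rfl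

theorem success_outliersP {s : Mem} (h0 : s.nat 0 = c.n) (h1 : s.nat 1 = c.d)
    (h2 : s.nat 2 = c.k) (h3 : s.nat 3 = c.z) (h4 : ∀ b, 4 ≤ b → s.nat b = 0) (hlg : c.lg = c.n.size)
    (hreal : s.real = c.coord) (hn : 2 ≤ c.n) (hd : 0 < c.d) (hk : 0 < c.k)
    (ha : ∀ i, a i = dist (c.pt i) (C (cl i)) ^ 2) :
    (1 - (7 / 8) ^ (32 * c.lg)) ^ (6 * c.lg) ≤ success (outliersP.run A T s) (GoodOutput A c a) := by
  have hlg0 : 0 < c.lg := by rw [hlg, Nat.size_pos]; omega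
  have hc : c = ⟨c.n, c.d, c.k, c.z, c.n.size, s.real⟩ := by rw [← hlg, hreal]
  have hset := ensures_setupP (A := A) (T := T) h0 h1 h2 h3 h4 (by omega)
  rw [← hc] at hset
  have key : ∀ s1, Slots c 0 s1 ∧ s1.nat 9 = 0 ∧ remaining c s1 = Finset.range c.n →
      (1 - (7 / 8) ^ (32 * c.lg)) ^ (6 * c.lg) ≤
        success ((Prog.loop (6 * cell 4) roundP ;; finishP).run A T s1) (GoodOutput A c a) := by
    rintro s1 ⟨f1, f2, f3⟩
    have := success_seq_ge (b := 1) (q := finishP) (G' := GoodOutput A c a)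
      (ensures_rounds (A := A) (T := T) hn hd hk hlg0 f1 f2)
      (success_rounds hn hd hk hlg0 ha f1 f2 f3) fun s2 g1 g2 =>
        ((ensures_finishP g1).success fun s3 h => ⟨s2, g1, g2, h⟩).ge
    rwa [one_mul] at this
  have := success_seq_ge (a := 1) (q := Prog.loop (6 * cell 4) roundP ;; finishP)
    (G' := GoodOutput A c a) hset (hset.success fun _ h => h).ge fun s1 _ h => key s1 h
  rwa [mul_one] at this

end

/-! ## The cost of the output -/

/-- A difference with lag l is a sum of l differences with lag 1, each of which telescopes over q to
at most `F 0`. -/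
theorem sum_sub_lag_le {F : ℕ → ℝ} (hF : Antitone F) (h0 : ∀ q, 0 ≤ F q) (r l : ℕ) :
    ∑ q ∈ Finset.range r, (F q - F (q + l)) ≤ l * F 0 := by
  induction l with
  | zero => simp
  | succ l ih =>
    have h1 : ∑ q ∈ Finset.range r, (F (q + l) - F (q + 1 + l)) = F (0 + l) - F (r + l) :=
      Finset.sum_range_sub' (fun q => F (q + l)) r
    have h2 : ∑ q ∈ Finset.range r, (F q - F (q + (l + 1))) =
        ∑ q ∈ Finset.range r, (F q - F (q + l)) +
          ∑ q ∈ Finset.range r, (F (q + l) - F (q + 1 + l)) := by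
      rw [← Finset.sum_add_distrib]
      refine Finset.sum_congr rfl fun q _ => ?_
      rw [show q + (l + 1) = q + 1 + l by ring]
      ring
    rw [h2, h1]
    push_cast
    have := hF (Nat.zero_le (0 + l))
    linarith [h0 (r + l)]

theorem pow_mul_card_le {V : ℕ → Finset ℕ} (hV : ∀ q, 8 * (V (q + 1)).card ≤ 7 * (V q).card)
    (q l : ℕ) : 8 ^ l * (V (q + l)).card ≤ 7 ^ l * (V q).card := by
  induction l with
  | zero => simp
  | succ l ih =>
    calc 8 ^ (l + 1) * (V (q + (l + 1))).card = 8 ^ l * (8 * (V (q + l + 1)).card) := by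
          rw [pow_succ, mul_assoc, add_assoc]
      _ ≤ 8 ^ l * (7 * (V (q + l)).card) := Nat.mul_le_mul_left _ (hV _)
      _ = 7 * (8 ^ l * (V (q + l)).card) := by ring
      _ ≤ 7 * (7 ^ l * (V q).card) := Nat.mul_le_mul_left _ ih
      _ = 7 ^ (l + 1) * (V q).card := by ring

/-- If the sizes of a decreasing sequence of sets decay geometrically, and each set has many elements
that are expensive compared with a threshold, then the thresholds can be charged to the elements. -/
theorem sum_card_mul_le {V : ℕ → Finset ℕ} {t : ℕ → ℝ} {a : ℕ → ℝ} {O : Finset ℕ} {r : ℕ}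
    (hsub : ∀ q, V (q + 1) ⊆ V q) (hV : ∀ q, 8 * (V (q + 1)).card ≤ 7 * (V q).card)
    (ha : ∀ i, 0 ≤ a i) (ht : ∀ q < r, 0 ≤ t q)
    (hH : ∀ q < r, (V q).card ≤ 16 * ({i ∈ V q \ O | t q ≤ 4 * a i} : Finset ℕ).card) :
    ∑ q ∈ Finset.range r, ((V q).card : ℝ) * t q ≤ 3456 * ∑ i ∈ V 0 \ O, a i := by
  set F : ℕ → ℝ := fun q => ∑ i ∈ V q \ O, a i with hF
  have hanti : Antitone V := antitone_nat_of_succ_le hsub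
  have hFanti : Antitone F := fun p q hpq =>
    Finset.sum_le_sum_of_subset_of_nonneg (Finset.sdiff_subset_sdiff (hanti hpq) le_rfl)
      fun i _ _ => ha i
  have hF0 : ∀ q, 0 ≤ F q := fun q => Finset.sum_nonneg fun i _ => ha i
  -- The lag 27 is such that (7/8)^27 ≤ 1/32. At least 1/16 - 1/32 = 1/32 of `V q` then consists of
  -- expensive points outside O that disappear within 27 rounds; each pays t/4, whence 128 = 32 · 4.
  -- Summation gives 128 · 27 = 3456.
  have hstep : ∀ q ∈ Finset.range r, ((V q).card : ℝ) * t q ≤ 128 * (F q - F (q + 27)) := by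
    intro q hq
    have hq := Finset.mem_range.mp hq
    set H : Finset ℕ := {i ∈ V q \ O | t q ≤ 4 * a i} with hHdef
    have h1 : (V q).card ≤ 16 * H.card := hH q hq
    have h2 := pow_mul_card_le hV q 27
    have h3 : 32 * (V (q + 27)).card ≤ (V q).card := by
      have : 32 * 7 ^ 27 * (V q).card ≤ 8 ^ 27 * (V q).card :=
        Nat.mul_le_mul_right _ (by norm_num)
      have h4 : 8 ^ 27 * (32 * (V (q + 27)).card) ≤ 8 ^ 27 * (V q).card := by
        calc 8 ^ 27 * (32 * (V (q + 27)).card) = 32 * (8 ^ 27 * (V (q + 27)).card) := by ring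
          _ ≤ 32 * (7 ^ 27 * (V q).card) := Nat.mul_le_mul_left _ h2
          _ = 32 * 7 ^ 27 * (V q).card := by ring
          _ ≤ _ := this
      exact Nat.le_of_mul_le_mul_left h4 (by positivity)
    have h4 : (V q).card ≤ 32 * (H \ V (q + 27)).card := by
      have := Finset.le_card_sdiff (V (q + 27)) H
      clear h2
      omega
    have h5 : ((H \ V (q + 27)).card : ℝ) * t q ≤ 4 * ∑ i ∈ H \ V (q + 27), a i := by
      rw [Finset.mul_sum, ← nsmul_eq_mul]
      refine Finset.card_nsmul_le_sum _ _ _ fun i hi => ?_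
      exact (Finset.mem_filter.mp (Finset.mem_sdiff.mp hi).1).2
    have h6 : ∑ i ∈ H \ V (q + 27), a i + F (q + 27) ≤ F q := by
      rw [hF]
      dsimp only
      rw [← Finset.sum_union]
      · refine Finset.sum_le_sum_of_subset_of_nonneg ?_ fun i _ _ => ha i
        refine Finset.union_subset (Finset.sdiff_subset.trans (Finset.filter_subset _ _)) ?_
        exact Finset.sdiff_subset_sdiff (hanti (by omega)) le_rfl
      · exact Finset.disjoint_of_subset_right Finset.sdiff_subset Finset.sdiff_disjoint
    have h7 : ((V q).card : ℝ) ≤ 32 * ((H \ V (q + 27)).card : ℝ) := by exact_mod_cast h4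
    calc ((V q).card : ℝ) * t q ≤ 32 * ((H \ V (q + 27)).card : ℝ) * t q :=
          mul_le_mul_of_nonneg_right h7 (ht q hq)
      _ ≤ 128 * (F q - F (q + 27)) := by linarith
  refine (Finset.sum_le_sum hstep).trans ?_
  rw [← Finset.mul_sum]
  have := sum_sub_lag_le hFanti hF0 r 27
  push_cast at this
  have h0 : F 0 = ∑ i ∈ V 0 \ O, a i := rfl
  rw [← h0]
  linarith

/-- Skipped rounds do not shrink the set. Replacing the sets of skipped rounds, and all after round
r, by the empty set yields a sequence that decays at every index. -/
theorem shrinks_active {c : Params} {a : ℕ → ℝ} {V : ℕ → Finset ℕ} {t : ℕ → ℝ} {r : ℕ}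
    (hV : ∀ q < r, Shrinks c a (V q) (V (q + 1)) (t q)) {W : ℕ → Finset ℕ}
    (hW : W = fun q => if q ≤ r ∧ 128 * c.k * c.z < (V q).card then V q else ∅) (q : ℕ) :
    W (q + 1) ⊆ W q ∧ 8 * (W (q + 1)).card ≤ 7 * (W q).card := by
  subst hW
  dsimp only
  by_cases h : q + 1 ≤ r ∧ 128 * c.k * c.z < (V (q + 1)).card
  · rw [if_pos h]
    rcases hV q h.1 with ⟨h1, h2, -⟩ | ⟨h1, h2, h3, -⟩
    · rw [h2] at h; omega
    · rw [if_pos ⟨by omega, h1⟩]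
      exact ⟨h3, h2⟩
  · rw [if_neg h]; simp

/-- Otherwise all rounds were active, and n < 2^lg together with 2 · 7^6 ≤ 8^6 would leave less than
one point after 6 lg of them. -/
theorem card_remaining_le {c : Params} {a : ℕ → ℝ} {V : ℕ → Finset ℕ} {t : ℕ → ℝ}
    (h0 : V 0 = Finset.range c.n) (hlg : c.n < 2 ^ c.lg)
    (hV : ∀ q < 6 * c.lg, Shrinks c a (V q) (V (q + 1)) (t q)) :
    (V (6 * c.lg)).card ≤ 128 * c.k * c.z := by
  by_contra hcon
  rw [not_le] at hcon
  set W : ℕ → Finset ℕ := fun q => if q ≤ 6 * c.lg ∧ 128 * c.k * c.z < (V q).card then V q else ∅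
    with hW
  have h1 := pow_mul_card_le (fun q => (shrinks_active hV hW q).2) 0 (6 * c.lg)
  have h2 : (W 0).card ≤ c.n := by
    rw [hW]
    dsimp only
    split_ifs
    · rw [h0]; simp
    · simp
  have h3 : 1 ≤ (W (0 + 6 * c.lg)).card := by
    rw [zero_add, hW]
    dsimp only
    rw [if_pos ⟨le_rfl, hcon⟩]
    omega
  have h4 : (7 : ℕ) ^ (6 * c.lg) * 2 ^ c.lg ≤ 8 ^ (6 * c.lg) := by
    rw [pow_mul, pow_mul, ← mul_pow]
    exact Nat.pow_le_pow_left (by norm_num) _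
  have h5 : 8 ^ (6 * c.lg) * 1 < 8 ^ (6 * c.lg) * 1 := by
    calc 8 ^ (6 * c.lg) * 1 ≤ 8 ^ (6 * c.lg) * (W (0 + 6 * c.lg)).card := Nat.mul_le_mul_left _ h3
      _ ≤ 7 ^ (6 * c.lg) * (W 0).card := h1
      _ ≤ 7 ^ (6 * c.lg) * c.n := Nat.mul_le_mul_left _ h2
      _ < 7 ^ (6 * c.lg) * 2 ^ c.lg := Nat.mul_lt_mul_of_pos_left hlg (by positivity)
      _ ≤ _ := by rw [mul_one]; exact h4
  exact lt_irrefl _ h5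

theorem sum_thresholds_le {c : Params} {a : ℕ → ℝ} {V : ℕ → Finset ℕ} {t : ℕ → ℝ} {r : ℕ}
    {O : Finset ℕ} (hk : 0 < c.k) (ha : ∀ i, 0 ≤ a i) (hO : O.card ≤ c.z)
    (h0 : V 0 = Finset.range c.n) (hV : ∀ q < r, Shrinks c a (V q) (V (q + 1)) (t q)) :
    ∑ q ∈ Finset.range r, ((V q).card : ℝ) * t q ≤ 3456 * ∑ i ∈ Finset.range c.n \ O, a i := by
  set W : ℕ → Finset ℕ := fun q => if q ≤ r ∧ 128 * c.k * c.z < (V q).card then V q else ∅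
    with hW
  have h1 : ∑ q ∈ Finset.range r, ((V q).card : ℝ) * t q
      = ∑ q ∈ Finset.range r, ((W q).card : ℝ) * t q := by
    refine Finset.sum_congr rfl fun q hq => ?_
    have hq := Finset.mem_range.mp hq
    rcases hV q hq with ⟨-, -, h3⟩ | ⟨h3, -⟩
    · rw [h3, mul_zero, mul_zero]
    · rw [hW]; dsimp only; rw [if_pos ⟨hq.le, h3⟩]
  rw [h1]
  refine (sum_card_mul_le (fun q => (shrinks_active hV hW q).1)
    (fun q => (shrinks_active hV hW q).2) (O := O) (a := a) ha (fun q hq => ?_)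
    fun q hq => ?_).trans ?_
  · rcases hV q hq with ⟨-, -, h3⟩ | ⟨-, -, -, h3, -⟩
    · rw [h3]
    · exact h3
  · rcases hV q hq with ⟨h3, -, -⟩ | ⟨h3, -, -, -, h4⟩
    · have : W q = ∅ := by rw [hW]; exact if_neg fun h => by omega
      rw [this]; simp
    · have : W q = V q := by rw [hW]; exact if_pos ⟨hq.le, h3⟩
      rw [this]
      -- Excluding O turns the fraction 1/8 into 1/16: O has at most z points, and 16 z is at most
      -- |V q| since |V q| > 128kz and k ≥ 1.
      have h5 : ({i ∈ V q | t q ≤ 4 * a i} : Finset ℕ).card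
          ≤ ({i ∈ V q \ O | t q ≤ 4 * a i} : Finset ℕ).card + O.card := by
        refine (Finset.card_le_card fun i hi => ?_).trans (Finset.card_union_le _ _)
        simp only [Finset.mem_filter, Finset.mem_union, Finset.mem_sdiff] at hi ⊢
        tauto
      have h6 : 128 * 1 * c.z ≤ 128 * c.k * c.z :=
        Nat.mul_le_mul_right _ (Nat.mul_le_mul_left _ hk)
      omega
  · refine mul_le_mul_of_nonneg_left ?_ (by norm_num)
    refine Finset.sum_le_sum_of_subset_of_nonneg ?_ fun i _ _ => ha i
    refine Finset.sdiff_subset_sdiff ?_ le_rfl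
    rw [hW, ← h0]
    dsimp only
    split_ifs
    · exact le_rfl
    · exact Finset.empty_subset _

/-! ### Distances to centers -/

section
variable {d k : ℕ}

theorem distTo_nonneg (x : Pt d) (C : Fin k → Pt d) : 0 ≤ distTo x C :=
  Real.iInf_nonneg fun _ => dist_nonneg

theorem distTo_le (x : Pt d) (C : Fin k → Pt d) (j : Fin k) : distTo x C ≤ dist x (C j) :=
  ciInf_le ⟨0, by rintro _ ⟨j, rfl⟩; exact dist_nonneg⟩ j

theorem exists_distTo_eq (hk : 0 < k) (x : Pt d) (C : Fin k → Pt d) :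
    ∃ j, distTo x C = dist x (C j) := by
  have : Nonempty (Fin k) := ⟨⟨0, hk⟩⟩
  obtain ⟨j, hj⟩ := exists_eq_ciInf_of_finite (f := fun j => dist x (C j))
  exact ⟨j, hj.symm⟩

theorem distTo_sq_le (hk : 0 < k) (x y : Pt d) (C : Fin k → Pt d) :
    distTo x C ^ 2 ≤ 2 * dist x y ^ 2 + 2 * distTo y C ^ 2 := by
  obtain ⟨j, hj⟩ := exists_distTo_eq hk y C
  have h1 : distTo x C ≤ dist x y + distTo y C := by
    rw [hj]; exact (distTo_le x C j).trans (dist_triangle _ _ _)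
  have h2 := distTo_nonneg x C
  nlinarith [sq_nonneg (dist x y - distTo y C)]

variable {n : ℕ}

theorem outlierCost_le {z : ℕ} (X : Fin n → Pt d) (C : Fin k → Pt d) (R : Finset (Fin n))
    (hR : R.card ≤ z) : outlierCost z X C ≤ ∑ i ∈ Rᶜ, distTo (X i) C ^ 2 :=
  ciInf_le (f := fun R : {R : Finset (Fin n) // R.card ≤ z} => ∑ i ∈ R.1ᶜ, distTo (X i) C ^ 2)
    ⟨0, by rintro _ ⟨Q, rfl⟩; exact Finset.sum_nonneg fun i _ => sq_nonneg _⟩ ⟨R, hR⟩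

theorem exists_outlierCost_eq (z : ℕ) (X : Fin n → Pt d) (C : Fin k → Pt d) :
    ∃ R : Finset (Fin n), R.card ≤ z ∧ outlierCost z X C = ∑ i ∈ Rᶜ, distTo (X i) C ^ 2 := by
  have : Nonempty {R : Finset (Fin n) // R.card ≤ z} := ⟨⟨∅, by simp⟩⟩
  obtain ⟨R, hR⟩ := exists_eq_ciInf_of_finite
    (f := fun R : {R : Finset (Fin n) // R.card ≤ z} => ∑ i ∈ R.1ᶜ, distTo (X i) C ^ 2)
  exact ⟨R.1, R.2, hR.symm⟩

/-- Moving the centers to the nearest points of the instance at most doubles the distances. -/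
theorem exists_snap (hk : 0 < k) (hn : 0 < n) (z : ℕ) (X : Fin n → Pt d) (C : Fin k → Pt d) :
    ∃ σ : Fin k → Fin n, outlierCost z X (X ∘ σ) ≤ 4 * outlierCost z X C := by
  have : Nonempty (Fin n) := ⟨⟨0, hn⟩⟩
  choose σ hσ using fun j => Finite.exists_min fun i => dist (X i) (C j)
  refine ⟨σ, ?_⟩
  obtain ⟨R, hR, hRe⟩ := exists_outlierCost_eq z X C
  rw [hRe, Finset.mul_sum]
  refine (outlierCost_le X _ R hR).trans (Finset.sum_le_sum fun i _ => ?_)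
  obtain ⟨j, hj⟩ := exists_distTo_eq hk (X i) C
  have h1 : distTo (X i) (X ∘ σ) ≤ dist (X i) (X (σ j)) := distTo_le _ _ j
  have h2 := dist_triangle_right (X i) (X (σ j)) (C j)
  have h3 := hσ j i
  have h4 := distTo_nonneg (X i) (X ∘ σ)
  rw [hj]
  nlinarith

/-- Among the finitely many families of instance points there is a best one, and snapping compares
it with every family of centers. So it need not be shown that the infimum is attained. -/
theorem exists_near_optimal (hk : 0 < k) (hn : 0 < n) (z : ℕ) (X : Fin n → Pt d) :
    ∃ C : Fin k → Pt d, outlierCost z X C ≤ 4 * outlierOpt X k z := by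
  have : Nonempty (Fin n) := ⟨⟨0, hn⟩⟩
  obtain ⟨σ, hσ⟩ := Finite.exists_min fun σ : Fin k → Fin n => outlierCost z X (X ∘ σ)
  refine ⟨X ∘ σ, ?_⟩
  have h : outlierCost z X (X ∘ σ) / 4 ≤ outlierOpt X k z := by
    refine le_ciInf fun C => ?_
    obtain ⟨τ, hτ⟩ := exists_snap hk hn z X C
    have := hσ τ
    linarith
  linarith

theorem outlierOpt_nonneg (X : Fin n → Pt d) (k z : ℕ) : 0 ≤ outlierOpt X k z :=
  Real.iInf_nonneg fun _ => Real.iInf_nonneg fun _ => Finset.sum_nonneg fun _ _ => sq_nonneg _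

theorem weightedOpt_le {m : ℕ} (Y : Fin m → Pt d) (w : Fin m → ℕ) (C : Fin k → Pt d) :
    weightedOpt Y w k ≤ weightedCost Y w C :=
  ciInf_le (f := fun C : Fin k → Pt d => weightedCost Y w C)
    ⟨0, by rintro _ ⟨C, rfl⟩; exact Finset.sum_nonneg fun i _ => by positivity⟩ C

end

/-! ### From slots to points -/

section
variable {d k m : ℕ} {W O : Finset ℕ} {asg : ℕ → ℕ} {x : ℕ → Pt d} {p : ℕ → ℕ} {w : ℕ → ℕ}

theorem weightedCost_eq_sum (hasg : ∀ i ∈ W, asg i < m)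
    (hw : ∀ y < m, w y = ({i ∈ W | asg i = y} : Finset ℕ).card) (C : Fin k → Pt d) :
    weightedCost (fun y : Fin m => x (p y)) (fun y => w y) C
      = ∑ i ∈ W, distTo (x (p (asg i))) C ^ 2 := by
  rw [weightedCost, ← Finset.sum_range fun y => (w y : ℝ) * distTo (x (p y)) C ^ 2,
    ← Finset.sum_fiberwise_of_maps_to (g := asg) (t := Finset.range m)
      fun i hi => Finset.mem_range.mpr (hasg i hi)]
  refine Finset.sum_congr rfl fun y hy => ?_
  rw [hw y (Finset.mem_range.mp hy), Finset.sum_congr rfl (g := fun _ => distTo (x (p y)) C ^ 2)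
    fun i hi => by rw [(Finset.mem_filter.mp hi).2], Finset.sum_const, nsmul_eq_mul]

/-- A slot of positive weight represents at least 2z points, at most z of them in O, so its weight
is at most twice the number of its points outside O. Charging only these costs a factor 2, and
moving between slot and point another factor 2. -/
theorem weightedCost_le_of_heavy (hk : 0 < k) {z : ℕ} (hO : O.card ≤ z)
    (hasg : ∀ i ∈ W, asg i < m)
    (hw : ∀ y < m, w y = ({i ∈ W | asg i = y} : Finset ℕ).card)
    (hheavy : ∀ y < m, 0 < w y → 2 * z ≤ w y) (C : Fin k → Pt d) :
    weightedCost (fun y : Fin m => x (p y)) (fun y => w y) C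
      ≤ 4 * ∑ i ∈ W, dist (x i) (x (p (asg i))) ^ 2 + 4 * ∑ i ∈ W \ O, distTo (x i) C ^ 2 := by
  have h1 : ∀ y ∈ Finset.range m, (w y : ℝ) * distTo (x (p y)) C ^ 2 ≤
      ∑ i ∈ W \ O with asg i = y,
        (4 * dist (x i) (x (p (asg i))) ^ 2 + 4 * distTo (x i) C ^ 2) := by
    intro y hy
    have hy := Finset.mem_range.mp hy
    have hcard : w y ≤ 2 * ({i ∈ W \ O | asg i = y} : Finset ℕ).card := by
      have e1 : ({i ∈ W | asg i = y} : Finset ℕ).card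
          ≤ ({i ∈ W \ O | asg i = y} : Finset ℕ).card + O.card := by
        refine (Finset.card_le_card fun i hi => ?_).trans (Finset.card_union_le _ _)
        simp only [Finset.mem_filter, Finset.mem_union, Finset.mem_sdiff] at hi ⊢
        tauto
      have e2 := hw y hy
      have e3 := hheavy y hy
      omega
    have hcard' : (w y : ℝ) ≤ 2 * (({i ∈ W \ O | asg i = y} : Finset ℕ).card : ℝ) := by
      exact_mod_cast hcard
    calc (w y : ℝ) * distTo (x (p y)) C ^ 2
        ≤ 2 * (({i ∈ W \ O | asg i = y} : Finset ℕ).card : ℝ) * distTo (x (p y)) C ^ 2 :=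
          mul_le_mul_of_nonneg_right hcard' (sq_nonneg _)
      _ = ∑ i ∈ W \ O with asg i = y, 2 * distTo (x (p y)) C ^ 2 := by
          rw [Finset.sum_const, nsmul_eq_mul]; ring
      _ ≤ _ := by
          refine Finset.sum_le_sum fun i hi => ?_
          have := distTo_sq_le hk (x (p y)) (x i) C
          rw [(Finset.mem_filter.mp hi).2]
          rw [dist_comm] at this
          linarith
  rw [weightedCost, ← Finset.sum_range fun y => (w y : ℝ) * distTo (x (p y)) C ^ 2]
  refine (Finset.sum_le_sum h1).trans ?_
  rw [Finset.sum_fiberwise_of_maps_to (g := asg) (t := Finset.range m)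
      fun i hi => Finset.mem_range.mpr (hasg i (Finset.mem_sdiff.mp hi).1),
    Finset.sum_add_distrib, ← Finset.mul_sum, ← Finset.mul_sum]
  gcongr
  exact Finset.sdiff_subset

end

/-- The cost of the centers found by the black box, when all rounds were good. -/
theorem cost_of_roundsGood {c : Params} (hk : 0 < c.k) (hlg : c.n < 2 ^ c.lg) {A : KMeansAlg}
    {α : ℝ} (hα : 1 ≤ α) (hA : A.IsApprox α) {C : Fin c.k → Pt c.d} {O : Finset ℕ}
    (hO : O.card ≤ c.z) {s : Mem}
    (hs : RoundsGood c (fun i => distTo (c.pt i) C ^ 2) (6 * c.lg) s) {C' : Fin c.k → Pt c.d}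
    (hC' : C' ∈ (A c.m c.k c.d (fun y => c.pt (s.nat (3 * (y : ℕ) + 33)))
        fun y => s.nat (3 * (y : ℕ) + 34)).support) :
    ∃ U ⊆ Finset.range c.n, U.card ≤ 128 * c.k * c.z ∧
      ∑ i ∈ Finset.range c.n \ U, distTo (c.pt i) C' ^ 2
        ≤ 34568 * α * ∑ i ∈ Finset.range c.n \ O, distTo (c.pt i) C ^ 2 := by
  obtain ⟨V, t, asg, h1, h2, h3, h4, h5, h6⟩ := hs
  have hm : 6 * c.lg * c.smp = c.m := by rw [Params.smp, Params.m]; ring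
  rw [hm] at h4 h5
  have hcard := card_remaining_le h1 hlg h3
  rw [h2] at hcard
  have hmove := h6.trans (sum_thresholds_le hk (fun i => sq_nonneg _) hO h1 h3)
  set U := remaining c s with hU
  set W := Finset.range c.n \ U with hW
  set Opt := ∑ i ∈ Finset.range c.n \ O, distTo (c.pt i) C ^ 2 with hOpt
  simp only [c.D_eq] at hmove
  set M := ∑ i ∈ W, dist (c.pt i) (c.pt (s.nat (3 * asg i + 33))) ^ 2 with hM
  have hOpt0 : 0 ≤ Opt := Finset.sum_nonneg fun i _ => sq_nonneg _
  have hw : ∀ y < c.m, s.nat (3 * y + 34) = ({i ∈ W | asg i = y} : Finset ℕ).card :=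
    fun y hy => (h5 y hy).1
  have e1 := weightedCost_eq_sum (x := c.pt) (p := fun y => s.nat (3 * y + 33))
    (w := fun y => s.nat (3 * y + 34)) h4 hw C'
  have e2 := weightedCost_le_of_heavy (x := c.pt) (p := fun y => s.nat (3 * y + 33))
    (w := fun y => s.nat (3 * y + 34)) hk hO h4 hw (fun y hy => (h5 y hy).2) C
  have e3 := hA _ _ _ _ _ C' hC'
  have e4 := weightedOpt_le (fun y : Fin c.m => c.pt (s.nat (3 * (y : ℕ) + 33)))
    (fun y => s.nat (3 * (y : ℕ) + 34)) C
  have e5 : ∑ i ∈ W \ O, distTo (c.pt i) C ^ 2 ≤ Opt := by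
    refine Finset.sum_le_sum_of_subset_of_nonneg ?_ fun i _ _ => sq_nonneg _
    exact Finset.sdiff_subset_sdiff Finset.sdiff_subset le_rfl
  have e6 : ∑ i ∈ W, distTo (c.pt i) C' ^ 2
      ≤ 2 * M + 2 * ∑ i ∈ W, distTo (c.pt (s.nat (3 * asg i + 33))) C' ^ 2 := by
    rw [hM, Finset.mul_sum, Finset.mul_sum, ← Finset.sum_add_distrib]
    exact Finset.sum_le_sum fun i _ => distTo_sq_le hk _ _ _
  refine ⟨U, Finset.filter_subset _ _, hcard, ?_⟩
  have e7 : ∑ i ∈ W, distTo (c.pt (s.nat (3 * asg i + 33))) C' ^ 2 ≤ α * (4 * M + 4 * Opt) := by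
    rw [← e1]
    refine e3.trans (mul_le_mul_of_nonneg_left (e4.trans (e2.trans ?_)) (by linarith))
    linarith
  -- The constants are 13828 = 4 · 3456 + 4 and, in the end, 34568 = 2 · 3456 + 2 · 13828, where α ≥
  -- 1 absorbs the term without α.
  have e8 : 4 * M + 4 * Opt ≤ 13828 * Opt := by linarith
  have e9 : α * (4 * M + 4 * Opt) ≤ α * (13828 * Opt) :=
    mul_le_mul_of_nonneg_left e8 (by linarith)
  have e10 : Opt ≤ α * Opt := le_mul_of_one_le_left hOpt0 hα
  calc ∑ i ∈ W, distTo (c.pt i) C' ^ 2 ≤ 2 * M + 2 * (α * (13828 * Opt)) := by linarith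
    _ ≤ 6912 * (α * Opt) + 2 * (α * (13828 * Opt)) := by linarith
    _ = 34568 * α * Opt := by ring

/-! ## The theorem -/

/-- Since (7/8)^32 ≤ 1/24, a round fails with probability at most 24^(-l) ≤ 1/(12 l), and
Bernoulli's inequality over 6 l rounds leaves 1/2. -/
theorem half_le_success {l : ℕ} (hl : 0 < l) :
    (2⁻¹ : ℝ≥0∞) ≤ (1 - (7 / 8) ^ (32 * l)) ^ (6 * l) := by
  set x : ℝ := (7 / 8) ^ (32 * l) with hx
  have h0 : 0 ≤ x := by positivity
  have hl' : (0 : ℝ) < l := by exact_mod_cast hl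
  have h1 : 12 * (l : ℝ) ≤ 24 ^ l := by
    have : 12 * l ≤ 24 ^ l := by
      calc 12 * l ≤ 12 * 2 ^ l := Nat.mul_le_mul_left _ Nat.lt_two_pow_self.le
        _ ≤ 12 ^ l * 2 ^ l := Nat.mul_le_mul_right _ (Nat.le_self_pow (by omega) _)
        _ = 24 ^ l := (mul_pow 12 2 l).symm
    exact_mod_cast this
  have h2 : x ≤ 1 / (12 * l) := by
    calc x ≤ (1 / 24) ^ l := by
          rw [hx, pow_mul]
          exact pow_le_pow_left₀ (by positivity) (by norm_num) _
      _ = 1 / 24 ^ l := by rw [div_pow, one_pow]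
      _ ≤ 1 / (12 * l) := one_div_le_one_div_of_le (by positivity) h1
  have h3 : 12 * l * x ≤ 1 := by
    rw [le_div_iff₀ (by positivity)] at h2
    linarith
  have h4 : x ≤ 1 := pow_le_one₀ (by norm_num) (by norm_num)
  have h5 := one_add_mul_le_pow (a := -x) (by linarith) (6 * l)
  push_cast at h5
  have h6 : (1 / 2 : ℝ) ≤ (1 - x) ^ (6 * l) := by
    rw [sub_eq_add_neg]; linarith
  have h7 : ((7 / 8 : ℝ≥0∞)) ^ (32 * l) = ENNReal.ofReal x := by
    rw [hx, ENNReal.ofReal_pow (by norm_num), ENNReal.ofReal_div_of_pos (by norm_num)]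
    norm_num
  have h8 : (2⁻¹ : ℝ≥0∞) = ENNReal.ofReal (1 / 2) := by
    rw [ENNReal.ofReal_div_of_pos (by norm_num)]
    norm_num
  rw [h7, h8, ← ENNReal.ofReal_one, ← ENNReal.ofReal_sub _ h0,
    ← ENNReal.ofReal_pow (by linarith)]
  exact ENNReal.ofReal_le_ofReal h6

/-- The binary length is at most 1 + log n / log 2, which for n ≥ 2 is at most 2 log n / log 2, and
2 / log 2 < 3. -/
theorem size_le_log {n : ℕ} (hn : 2 ≤ n) : (n.size : ℝ) ≤ 3 * Real.log n := by
  have h1 : 2 ^ (n.size - 1) ≤ n := by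
    rw [← Nat.lt_size]
    have : 0 < n.size := Nat.size_pos.mpr (by omega)
    omega
  have h2 : ((n.size : ℝ) - 1) * Real.log 2 ≤ Real.log n := by
    have h : ((2 : ℝ) ^ (n.size - 1)) ≤ n := by exact_mod_cast h1
    have := Real.log_le_log (by positivity) h
    rw [Real.log_pow, Nat.cast_sub (Nat.size_pos.mpr (by omega))] at this
    simpa using this
  have h3 : Real.log 2 ≤ Real.log n := Real.log_le_log (by norm_num) (by exact_mod_cast hn)
  have h4 := Real.log_two_gt_d9
  nlinarith

/-! ### From the internal parameters back to the instance -/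

section
variable {n d : ℕ} (X : Fin n → Pt d) (k z : ℕ)

/-- The parameters of an instance. -/
def params : Params := ⟨n, d, k, z, n.size, (initMem X k z).real⟩

theorem params_pt (i : Fin n) : (params X k z).pt i = X i := by
  have := congrFun (Mem.readPts_writePts
    { nat := fun a => if a = 0 then n else if a = 1 then d else if a = 2 then k
        else if a = 3 then z else 0
      real := fun _ => 0 } 0 X) i
  rw [← this]
  ext l
  simp only [Params.pt, params, Mem.readPts, zero_add, initMem]

theorem sum_sdiff_range (S : Finset ℕ) {k' : ℕ} (C : Fin k' → Pt d) :
    ∑ i ∈ Finset.range n \ S, distTo ((params X k z).pt i) C ^ 2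
      = ∑ i ∈ ({i | (i : ℕ) ∈ S} : Finset (Fin n))ᶜ, distTo (X i) C ^ 2 := by
  rw [Finset.compl_filter, Finset.sdiff_eq_filter, Finset.sum_filter, Finset.sum_filter,
    Finset.sum_range]
  simp only [params_pt]
  congr! 2

theorem card_filter_val_mem_le (S : Finset ℕ) :
    ({i | (i : ℕ) ∈ S} : Finset (Fin n)).card ≤ S.card :=
  Finset.card_le_card_of_injOn Fin.val (fun i hi => by simpa using hi) Fin.val_injective.injOn

/-- A good output is an approximate solution. -/
theorem outlierCost_of_goodOutput (hk : 0 < k) {A : KMeansAlg} {α : ℝ} (hα : 1 ≤ α)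
    (hA : A.IsApprox α) {C : Fin k → Pt d} (hC : outlierCost z X C ≤ 4 * outlierOpt X k z)
    {s : Mem}
    (hs : GoodOutput A (params X k z) (fun i => distTo ((params X k z).pt i) C ^ 2) s) {b : ℕ}
    (hb : 138272 ≤ b) :
    outlierCost (b * k * z) X (output s k d) ≤ b * α * outlierOpt X k z := by
  obtain ⟨s', -, h1, h2⟩ := hs
  obtain ⟨R, hR, hRe⟩ := exists_outlierCost_eq z X C
  have hO : (R.map Fin.valEmbedding).card ≤ z := by rwa [Finset.card_map]
  obtain ⟨U, -, hUc, hU⟩ := cost_of_roundsGood (c := params X k z) hk (Nat.lt_size_self n) hα hA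
    hO h1 h2
  have e1 : ∑ i ∈ Finset.range n \ R.map Fin.valEmbedding, distTo ((params X k z).pt i) C ^ 2
      = outlierCost z X C := by
    rw [sum_sdiff_range, hRe]
    congr 2
    ext i
    simp [Fin.val_inj]
  have e2 : ({i | (i : ℕ) ∈ U} : Finset (Fin n)).card ≤ b * k * z :=
    (card_filter_val_mem_le U).trans (hUc.trans
      (Nat.mul_le_mul_right _ (Nat.mul_le_mul_right _ (by omega))))
  have e3 := outlierCost_le X (output s k d) _ e2
  rw [← sum_sdiff_range X k z] at e3
  refine e3.trans ((hU.trans_eq (congrArg (34568 * α * ·) e1)).trans ?_)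
  have e4 := outlierOpt_nonneg X k z
  have e5 : (138272 : ℝ) ≤ b := by exact_mod_cast hb
  calc 34568 * α * outlierCost z X C ≤ 34568 * α * (4 * outlierOpt X k z) :=
        mul_le_mul_of_nonneg_left hC (by positivity)
    _ = 138272 * α * outlierOpt X k z := by ring
    _ ≤ b * α * outlierOpt X k z := by gcongr

theorem totalTime_le (hn : 2 ≤ n) {b : ℕ} (hb : 9000000 ≤ b) :
    (totalTime (params X k z) : ℝ≥0∞) ≤ ENNReal.ofReal (b * (k * d * n * Real.log n ^ 2)) := by
  rw [← ENNReal.ofReal_natCast]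
  refine ENNReal.ofReal_le_ofReal ?_
  have h1 := size_le_log hn
  have h2 : (n.size : ℝ) ^ 2 ≤ 9 * Real.log n ^ 2 := by
    calc (n.size : ℝ) ^ 2 ≤ (3 * Real.log n) ^ 2 := pow_le_pow_left₀ (Nat.cast_nonneg _) h1 2
      _ = _ := by ring
  have e5 : (9000000 : ℝ) ≤ b := by exact_mod_cast hb
  calc (totalTime (params X k z) : ℝ) = 1000000 * (k * d * n * (n.size : ℝ) ^ 2) := by
        simp only [totalTime, params]; push_cast; ring
    _ ≤ 1000000 * (k * d * n * (9 * Real.log n ^ 2)) := by gcongr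
    _ = 9000000 * (k * d * n * Real.log n ^ 2) := by ring
    _ ≤ _ := by gcongr

theorem params_m_le (hn : 2 ≤ n) {b : ℕ} (hb : 144 ≤ b) :
    (params X k z).m ≤ ⌈(b : ℝ) * (k * Real.log n)⌉₊ := by
  have h1 := size_le_log hn
  have h2 : 0 ≤ Real.log n := Real.log_natCast_nonneg n
  have e5 : (144 : ℝ) ≤ b := by exact_mod_cast hb
  have : ((params X k z).m : ℝ) ≤ (b : ℝ) * (k * Real.log n) := by
    calc ((params X k z).m : ℝ) = 48 * (k * (n.size : ℝ)) := by
          simp only [Params.m, params]; push_cast; ring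
      _ ≤ 48 * (k * (3 * Real.log n)) := by gcongr
      _ = 144 * (k * Real.log n) := by ring
      _ ≤ _ := by gcongr
  exact_mod_cast this.trans (Nat.le_ceil _)

end

end

end KMeansOutliers

open KMeansOutliers in
theorem mainTheorem4 :
    ∃ (P : KMeansOutliers.Prog) (δ : ℝ≥0∞) (c : ℕ), 0 < δ ∧
      ∀ (α : ℝ) (A : KMeansOutliers.KMeansAlg) (T : ℕ → ℕ → ℕ → ℕ),
        1 ≤ α → A.IsApprox α → (∀ k d : ℕ, Monotone fun m => T m k d) →
        ∀ (n d k z : ℕ) (X : Fin n → KMeansOutliers.Pt d), 2 ≤ n → 1 ≤ d → 1 ≤ k →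
          δ ≤ (P.run A T (KMeansOutliers.initMem X k z)).toOuterMeasure
              {o | KMeansOutliers.outlierCost (c * k * z) X (KMeansOutliers.output o.1 k d)
                ≤ c * α * KMeansOutliers.outlierOpt X k z} ∧
          KMeansOutliers.expectedSteps (P.run A T (KMeansOutliers.initMem X k z))
            ≤ ENNReal.ofReal (c * (k * d * n * Real.log n ^ 2))
              + (T ⌈c * (k * Real.log n)⌉₊ k d : ℝ≥0∞) := by
  -- The constant comes from the running time: 1000000 lg² with lg ≤ 3 log n. It exceeds the 138272
  -- = 4 · 34568 needed for the cost, the 128 for the outliers and the 144 for the number of slots.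
  refine ⟨outliersP, 2⁻¹, 9000000, by simp, ?_⟩
  intro α A T hα hA hT n d k z X hn hd hk
  have h0 : (initMem X k z).nat 0 = n := rfl
  have h1 : (initMem X k z).nat 1 = d := rfl
  have h2 : (initMem X k z).nat 2 = k := rfl
  have h3 : (initMem X k z).nat 3 = z := rfl
  have h4 : ∀ b, 4 ≤ b → (initMem X k z).nat b = 0 := by
    intro b hb
    have : b ≠ 0 ∧ b ≠ 1 ∧ b ≠ 2 ∧ b ≠ 3 := by omega
    simp [initMem, Mem.writePts, this]
  constructor
  -- These centers and their clusters occur only in the analysis.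
  · obtain ⟨C, hC⟩ := exists_near_optimal hk (by omega) z X
    choose cl hcl using fun i : ℕ => exists_distTo_eq hk ((params X k z).pt i) C
    have key := success_outliersP (A := A) (T := T) (c := params X k z) h0 h1 h2 h3 h4 rfl rfl hn hd
      hk (a := fun i => distTo ((params X k z).pt i) C ^ 2) (C := C) (cl := cl)
      fun i => by rw [← hcl i]
    refine (half_le_success (Nat.size_pos.mpr (by omega))).trans (key.trans ?_)
    rw [success_eq]
    exact MeasureTheory.measure_mono fun o ho =>
      outlierCost_of_goodOutput X k z hk hα hA hC ho (by norm_num)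
  · refine (expectedSteps_le (ensures_outliersP (A := A) (T := T) (c := params X k z) h0 h1 h2 h3 h4
      rfl rfl hn hd hk)).trans ?_
    rw [Nat.cast_add]
    refine add_le_add (totalTime_le X k z hn le_rfl) ?_
    exact_mod_cast hT k d (params_m_le X k z hn (by norm_num))
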